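/- **Setting.** Let $n\in\mathbb N$, $h,T>0$, $X=C([-h,0],\mathbb R^n)$, and let $L:\mathbb R\to\mathcal L(X,\mathbb R^n)$ be $T$-periodic and $C^1$, with kernel $\zeta$: $L(t)\varphi=\int_0^h d_2\zeta(t,\theta)\varphi(-\theta)$ (Riemann–Stieltjes), where $\zeta(t,\cdot):[0,h]\to\mathbb R^{n\times n}$ is of bounded variation, right-continuous on $(0,h)$, $\zeta(t,0)=0$, and $\zeta$ is $T$-periodic in $t$. (For the linearization of $\dot x(t)=F(x_t)$ along a $T$-periodic solution $\gamma$, $L(t)=DF(\gamma_t)$.) Everything is complexified. $C^l_T(\mathbb R,E)$ denotes the $T$-periodic $C^l$ functions $\mathbb R\to E$ and $C_T=C^0_T$. Integrals of the form $\int_a^b f(s)\,d_2\zeta(\tau+s,s)$ are limits, as the mesh tends to $0$, of $\sum_i f(c_i)[\zeta(\tau+c_i,s_{i+1})-\zeta(\tau+c_i,s_i)]$ over tagged partitions of $[a,b]$. For $z\in\mathbb C$, $q\in C_T^1(\mathbb R,\mathbb C^n)$ and $p\in C^1_T(\mathbb R,\mathbb C^{n\star})$ (row vectors) put $$(\Delta(z)q)(\tau)=\dot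 q(\tau)+zq(\tau)-\int_0^h d_2\zeta(\tau,\theta)e^{-z\theta}q(\tau-\theta),$$ $$(\Delta^\star(z)p)(\tau)=-\dot p(\tau)+zp(\tau)-\int_0^h p(\tau+\theta)e^{-z\theta}d_2\zeta(\tau+\theta,\theta),$$ $\Delta'(z)=\frac{d}{dz}\Delta(z)$ and $\langle p,q\rangle_T=\int_0^Tp(\tau)q(\tau)\,d\tau$. Let $X^{\odot\star}=\mathbb C^n\times L^\infty([-h,0],\mathbb C^n)$ and let $A^{\odot\star}(\tau)$ be the operator whose domain consists of all $(\varphi(0),\varphi)$ with $\varphi$ Lipschitz on $[-h,0]$, acting by $A^{\odot\star}(\tau)(\varphi(0),\varphi)=(L(\tau)\varphi,\varphi')$. In $C_T(\mathbb R,X^{\odot\star})$ let $(\mathcal A^{\odot\star}\phi)(\tau)=A^{\odot\star}(\tau)\phi(\tau)-\dot\phi(\tau)$, with domain all $\phi\in C_T^1(\mathbb R,X^{\odot\star})$ such that $\phi(\tau)\in\mathcal D(A^{\odot\star}(\tau))$ for all $\tau$. A number $\sigma\in\mathbb C$ is a *simple Floquet exponent* if $e^{\sigma T}$ is an eigenvalue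 of algebraic multiplicity one of the monodromy operator $x_0\mapsto x_T$ of $\dot x(t)=L(t)x_t$. For $w\in C(\mathbb R,L^\infty([-h,0],\mathbb C^n))$ the value $w(t)(s)$ refers to the representative (unique up to a $t$-independent null set of $s$) for which $t\mapsto w(t)(s)$ is continuous for almost every $s$. **Proposition 3.13.** Let $\sigma$ be a simple Floquet exponent, let $(w_0,w)\in C_T(\mathbb R,X^{\odot\star})$, and suppose that $$(\sigma I-\mathcal A^{\odot\star})(v_0,v)=(w_0,w)\qquad(1)$$ has at least one solution in $\mathcal D(\mathcal A^{\odot\star})$. Let $q\in C_T^1(\mathbb R,\mathbb C^n)$ with $\Delta(\sigma)q=0$ and $p\in C^1_T(\mathbb R,\mathbb C^{n\star})$ with $\Delta^\star(\sigma)p=0$, and put $$\varphi(\tau)(\theta)=e^{\sigma\theta}q(\tau+\theta)\ (\theta\in[-h,0]),\qquad \varphi^\odot(\tau)=(p(\tau),g(\tau)),\quad g(\tau)(\theta)=\int_\theta^he^{\sigma(\theta-s)}p(\tau+s-\theta)\,d_2\zeta(\tau+s-\theta,s)\ (\theta\in[0,h]).$$ Assume the normalization $\langle\varphi^\odot,\varphi\rangle_T:=\int_0^T\big(p(\tau)\varphi(\tau)(0)+\int_0^hg(\tau)(\theta)\varphi(\tau)(-\theta)\,d\theta\big)d\tau=1$.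 Then (1) has exactly one solution $(v_0,v)$ such that $$\langle(v_0,v),\varphi^\odot\rangle_T:=\int_0^T\Big(p(\tau)v_0(\tau)+\int_0^hg(\tau)(\theta)v(\tau)(-\theta)\,d\theta\Big)d\tau=0,$$ and it is given by $$v(\tau)(\theta)=e^{\sigma\theta}v_0(\tau+\theta)+\int_\theta^0e^{\sigma(\theta-s)}w(\tau+\theta-s)(s)\,ds\quad(\tau\in\mathbb R,\ \theta\in[-h,0]),\qquad v_0=\xi+\mu q,$$ where $\xi\in C_T^1(\mathbb R,\mathbb C^n)$ is any solution of $$(\Delta(\sigma)\xi)(\tau)=w_0(\tau)+\int_0^hd_2\zeta(\tau,\theta)\int_0^\theta e^{-\sigma s}w(\tau-s)(s-\theta)\,ds\quad(\tau\in\mathbb R)\qquad(2)$$ and $$\mu=-\langle p,\Delta'(\sigma)\xi\rangle_T-\int_0^T\int_0^h\Big(\int_\theta^he^{-\sigma s}p(s+\tau-\theta)\,d_2\zeta(\tau+s-\theta,s)\Big)\Big(\int_{-\theta}^0e^{-\sigma r}w(\tau-\theta-r)(r)\,dr\Big)d\theta\,d\tau.$$ Equation (2) has a solution $\xi\in C_T^1(\mathbb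 R,\mathbb C^n)$. If $\langle p,q\rangle_T\neq0$, exactly one solution of (2) satisfies $\langle p,\xi\rangle_T=0$: this is the bordered inverse $\xi=\Delta(\sigma)^{\mathrm{INV}}(\text{right-hand side of (2)})$. -/

import Mathlib

open MeasureTheory Set Filter Topology

noncomputable section

namespace PeriodicDDE

/-! ### Riemann-Stieltjes integrals

For `G : ℝ → ℝ → E`, written `G c s`, these are the integrals `∫_a^b d_s G(c, s)|_{c = s}`:
the limit of `∑ (G(c_i, s_{i+1}) - G(c_i, s_i))` over tagged partitions of `[a,b]` whose mesh tends
to zero.  For `G c s = ζ(s) f(c)` this is the usual `∫_a^b dζ(s) f(s)`; for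
`G c s = f(c) ζ(t + c, s)` it is `∫_a^b f(s) d_2 ζ(t + s, s)`. -/

/-- `I` is the limit of the Riemann-Stieltjes sums of `G` over `[a,b]`. -/
def HasRSInt {E : Type*} [NormedAddCommGroup E] (G : ℝ → ℝ → E) (a b : ℝ) (I : E) : Prop :=
  ∀ ε > 0, ∃ δ > 0, ∀ (N : ℕ) (s c : ℕ → ℝ), s 0 = a → s N = b →
    (∀ i < N, s i ≤ c i ∧ c i ≤ s (i + 1) ∧ s (i + 1) - s i < δ) →
    ‖(∑ i ∈ Finset.range N, (G (c i) (s (i + 1)) - G (c i) (s i))) - I‖ < ε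

open scoped Classical in
/-- The Riemann-Stieltjes integral (zero if the sums do not converge). -/
def rsInt {E : Type*} [NormedAddCommGroup E] (G : ℝ → ℝ → E) (a b : ℝ) : E :=
  if H : ∃ I, HasRSInt G a b I then H.choose else 0

/-! ### The kernel of a family of operators `L(t)` on `X = C([-h,0], ℝⁿ)` -/

/-- `ζ` is the kernel of the `T`-periodic family `L(t)`: `ζ(t,·)` is a matrix-valued function of
bounded variation on `[0,h]`, right-continuous on `(0,h)`, `ζ(t,0) = 0`, `ζ` is `T`-periodic in
`t`, and `L(t)φ = ∫_0^h d_2ζ(t,θ) φ(-θ)`. -/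
structure IsKernel {n : ℕ} (h T : ℝ) (hh : 0 < h)
    (L : ℝ → C(Icc (-h) 0, Fin n → ℝ) →L[ℝ] (Fin n → ℝ))
    (ζ : ℝ → ℝ → Matrix (Fin n) (Fin n) ℝ) : Prop where
  boundedVariation : ∀ t i j, BoundedVariationOn (fun θ => ζ t θ i j) (Icc 0 h)
  rightContinuous : ∀ t i j, ∀ θ ∈ Ioo 0 h, ContinuousWithinAt (fun θ => ζ t θ i j) (Ici θ) θ
  zero : ∀ t, ζ t 0 = 0
  periodic : ∀ t, ∀ θ ∈ Icc 0 h, ζ (t + T) θ = ζ t θ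
  represents : ∀ t (φ : C(Icc (-h) 0, Fin n → ℝ)),
    HasRSInt (fun c s => (ζ t s).mulVec (IccExtend (neg_nonpos.mpr hh.le) φ (-c))) 0 h (L t φ)

/-- The real matrix `ζ(t,θ)` as a complex matrix. -/
def cMat {n : ℕ} (ζ : ℝ → ℝ → Matrix (Fin n) (Fin n) ℝ) (t θ : ℝ) : Matrix (Fin n) (Fin n) ℂ :=
  (ζ t θ).map (fun x : ℝ => (x : ℂ))

/-- `∫_0^h d_2ζ(t,θ) f(θ)`.  With `f(θ) = φ(-θ)` this is (the complexification of) `L(t)φ`. -/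
def kerInt {n : ℕ} (h : ℝ) (ζ : ℝ → ℝ → Matrix (Fin n) (Fin n) ℝ) (t : ℝ)
    (f : ℝ → Fin n → ℂ) : Fin n → ℂ :=
  rsInt (fun c s => (cMat ζ t s).mulVec (f c)) 0 h

/-! ### Floquet exponents -/

/-- The graph of `U(t,s)` on `C([-h,0], ℂⁿ)`: `U(t,s)φ = ψ` if `ψ = x_t` for the solution `x` on
`[s-h,∞)` of `x'(r) = L(r) x_r`, `r ≥ s`, with `x_s = φ`. -/
def Evolves {n : ℕ} (h : ℝ) (ζ : ℝ → ℝ → Matrix (Fin n) (Fin n) ℝ) (s t : ℝ)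
    (φ ψ : C(Icc (-h) 0, Fin n → ℂ)) : Prop :=
  ∃ x : ℝ → Fin n → ℂ, ContinuousOn x (Ici (s - h)) ∧
    (∀ θ : Icc (-h) 0, x (s + θ) = φ θ) ∧
    (∀ r ≥ s, HasDerivWithinAt x (kerInt h ζ r (fun θ => x (r - θ))) (Ici s) r) ∧
    (∀ θ : Icc (-h) 0, x (t + θ) = ψ θ)

/-- For an operator `R` given by its graph: `(lam - R)^k φ = 0`. -/
def InKerPow {E : Type*} [AddCommGroup E] [Module ℂ E] (R : E → E → Prop) (lam : ℂ) : ℕ → E → Prop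
  | 0, φ => φ = 0
  | k + 1, φ => ∃ ψ, R φ ψ ∧ InKerPow R lam k (lam • φ - ψ)

/-- The algebraic multiplicity of `lam`, i.e. the dimension of its generalized eigenspace
`⋃_k N((lam - U(T,0))^k)`, with `U(T,0)` the monodromy operator. -/
def algMult {n : ℕ} (h T : ℝ) (ζ : ℝ → ℝ → Matrix (Fin n) (Fin n) ℝ) (lam : ℂ) : ℕ :=
  Module.finrank ℂ (Submodule.span ℂ
    {φ : C(Icc (-h) 0, Fin n → ℂ) | ∃ k, InKerPow (Evolves h ζ 0 T) lam k φ})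

/-- `σ` is a simple Floquet exponent: `e^{σT}` is a Floquet multiplier of algebraic
multiplicity one. -/
def IsSimpleFloquetExponent {n : ℕ} (h T : ℝ) (ζ : ℝ → ℝ → Matrix (Fin n) (Fin n) ℝ)
    (σ : ℂ) : Prop :=
  algMult h T ζ (Complex.exp (σ * T)) = 1

/-! ### Characteristic operators -/

/-- `f ∈ C_T^l(ℝ, E)`. -/
def IsCT {E : Type*} [NormedAddCommGroup E] [NormedSpace ℝ E] (T : ℝ) (l : ℕ) (f : ℝ → E) : Prop :=
  ContDiff ℝ l f ∧ Function.Periodic f T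

/-- `(Δ(z)q)(τ) = q'(τ) + z q(τ) - ∫_0^h d_2ζ(τ,θ) e^{-zθ} q(τ-θ)`. -/
def charOp {n : ℕ} (h : ℝ) (ζ : ℝ → ℝ → Matrix (Fin n) (Fin n) ℝ) (z : ℂ)
    (q : ℝ → Fin n → ℂ) (τ : ℝ) : Fin n → ℂ :=
  deriv q τ + z • q τ - kerInt h ζ τ (fun θ => Complex.exp (-z * θ) • q (τ - θ))

/-- `(Δ'(z)q)(τ)`, the derivative of `Δ(z)q` with respect to `z`. -/
def charOpDeriv {n : ℕ} (h : ℝ) (ζ : ℝ → ℝ → Matrix (Fin n) (Fin n) ℝ) (z : ℂ)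
    (q : ℝ → Fin n → ℂ) (τ : ℝ) : Fin n → ℂ :=
  deriv (fun z' : ℂ => charOp h ζ z' q τ) z

/-- `(Δ*(z)p)(τ) = -p'(τ) + z p(τ) - ∫_0^h p(τ+θ) e^{-zθ} d_2ζ(τ+θ,θ)`, for row vectors `p`. -/
def charOpAdj {n : ℕ} (h : ℝ) (ζ : ℝ → ℝ → Matrix (Fin n) (Fin n) ℝ) (z : ℂ)
    (p : ℝ → Fin n → ℂ) (τ : ℝ) : Fin n → ℂ :=
  -deriv p τ + z • p τ -
    rsInt (fun c s => Matrix.vecMul (Complex.exp (-z * c) • p (τ + c)) (cMat ζ (τ + c) s)) 0 h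

/-- `⟨p,q⟩_T = ∫_0^T p(τ) q(τ) dτ`, for a row vector `p(τ)` and a column vector `q(τ)`. -/
def pairT {n : ℕ} (T : ℝ) (p q : ℝ → Fin n → ℂ) : ℂ :=
  ∫ τ in (0 : ℝ)..T, p τ ⬝ᵥ q τ

/-- `ξ = Δ(σ)^{INV} w`: `ξ ∈ C_T^1` with `Δ(σ)ξ = w` and `⟨p,ξ⟩_T = 0`. -/
def IsBorderedSol {n : ℕ} (h T : ℝ) (ζ : ℝ → ℝ → Matrix (Fin n) (Fin n) ℝ) (σ : ℂ)
    (p w ξ : ℝ → Fin n → ℂ) : Prop :=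
  IsCT T 1 ξ ∧ (∀ τ, charOp h ζ σ ξ τ = w τ) ∧ pairT T p ξ = 0

/-! ### The space `X^{⊙*}` and the operators `A^{⊙*}(τ)` and `𝒜^{⊙*}` -/

/-- `X^{⊙*} = ℂⁿ × L^∞([-h,0], ℂⁿ)`. -/
abbrev XSunStar (n : ℕ) (h : ℝ) : Type :=
  (Fin n → ℂ) × Lp (Fin n → ℂ) ⊤ ((volume : Measure ℝ).restrict (Icc (-h) 0))

/-- `x = (φ(0), φ)` with `φ` Lipschitz on `[-h,0]`. -/
def IsLipRep {n : ℕ} {h : ℝ} (x : XSunStar n h) (φ : ℝ → Fin n → ℂ) : Prop :=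
  (∃ K, LipschitzOnWith K φ (Icc (-h) 0)) ∧ x.1 = φ 0 ∧
    (x.2 : ℝ → Fin n → ℂ) =ᵐ[(volume : Measure ℝ).restrict (Icc (-h) 0)] φ

/-- The graph of `A^{⊙*}(τ)`: the domain consists of the `(φ(0), φ)` with `φ` Lipschitz, and
`A^{⊙*}(τ)(φ(0), φ) = (L(τ)φ, φ')`. -/
def SunStarGen {n : ℕ} {h : ℝ} (ζ : ℝ → ℝ → Matrix (Fin n) (Fin n) ℝ) (τ : ℝ)
    (x y : XSunStar n h) : Prop :=
  ∃ φ : ℝ → Fin n → ℂ, IsLipRep x φ ∧ y.1 = kerInt h ζ τ (fun θ => φ (-θ)) ∧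
    (y.2 : ℝ → Fin n → ℂ) =ᵐ[(volume : Measure ℝ).restrict (Icc (-h) 0)] deriv φ

/-- The graph of `𝒜^{⊙*}` in `C_T(ℝ, X^{⊙*})`: `v ∈ C_T^1(ℝ, X^{⊙*})` is in the domain if
`v(τ) ∈ D(A^{⊙*}(τ))` for all `τ`, and `(𝒜^{⊙*}v)(τ) = A^{⊙*}(τ)v(τ) - v'(τ)`. -/
def CurlySunStar {n : ℕ} {h : ℝ} (T : ℝ) (ζ : ℝ → ℝ → Matrix (Fin n) (Fin n) ℝ)
    (v y : ℝ → XSunStar n h) : Prop :=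
  IsCT T 1 v ∧ IsCT T 0 y ∧ ∀ τ, SunStarGen ζ τ (v τ) (y τ + deriv v τ)

/-- `v ∈ D(𝒜^{⊙*})` and `(z - 𝒜^{⊙*})v = w`. -/
def Solves {n : ℕ} {h : ℝ} (T : ℝ) (ζ : ℝ → ℝ → Matrix (Fin n) (Fin n) ℝ) (z : ℂ)
    (w v : ℝ → XSunStar n h) : Prop :=
  CurlySunStar T ζ v (fun τ => z • v τ - w τ)

/-- The value `w(t)(s)` of the second component of `w ∈ C(ℝ, X^{⊙*})`.  Since `w(t)` is only a
class in `L^∞`, expressions such as `s ↦ w(u-s)(s)` need a representative: this is the one (unique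
up to a `t`-independent null set of `s`) for which `t ↦ w(t)(s)` is continuous for almost
every `s`. -/
def ev {n : ℕ} {h : ℝ} (w : ℝ → XSunStar n h) (t s : ℝ) : Fin n → ℂ :=
  limUnder atTop (fun m : ℕ => ((w ((⌊(m : ℝ) * t⌋ : ℝ) / m)).2 : ℝ → Fin n → ℂ) s)

/-- The pairing of `(c,g) ∈ X^⊙ = ℂ^{n*} × L¹([0,h], ℂ^{n*})` with `(a,ψ)`:
`c a + ∫_0^h g(θ) ψ(-θ) dθ`. -/
def pairSun {n : ℕ} (h : ℝ) (c : Fin n → ℂ) (g : ℝ → Fin n → ℂ) (a : Fin n → ℂ)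
    (ψ : ℝ → Fin n → ℂ) : ℂ :=
  c ⬝ᵥ a + ∫ θ in (0 : ℝ)..h, g θ ⬝ᵥ ψ (-θ)

/-- The second component of the adjoint eigenfunction `φ^⊙(τ) = (p(τ), g(τ))`:
`g(τ)(θ) = ∫_θ^h e^{σ(θ-s)} p(τ+s-θ) d_2ζ(τ+s-θ,s)`. -/
def adjEig {n : ℕ} (h : ℝ) (ζ : ℝ → ℝ → Matrix (Fin n) (Fin n) ℝ) (σ : ℂ)
    (p : ℝ → Fin n → ℂ) (τ θ : ℝ) : Fin n → ℂ :=
  rsInt (fun c s => Matrix.vecMul (Complex.exp (σ * (θ - c)) • p (τ + c - θ))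
    (cMat ζ (τ + c - θ) s)) θ h

/-- The eigenfunction `φ(τ)(θ) = e^{σθ} q(τ+θ)`. -/
def eig {n : ℕ} (σ : ℂ) (q : ℝ → Fin n → ℂ) (τ θ : ℝ) : Fin n → ℂ :=
  Complex.exp (σ * θ) • q (τ + θ)

/-- `⟨φ^⊙, φ⟩_T` for the adjoint eigenfunction `φ^⊙` given by `p` and the eigenfunction `φ`
given by `q`. -/
def pairEig {n : ℕ} (h T : ℝ) (ζ : ℝ → ℝ → Matrix (Fin n) (Fin n) ℝ) (σ : ℂ)
    (p q : ℝ → Fin n → ℂ) : ℂ :=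
  ∫ τ in (0 : ℝ)..T, pairSun h (p τ) (adjEig h ζ σ p τ) (eig σ q τ 0) (eig σ q τ)

/-- `⟨v, φ^⊙⟩_T` for `v : ℝ → X^{⊙*}` and the adjoint eigenfunction `φ^⊙` given by `p`. -/
def pairSunStar {n : ℕ} {h : ℝ} (T : ℝ) (ζ : ℝ → ℝ → Matrix (Fin n) (Fin n) ℝ) (σ : ℂ)
    (p : ℝ → Fin n → ℂ) (v : ℝ → XSunStar n h) : ℂ :=
  ∫ τ in (0 : ℝ)..T, pairSun h (p τ) (adjEig h ζ σ p τ) (v τ).1 ((v τ).2 : ℝ → Fin n → ℂ)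

/-! ### The objects in the explicit solution -/

/-- `w_0(τ) + ∫_0^h d_2ζ(τ,θ) ∫_0^θ e^{-σs} w(τ-s)(s-θ) ds`. -/
def xiRhs {n : ℕ} {h : ℝ} (ζ : ℝ → ℝ → Matrix (Fin n) (Fin n) ℝ) (σ : ℂ)
    (w : ℝ → XSunStar n h) (τ : ℝ) : Fin n → ℂ :=
  (w τ).1 + kerInt h ζ τ
    (fun θ => ∫ s in (0 : ℝ)..θ, Complex.exp (-σ * s) • ev w (τ - s) (s - θ))

/-- `μ = -⟨p,Δ'(σ)ξ⟩_T - ∫_0^T ∫_0^h (∫_θ^h e^{-σs} p(s+τ-θ) d_2ζ(τ+s-θ,s))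
(∫_{-θ}^0 e^{-σr} w(τ-θ-r)(r) dr) dθ dτ`. -/
def muCoeff {n : ℕ} {h : ℝ} (T : ℝ) (ζ : ℝ → ℝ → Matrix (Fin n) (Fin n) ℝ) (σ : ℂ)
    (w : ℝ → XSunStar n h) (p ξ : ℝ → Fin n → ℂ) : ℂ :=
  -pairT T p (charOpDeriv h ζ σ ξ) -
    ∫ τ in (0 : ℝ)..T, ∫ θ in (0 : ℝ)..h,
      rsInt (fun c s => Matrix.vecMul (Complex.exp (-σ * c) • p (c + τ - θ))
        (cMat ζ (τ + c - θ) s)) θ h ⬝ᵥ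
      ∫ r in (-θ)..(0 : ℝ), Complex.exp (-σ * r) • ev w (τ - θ - r) r

/-- `e^{σθ} v_0(τ+θ) + ∫_θ^0 e^{σ(θ-s)} w(τ+θ-s)(s) ds`. -/
def varConst {n : ℕ} {h : ℝ} (σ : ℂ) (w : ℝ → XSunStar n h) (v0 : ℝ → Fin n → ℂ)
    (τ θ : ℝ) : Fin n → ℂ :=
  Complex.exp (σ * θ) • v0 (τ + θ) +
    ∫ s in θ..(0 : ℝ), Complex.exp (σ * (θ - s)) • ev w (τ + θ - s) s

end PeriodicDDE

end

/-! Everything is read off from first components. If `(v₀, v)` solves the resolvent equation, its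
second component obeys the transport equation `∂_θ v = σ v + ∂_τ v - w`. Integrating it along the
lines where `τ + θ` is constant gives the variation-of-constants formula (`eq_varConst`). So a
solution is determined by `v₀`, and inserting the formula into the boundary component shows that
`v₀` solves `Δ(σ)v₀ = xiRhs` (`charOp_fst_eq`). In particular a solution `ξ` of the characteristic
equation exists.

The pairing also depends on `v₀` only: `⟨v, φ^⊙⟩_T = -μ(v₀)` (`pairSunStar_eq`), where `μ` is
`muCoeff`. Behind this is the identity `integral_adjInt`, which says that the integral part of
`⟨φ^⊙, φ⟩_T` is the integral part of `⟨p, Δ'(σ)q⟩_T`. It makes the normalization read `⟨p, Δ'(σ)q⟩_T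
= 1`, whence `μ(ξ - cq) = μ(ξ) + c` (`muCoeff_sub_smul`).

Finally `ker Δ(σ)` is spanned by `q`: if `Δ(σ)q = 0`, then `e^{σt}q(t)` solves the delay equation
and its segment on `[-h,0]` lies in the eigenspace of the monodromy operator, which has multiplicity
one (`exists_eq_smul_of_charOp_eq_zero`). Subtracting from a given solution its pairing times the
eigencurve gives `v` with `μ(v₀) = 0`. Any other `ξ` is `v₀ - dq`, so `μ(ξ) = d` and `v₀ = ξ +
μ(ξ)q`. Uniqueness follows by taking for `ξ` the first component of a competing solution.

Two analytic points need care. The integrals `∫ f(s) d₂ζ(t+s,s)` have a kernel that moves with the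
integration variable; their existence and bounds come from viewing `t ↦ L(t)` as a `C¹` path of
functionals (`exists_hasRSInt_path`). And `w(t)` is only a class in `L^∞`, so the chain rule along a
characteristic is replaced by an averaging argument (`transport_along_characteristic`). -/

namespace PeriodicDDE

/-! ### Tagged partitions and Riemann-Stieltjes sums -/

/-- A tagged partition of `[a,b]` with mesh less than `δ`. -/
structure IsTagged (a b δ : ℝ) (N : ℕ) (s c : ℕ → ℝ) : Prop where
  left : s 0 = a
  right : s N = b
  cell : ∀ i < N, s i ≤ c i ∧ c i ≤ s (i + 1) ∧ s (i + 1) - s i < δ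

/-- The Riemann-Stieltjes sum of `G` over a tagged partition. -/
def rsSum {E : Type*} [AddCommGroup E] (G : ℝ → ℝ → E) (N : ℕ) (s c : ℕ → ℝ) : E :=
  ∑ i ∈ Finset.range N, (G (c i) (s (i + 1)) - G (c i) (s i))

namespace IsTagged

variable {a b δ : ℝ} {N : ℕ} {s c : ℕ → ℝ}

lemma le_of_le (hP : IsTagged a b δ N s c) {i j : ℕ} (hij : i ≤ j) (hj : j ≤ N) : s i ≤ s j := by
  induction j, hij using Nat.le_induction with
  | base => exact le_rfl
  | succ k hk ih =>
    have := hP.cell k (by omega)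
    exact (ih (by omega)).trans (this.1.trans this.2.1)

lemma le_node (hP : IsTagged a b δ N s c) {i : ℕ} (hi : i ≤ N) : a ≤ s i :=
  hP.left ▸ hP.le_of_le (Nat.zero_le i) hi

lemma node_le (hP : IsTagged a b δ N s c) {i : ℕ} (hi : i ≤ N) : s i ≤ b :=
  hP.right ▸ hP.le_of_le hi le_rfl

lemma node_mem (hP : IsTagged a b δ N s c) {i : ℕ} (hi : i ≤ N) : s i ∈ Icc a b :=
  ⟨hP.le_node hi, hP.node_le hi⟩

lemma tag_mem (hP : IsTagged a b δ N s c) {i : ℕ} (hi : i < N) : c i ∈ Icc a b :=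
  ⟨(hP.le_node hi.le).trans (hP.cell i hi).1, (hP.cell i hi).2.1.trans (hP.node_le hi)⟩

lemma tag_le_succ (hP : IsTagged a b δ N s c) {i : ℕ} (hi : i + 1 < N) : c i ≤ c (i + 1) :=
  (hP.cell i (by omega)).2.1.trans (hP.cell (i + 1) hi).1

lemma mono (hP : IsTagged a b δ N s c) {δ' : ℝ} (h : δ ≤ δ') : IsTagged a b δ' N s c :=
  ⟨hP.left, hP.right, fun i hi => ⟨(hP.cell i hi).1, (hP.cell i hi).2.1,
    (hP.cell i hi).2.2.trans_le h⟩⟩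

end IsTagged

/-- The nodes of the partition of `[a,b]` into `N` equal cells. -/
noncomputable def uniformNode (a b : ℝ) (N i : ℕ) : ℝ := a + i * ((b - a) / N)

lemma uniformNode_tagged {a b δ : ℝ} (hab : a ≤ b) {N : ℕ} (hN : 0 < N) (hδ : (b - a) / N < δ) :
    IsTagged a b δ N (uniformNode a b N) (uniformNode a b N) := by
  have hN' : (N : ℝ) ≠ 0 := by positivity
  have h0 : 0 ≤ (b - a) / N := div_nonneg (by linarith) (by positivity)
  refine ⟨by simp [uniformNode], by simp only [uniformNode]; field_simp; ring, fun i _ => ?_⟩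
  simp only [uniformNode]
  push_cast
  refine ⟨le_rfl, by nlinarith, by linarith⟩

lemma eventually_uniformNode_tagged {a b δ : ℝ} (hab : a ≤ b) (hδ : 0 < δ) :
    ∀ᶠ N : ℕ in atTop, IsTagged a b δ N (uniformNode a b N) (uniformNode a b N) := by
  have h1 : Tendsto (fun N : ℕ => (b - a) / N) atTop (𝓝 0) :=
    tendsto_const_div_atTop_nhds_zero_nat (b - a)
  filter_upwards [h1.eventually (gt_mem_nhds hδ), eventually_gt_atTop 0] with N h2 h3
  exact uniformNode_tagged hab h3 h2

lemma exists_tagged {a b δ : ℝ} (hab : a ≤ b) (hδ : 0 < δ) : ∃ N s c, IsTagged a b δ N s c :=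
  let ⟨N, hN⟩ := (eventually_uniformNode_tagged hab hδ).exists
  ⟨N, _, _, hN⟩

section RS

variable {E F : Type*} [NormedAddCommGroup E] [NormedAddCommGroup F]
  {G G' : ℝ → ℝ → E} {a b : ℝ} {I I' : E}

lemma hasRSInt_iff : HasRSInt G a b I ↔ ∀ ε > 0, ∃ δ > 0, ∀ N s c, IsTagged a b δ N s c →
    ‖rsSum G N s c - I‖ < ε := by
  refine forall₂_congr fun ε _ => exists_congr fun δ => and_congr_right fun _ =>
    forall₃_congr fun N s c => ?_
  exact ⟨fun H hP => H hP.left hP.right hP.cell, fun H h1 h2 h3 => H ⟨h1, h2, h3⟩⟩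

lemma rsSum_congr {δ : ℝ} {N : ℕ} {s c : ℕ → ℝ} (hP : IsTagged a b δ N s c)
    (h : ∀ c ∈ Icc a b, ∀ s ∈ Icc a b, G c s = G' c s) : rsSum G N s c = rsSum G' N s c :=
  Finset.sum_congr rfl fun i hi => by
    have hi' := Finset.mem_range.mp hi
    rw [h _ (hP.tag_mem hi') _ (hP.node_mem hi'), h _ (hP.tag_mem hi') _ (hP.node_mem hi'.le)]

lemma HasRSInt.congr (H : HasRSInt G a b I)
    (h : ∀ c ∈ Icc a b, ∀ s ∈ Icc a b, G c s = G' c s) : HasRSInt G' a b I := by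
  rw [hasRSInt_iff] at H ⊢
  intro ε hε
  obtain ⟨δ, hδ, H⟩ := H ε hε
  exact ⟨δ, hδ, fun N s c hP => by rw [← rsSum_congr hP h]; exact H N s c hP⟩

lemma HasRSInt.tendsto (H : HasRSInt G a b I) (hab : a ≤ b) :
    Tendsto (fun N => rsSum G N (uniformNode a b N) (uniformNode a b N)) atTop (𝓝 I) := by
  rw [Metric.tendsto_atTop']
  intro ε hε
  obtain ⟨δ, hδ, H⟩ := hasRSInt_iff.mp H ε hε
  obtain ⟨N₀, hN₀⟩ := eventually_atTop.mp (eventually_uniformNode_tagged hab hδ)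
  exact ⟨N₀, fun N hN => by rw [dist_eq_norm]; exact H _ _ _ (hN₀ N hN.le)⟩

lemma HasRSInt.unique (H : HasRSInt G a b I) (H' : HasRSInt G a b I') (hab : a ≤ b) : I = I' :=
  tendsto_nhds_unique (H.tendsto hab) (H'.tendsto hab)

lemma HasRSInt.rsInt_eq (H : HasRSInt G a b I) (hab : a ≤ b) : rsInt G a b = I := by
  have hex : ∃ I, HasRSInt G a b I := ⟨I, H⟩
  rw [rsInt, dif_pos hex]
  exact hex.choose_spec.unique H hab

lemma rsInt_congr (h : ∀ c ∈ Icc a b, ∀ s ∈ Icc a b, G c s = G' c s) :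
    rsInt G a b = rsInt G' a b := by
  have hG : HasRSInt G a b = HasRSInt G' a b := by
    ext I
    exact ⟨fun H => H.congr h, fun H => H.congr fun c hc s hs => (h c hc s hs).symm⟩
  -- `rsInt` selects its value by choice, so equality of the integrals is drawn from equality of the
  -- predicates, not from uniqueness of limits; this needs neither convergence nor `a ≤ b`.
  have key : ∀ P Q : E → Prop, P = Q → (open scoped Classical in
      (if H : ∃ I, P I then H.choose else 0) = if H : ∃ I, Q I then H.choose else 0) := by
    rintro P _ rfl
    rfl
  exact key _ _ hG

lemma HasRSInt.add (H : HasRSInt G a b I) (H' : HasRSInt G' a b I') :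
    HasRSInt (fun c s => G c s + G' c s) a b (I + I') := by
  rw [hasRSInt_iff] at *
  intro ε hε
  obtain ⟨δ, hδ, H⟩ := H (ε / 2) (by positivity)
  obtain ⟨δ', hδ', H'⟩ := H' (ε / 2) (by positivity)
  refine ⟨min δ δ', lt_min hδ hδ', fun N s c hP => ?_⟩
  have e : rsSum (fun c s => G c s + G' c s) N s c - (I + I')
      = (rsSum G N s c - I) + (rsSum G' N s c - I') := by
    have : rsSum (fun c s => G c s + G' c s) N s c = rsSum G N s c + rsSum G' N s c := by
      simp only [rsSum, ← Finset.sum_add_distrib]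
      exact Finset.sum_congr rfl fun i _ => by abel
    rw [this]; abel
  rw [e]
  calc _ ≤ _ := norm_add_le _ _
    _ < ε / 2 + ε / 2 := add_lt_add (H N s c (hP.mono (min_le_left _ _)))
        (H' N s c (hP.mono (min_le_right _ _)))
    _ = ε := by ring

lemma rsSum_map (A : E →+ F) (N : ℕ) (s c : ℕ → ℝ) :
    rsSum (fun c s => A (G c s)) N s c = A (rsSum G N s c) := by
  simp [rsSum, map_sum]

lemma HasRSInt.map (H : HasRSInt G a b I) (A : E →+ F) {K : ℝ} (hA : ∀ x, ‖A x‖ ≤ K * ‖x‖) :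
    HasRSInt (fun c s => A (G c s)) a b (A I) := by
  rw [hasRSInt_iff] at *
  intro ε hε
  obtain ⟨δ, hδ, H⟩ := H (ε / (|K| + 1)) (by positivity)
  refine ⟨δ, hδ, fun N s c hP => ?_⟩
  rw [rsSum_map, ← map_sub]
  have h1 := H N s c hP
  rw [lt_div_iff₀ (by positivity)] at h1
  nlinarith [hA (rsSum G N s c - I), le_abs_self K, norm_nonneg (rsSum G N s c - I)]

lemma hasRSInt_zero (a b : ℝ) : HasRSInt (fun _ _ => (0 : E)) a b 0 := by
  rw [hasRSInt_iff]
  exact fun ε hε => ⟨1, one_pos, fun N s c _ => by simpa [rsSum] using hε⟩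

lemma HasRSInt.const_smul {𝕜 : Type*} [NormedField 𝕜] [NormedSpace 𝕜 E] (k : 𝕜)
    (H : HasRSInt G a b I) : HasRSInt (fun c s => k • G c s) a b (k • I) :=
  H.map (DistribSMul.toAddMonoidHom E k) (K := ‖k‖) fun x => (norm_smul k x).le

lemma HasRSInt.finset_sum {ι : Type*} {S : Finset ι} {G : ι → ℝ → ℝ → E} {I : ι → E}
    (H : ∀ i ∈ S, HasRSInt (G i) a b (I i)) :
    HasRSInt (fun c s => ∑ i ∈ S, G i c s) a b (∑ i ∈ S, I i) := by
  classical
  induction S using Finset.induction_on with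
  | empty => simpa using hasRSInt_zero a b
  | insert i S hi ih =>
    simp only [Finset.sum_insert hi]
    exact (H i (Finset.mem_insert_self _ _)).add
      (ih fun j hj => H j (Finset.mem_insert_of_mem hj))

lemma rsSum_apply {ι : Type*} {E : ι → Type*} [∀ i, NormedAddCommGroup (E i)]
    (G : ℝ → ℝ → ∀ i, E i) (N : ℕ) (s c : ℕ → ℝ) (i : ι) :
    rsSum G N s c i = rsSum (fun c s => G c s i) N s c := by
  simp [rsSum, Finset.sum_apply]

lemma hasRSInt_pi {ι : Type*} [Fintype ι] {E : ι → Type*} [∀ i, NormedAddCommGroup (E i)]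
    {G : ℝ → ℝ → ∀ i, E i} {I : ∀ i, E i}
    (H : ∀ i, HasRSInt (fun c s => G c s i) a b (I i)) : HasRSInt G a b I := by
  simp only [hasRSInt_iff] at *
  intro ε hε
  choose δ hδ H using fun i => H i ε hε
  obtain ⟨d, hd, hle⟩ : ∃ d > 0, ∀ i, d ≤ δ i := by
    rcases isEmpty_or_nonempty ι with h | h
    · exact ⟨1, one_pos, fun i => h.elim i⟩
    · obtain ⟨i₀, hi₀⟩ := Finite.exists_min δ
      exact ⟨δ i₀, hδ i₀, hi₀⟩
  refine ⟨d, hd, fun N s c hP => ?_⟩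
  rw [pi_norm_lt_iff hε]
  intro i
  rw [Pi.sub_apply, rsSum_apply]
  exact H i N s c (hP.mono (hle i))

lemma HasRSInt.apply {ι : Type*} [Fintype ι] {E : ι → Type*} [∀ i, NormedAddCommGroup (E i)]
    {G : ℝ → ℝ → ∀ i, E i} {I : ∀ i, E i} (H : HasRSInt G a b I) (i : ι) :
    HasRSInt (fun c s => G c s i) a b (I i) :=
  H.map (Pi.evalAddMonoidHom E i) (K := 1) fun x => by simpa using norm_le_pi_norm x i

lemma HasRSInt.norm_le (H : HasRSInt G a b I) (hab : a ≤ b) {C : ℝ}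
    (hC : ∀ N s c, IsTagged a b 1 N s c → ‖rsSum G N s c‖ ≤ C) : ‖I‖ ≤ C := by
  refine le_of_tendsto (H.tendsto hab).norm ?_
  filter_upwards [eventually_uniformNode_tagged hab one_pos] with N hN
  exact hC _ _ _ hN

/-- Riemann-Stieltjes integrability is stable under uniform approximation of the sums. -/
lemma exists_hasRSInt_of_approx [CompleteSpace E] (hab : a ≤ b)
    (H : ∀ ε > 0, ∃ G' I', HasRSInt G' a b I' ∧ ∃ δ > 0, ∀ N s c, IsTagged a b δ N s c →
      ‖rsSum G N s c - rsSum G' N s c‖ ≤ ε) : ∃ I, HasRSInt G a b I := by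
  have key : ∀ ε > 0, ∃ J : E, ∃ δ > 0, ∀ N s c, IsTagged a b δ N s c → ‖rsSum G N s c - J‖ < ε := by
    intro ε hε
    obtain ⟨G', J, hJ, δ, hδ, h1⟩ := H (ε / 2) (by positivity)
    obtain ⟨δ', hδ', h2⟩ := hasRSInt_iff.mp hJ (ε / 2) (by positivity)
    refine ⟨J, min δ δ', lt_min hδ hδ', fun N s c hP => ?_⟩
    calc _ = ‖(rsSum G N s c - rsSum G' N s c) + (rsSum G' N s c - J)‖ := by abel_nf
      _ ≤ _ := norm_add_le _ _
      _ < ε / 2 + ε / 2 := add_lt_add_of_le_of_lt (h1 N s c (hP.mono (min_le_left _ _)))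
        (h2 N s c (hP.mono (min_le_right _ _)))
      _ = ε := by ring
  have hc : CauchySeq fun N => rsSum G N (uniformNode a b N) (uniformNode a b N) := by
    rw [Metric.cauchySeq_iff']
    intro ε hε
    obtain ⟨J, δ, hδ, h1⟩ := key (ε / 2) (by positivity)
    obtain ⟨N₀, hN₀⟩ := eventually_atTop.mp (eventually_uniformNode_tagged hab hδ)
    refine ⟨N₀, fun N hN => ?_⟩
    have := h1 _ _ _ (hN₀ N hN)
    have h3 := h1 _ _ _ (hN₀ N₀ le_rfl)
    rw [← dist_eq_norm] at this h3
    linarith [dist_triangle_right (rsSum G N (uniformNode a b N) (uniformNode a b N))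
      (rsSum G N₀ (uniformNode a b N₀) (uniformNode a b N₀)) J]
  obtain ⟨I, hI⟩ := cauchySeq_tendsto_of_complete hc
  refine ⟨I, hasRSInt_iff.mpr fun ε hε => ?_⟩
  obtain ⟨J, δ, hδ, h1⟩ := key (ε / 2) (by positivity)
  have h2 : ‖I - J‖ ≤ ε / 2 := by
    refine le_of_tendsto (hI.sub_const J).norm ?_
    filter_upwards [eventually_uniformNode_tagged hab hδ] with N hN
    exact (h1 _ _ _ hN).le
  refine ⟨δ, hδ, fun N s c hP => ?_⟩
  calc _ = ‖(rsSum G N s c - J) - (I - J)‖ := by abel_nf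
    _ ≤ _ := norm_sub_le _ _
    _ < ε / 2 + ε / 2 := add_lt_add_of_lt_of_le (h1 N s c hP) h2
    _ = ε := by ring

lemma IsTagged.append {a b d δ : ℝ} {N M : ℕ} {s c s' c' : ℕ → ℝ} (hP : IsTagged a b δ N s c)
    (hQ : IsTagged b d δ M s' c') :
    IsTagged a d δ (N + M) (fun i => if i < N then s i else s' (i - N))
      (fun i => if i < N then c i else c' (i - N)) := by
  refine ⟨?_, by simp [hQ.right], fun i hi => ?_⟩
  · rcases Nat.eq_zero_or_pos N with h | h
    · subst h
      simp [hQ.left, ← hP.right, hP.left]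
    · simp [h, hP.left]
  · rcases lt_trichotomy (i + 1) N with h | h | h
    · simpa [h, (show i < N by omega)] using hP.cell i (by omega)
    · have := hP.cell i (by omega)
      subst h
      rw [hP.right] at this
      simpa [hQ.left] using this
    · have h1 : ¬ i < N := by omega
      have h2 : ¬ i + 1 < N := by omega
      have h3 : i + 1 - N = i - N + 1 := by omega
      simpa [h1, h2, h3] using hQ.cell (i - N) (by omega)

lemma rsSum_append {a b δ : ℝ} {N M : ℕ} {s c s' c' : ℕ → ℝ} (hP : IsTagged a b δ N s c)
    (hQ : s' 0 = b) (G : ℝ → ℝ → E) :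
    rsSum G (N + M) (fun i => if i < N then s i else s' (i - N))
      (fun i => if i < N then c i else c' (i - N)) = rsSum G N s c + rsSum G M s' c' := by
  rw [rsSum, Finset.sum_range_add]
  congr 1
  · refine Finset.sum_congr rfl fun i hi => ?_
    have hi' := Finset.mem_range.mp hi
    rcases lt_or_eq_of_le (show i + 1 ≤ N from hi') with h | h
    · simp [hi', h]
    · simp [hi', h, hQ, hP.right]
  · refine Finset.sum_congr rfl fun i _ => ?_
    have h3 : N + i + 1 - N = i + 1 := by omega
    have h2 : ¬ (N + i + 1 < N) := by omega
    simp [h3, h2]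

/-- Integrals over `[θ,h]` from integrals over `[0,h]`, by freezing the tag on `[0,θ]`. -/
lemma HasRSInt.restrict {θ h : ℝ} (hθ : 0 ≤ θ)
    (H : HasRSInt (fun c s => G (max c θ) s) 0 h I) :
    HasRSInt G θ h (I - (G θ θ - G θ 0)) := by
  rw [hasRSInt_iff] at *
  intro ε hε
  obtain ⟨δ, hδ, H⟩ := H ε hε
  refine ⟨δ, hδ, fun N s c hP => ?_⟩
  obtain ⟨M, s', c', hQ⟩ := exists_tagged hθ hδ
  have := H _ _ _ (hQ.append hP)
  rw [rsSum_append hQ hP.left] at this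
  -- On `[0,θ]` every tag is frozen at `θ`, so the sum telescopes.
  have e1 : rsSum (fun c s => G (max c θ) s) M s' c' = G θ θ - G θ 0 := by
    have := Finset.sum_range_sub (fun i => G θ (s' i)) M
    rw [hQ.right, hQ.left] at this
    rw [← this]
    refine Finset.sum_congr rfl fun i hi => ?_
    simp only [max_eq_right (hQ.tag_mem (Finset.mem_range.mp hi)).2]
  have e2 : rsSum (fun c s => G (max c θ) s) N s c = rsSum G N s c :=
    Finset.sum_congr rfl fun i hi => by
      simp only [max_eq_left (hP.tag_mem (Finset.mem_range.mp hi)).1]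
  rw [e1, e2] at this
  convert this using 2
  abel

end RS

end PeriodicDDE

namespace PeriodicDDE

/-! ### Scalar kernels -/

/-- `z` is the (normalized) kernel of the functional `Λ` on `C([-h,0], ℝ)`. -/
structure IsScalarKernel {h : ℝ} (hh : 0 < h) (Λ : C(Icc (-h) 0, ℝ) →L[ℝ] ℝ) (z : ℝ → ℝ) :
    Prop where
  zero : z 0 = 0
  right : ∀ θ ∈ Ioo 0 h, ContinuousWithinAt z (Ici θ) θ
  repr : ∀ φ : C(Icc (-h) 0, ℝ),
    HasRSInt (fun c s => z s * IccExtend (neg_nonpos.mpr hh.le) φ (-c)) 0 h (Λ φ)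

/-- A continuous approximation of the indicator function of `(-∞, s]`, with the conventions
appropriate at the end points of `[0,h]`. -/
noncomputable def ramp (h : ℝ) (m : ℕ) (s θ : ℝ) : ℝ :=
  if s ≤ 0 then 0 else if h ≤ s then 1 else max 0 (min 1 ((s - θ) * (m + 1) + 2))

section ramp

variable {h : ℝ} {m : ℕ} {s s' θ θ' : ℝ}

lemma ramp_nonneg : 0 ≤ ramp h m s θ := by
  unfold ramp; split_ifs <;> simp

lemma ramp_le_one : ramp h m s θ ≤ 1 := by
  unfold ramp; split_ifs <;> simp

lemma ramp_mono (hs : s ≤ s') : ramp h m s θ ≤ ramp h m s' θ := by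
  unfold ramp
  split_ifs <;> first | linarith | skip
  · simp
  · simp
  · have : (s - θ) * (m + 1 : ℝ) ≤ (s' - θ) * (m + 1) := by gcongr
    gcongr

lemma ramp_anti (hθ : θ ≤ θ') : ramp h m s θ' ≤ ramp h m s θ := by
  unfold ramp
  split_ifs <;> first | linarith | skip
  have : (s - θ') * (m + 1 : ℝ) ≤ (s - θ) * (m + 1) := by gcongr
  gcongr

lemma continuous_ramp : Continuous (ramp h m s) := by
  unfold ramp; split_ifs <;> fun_prop

/-- The constant `2` in `ramp` places the descent strictly to the right of `s`, between `s +
1/(m+1)` and `s + 2/(m+1)`. Thus only values of a kernel to the right of `s` matter, which is where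
it is known to be continuous. -/
lemma ramp_eq_one (h0 : 0 < s) (hθ : (θ - s) * (m + 1) ≤ 1) : ramp h m s θ = 1 := by
  unfold ramp
  split_ifs <;> first | linarith | rfl | skip
  rw [min_eq_left (by nlinarith), max_eq_right zero_le_one]

lemma ramp_eq_zero (h1 : s < h) (hθ : 2 ≤ (θ - s) * (m + 1)) : ramp h m s θ = 0 := by
  unfold ramp
  split_ifs <;> first | linarith | rfl | skip
  refine max_eq_left (min_le_iff.mpr (Or.inr (by nlinarith)))

end ramp

/-- The function `x ↦ ramp h m s (-x)` on `[-h,0]`. -/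
noncomputable def rampC (h : ℝ) (m : ℕ) (s : ℝ) : C(Icc (-h) 0, ℝ) :=
  ⟨fun x => ramp h m s (-x), continuous_ramp.comp (by fun_prop)⟩

lemma iccExtend_neg {E : Type*} {h : ℝ} (hh : -h ≤ 0) (g : ℝ → E) {c : ℝ} (hc : c ∈ Icc 0 h) :
    IccExtend hh (fun x : Icc (-h) 0 => g (-x)) (-c) = g c := by
  rw [IccExtend_of_mem _ _ ⟨by linarith [hc.2], by linarith [hc.1]⟩]
  simp

/-- Paths `d i` that are jointly Lipschitz in `ℓ¹`, evaluated at increasing times. -/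
lemma sum_norm_sub_le_of_lipschitz {E : Type*} [NormedAddCommGroup E] {K : ℝ} (N : ℕ) :
    ∀ (d : ℕ → ℝ → E) (t : ℕ → ℝ) (t₀ t₁ : ℝ), t₀ ≤ t₁ → 0 ≤ K →
      (∀ i < N, t i ∈ Icc t₀ t₁) → (∀ i, i + 1 < N → t i ≤ t (i + 1)) →
      (∀ r ∈ Icc t₀ t₁, ∀ r' ∈ Icc t₀ t₁,
        ∑ i ∈ Finset.range N, ‖d i r - d i r'‖ ≤ K * |r - r'|) →
      ∑ i ∈ Finset.range N, ‖d i (t i) - d i t₀‖ ≤ K * (t₁ - t₀) := by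
  induction N with
  | zero => intro d t t₀ t₁ h hK _ _ _; simpa using mul_nonneg hK (by linarith)
  | succ N ih =>
    intro d t t₀ t₁ h hK ht hmono hd
    have h0 := ht 0 (by omega)
    have hm : ∀ i ≤ N, t 0 ≤ t i := by
      intro i hi
      induction i with
      | zero => exact le_rfl
      | succ i ihi => exact (ihi (by omega)).trans (hmono i (by omega))
    -- All paths first move together from `t₀` to `t 0`; path `0` then stops and the remaining ones
    -- continue, so the induction restarts at `t 0`.
    have h1 := ih (fun i => d (i + 1)) (fun i => t (i + 1)) (t 0) t₁ h0.2 hK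
      (fun i hi => ⟨hm _ (by omega), (ht _ (by omega)).2⟩) (fun i hi => hmono _ (by omega))
      (fun r hr r' hr' => by
        have := hd r ⟨h0.1.trans hr.1, hr.2⟩ r' ⟨h0.1.trans hr'.1, hr'.2⟩
        rw [Finset.sum_range_succ'] at this
        linarith [norm_nonneg (d 0 r - d 0 r')])
    have h2 := hd (t 0) h0 t₀ ⟨le_rfl, h⟩
    rw [abs_of_nonneg (by linarith [h0.1])] at h2
    calc _ ≤ ∑ i ∈ Finset.range (N + 1), (‖d i (t i) - d i (t 0)‖ + ‖d i (t 0) - d i t₀‖) :=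
          Finset.sum_le_sum fun i _ => norm_sub_le_norm_sub_add_norm_sub _ _ _
      _ = ∑ i ∈ Finset.range N, ‖d (i + 1) (t (i + 1)) - d (i + 1) (t 0)‖
          + ∑ i ∈ Finset.range (N + 1), ‖d i (t 0) - d i t₀‖ := by
        rw [Finset.sum_add_distrib]
        congr 1
        rw [Finset.sum_range_succ']
        simp
      _ ≤ K * (t₁ - t 0) + K * (t 0 - t₀) := add_le_add h1 h2
      _ = K * (t₁ - t₀) := by ring

namespace IsScalarKernel

variable {h : ℝ} {hh : 0 < h} {Λ Λ' : C(Icc (-h) 0, ℝ) →L[ℝ] ℝ} {z z' : ℝ → ℝ}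

lemma zero_kernel : IsScalarKernel hh 0 (fun _ => 0) :=
  ⟨rfl, fun _ _ => continuousWithinAt_const, fun φ => by simpa using hasRSInt_zero 0 h⟩

lemma add (H : IsScalarKernel hh Λ z) (H' : IsScalarKernel hh Λ' z') :
    IsScalarKernel hh (Λ + Λ') (fun s => z s + z' s) :=
  ⟨by simp [H.zero, H'.zero], fun θ hθ => (H.right θ hθ).add (H'.right θ hθ), fun φ => by
    simpa [add_mul] using (H.repr φ).add (H'.repr φ)⟩

lemma smul (k : ℝ) (H : IsScalarKernel hh Λ z) : IsScalarKernel hh (k • Λ) (fun s => k * z s) :=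
  ⟨by simp [H.zero], fun θ hθ => (H.right θ hθ).const_mul k, fun φ => by
    simpa [mul_assoc] using (H.repr φ).const_smul k⟩

lemma sub (H : IsScalarKernel hh Λ z) (H' : IsScalarKernel hh Λ' z') :
    IsScalarKernel hh (Λ - Λ') (fun s => z s - z' s) := by
  convert H.add (H'.smul (-1)) using 1
  · ext φ; simp [sub_eq_add_neg]
  · ext s; ring

lemma sum {ι : Type*} {S : Finset ι} {Λ : ι → C(Icc (-h) 0, ℝ) →L[ℝ] ℝ} {z : ι → ℝ → ℝ}
    (H : ∀ i ∈ S, IsScalarKernel hh (Λ i) (z i)) :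
    IsScalarKernel hh (∑ i ∈ S, Λ i) (fun s => ∑ i ∈ S, z i s) := by
  classical
  induction S using Finset.induction_on with
  | empty => simpa using zero_kernel
  | insert i S hi ih =>
    simp only [Finset.sum_insert hi]
    exact (H i (Finset.mem_insert_self _ _)).add
      (ih fun j hj => H j (Finset.mem_insert_of_mem hj))

/-- The integral of a continuous function given on `[0,h]`. -/
lemma hasRSInt_real (H : IsScalarKernel hh Λ z) {f : ℝ → ℝ} (φ : C(Icc (-h) 0, ℝ))
    (hφ : ∀ x : Icc (-h) 0, φ x = f (-x)) : HasRSInt (fun c s => z s * f c) 0 h (Λ φ) := by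
  refine (H.repr φ).congr fun c hc s _ => ?_
  rw [show (φ : Icc (-h) 0 → ℝ) = fun x : Icc (-h) 0 => f (-x) from funext hφ,
    iccExtend_neg _ f hc]

/-- Testing the functional on approximate indicator functions recovers the kernel at every point,
thanks to its normalization. This transfers bounds from the functional to the kernel. -/
lemma tendsto_rampC (H : IsScalarKernel hh Λ z) {s : ℝ} (hs : s ∈ Icc 0 h) :
    Tendsto (fun m => Λ (rampC h m s)) atTop (𝓝 (z s)) := by
  rcases hs.1.eq_or_lt with rfl | hs0
  · have : ∀ m, rampC h m 0 = 0 := fun m => by ext x; simp [rampC, ramp]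
    simp [this, H.zero]
  rcases hs.2.eq_or_lt with rfl | hs1
  · have h1 : ∀ m, Λ (rampC s m s) = z s := by
      intro m
      have h2 : HasRSInt (fun c x => z x * 1) 0 s (Λ (rampC s m s)) :=
        H.hasRSInt_real (f := fun _ => 1) _ fun x => by
          simp [rampC, ramp, hh.not_ge]
      refine tendsto_nhds_unique (h2.tendsto hh.le) (tendsto_const_nhds.congr' ?_)
      filter_upwards [eventually_uniformNode_tagged hh.le one_pos] with N hN
      simp only [rsSum, mul_one]
      rw [Finset.sum_range_sub (fun i => z (uniformNode 0 s N i)), hN.left, hN.right, H.zero,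
        sub_zero]
    simp [h1]
  · rw [Metric.tendsto_atTop']
    intro ε hε
    obtain ⟨d, hd, hz⟩ := Metric.continuousWithinAt_iff.mp (H.right s ⟨hs0, hs1⟩) (ε / 2)
      (by positivity)
    -- The descent of the ramp ends at `s + 2/(m+1)`, and one cell of mesh below `1/(m+1)` may stick
    -- out beyond it; hence `3/(m+1)` must be below both `d` and `h - s`.
    obtain ⟨m₀, hm₀⟩ := exists_nat_gt (3 / min d (h - s))
    refine ⟨m₀, fun m hm => ?_⟩
    have hmin : 0 < min d (h - s) := lt_min hd (by linarith)
    have hm' : 3 < min d (h - s) * (m + 1) := by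
      rw [div_lt_iff₀ hmin] at hm₀
      have : (m₀ : ℝ) < m + 1 := by exact_mod_cast hm.trans (Nat.lt_succ_self m)
      nlinarith
    have hmpos : (0 : ℝ) < m + 1 := by positivity
    have hd3 : 3 < d * (m + 1) := hm'.trans_le (by gcongr; exact min_le_left _ _)
    have hs3 : 3 < (h - s) * (m + 1) := hm'.trans_le (by gcongr; exact min_le_right _ _)
    have h2 : HasRSInt (fun c x => z x * ramp h m s c) 0 h (Λ (rampC h m s)) :=
      H.hasRSInt_real _ fun x => rfl
    suffices hle : dist (Λ (rampC h m s)) (z s) ≤ ε / 2 by linarith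
    rw [dist_eq_norm]
    refine le_of_tendsto ((h2.tendsto hh.le).sub_const (z s)).norm ?_
    have hδ : (0 : ℝ) < 1 / (m + 1) := by positivity
    filter_upwards [eventually_uniformNode_tagged hh.le hδ] with N hN
    set u := uniformNode 0 h N
    have hr0 : ramp h m s (u 0) = 1 := by
      rw [hN.left]; exact ramp_eq_one hs0 (by nlinarith)
    have hrN : ramp h m s (u N) = 0 := by
      rw [hN.right]; exact ramp_eq_zero hs1 (by linarith)
    -- Summation by parts: the differences fall on the ramp and add up to `1`, so `z s` can be
    -- absorbed into the sum.
    have e1 : rsSum (fun c x => z x * ramp h m s c) N u u - z s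
        = ∑ i ∈ Finset.range N,
          (z (u (i + 1)) - z s) * (ramp h m s (u i) - ramp h m s (u (i + 1))) := by
      have t1 := Finset.sum_range_sub (fun i => z (u i) * ramp h m s (u i)) N
      have t2 := Finset.sum_range_sub' (fun i => ramp h m s (u i)) N
      rw [hr0, hrN] at t2
      rw [hrN, hN.left, H.zero] at t1
      calc _ = rsSum (fun c x => z x * ramp h m s c) N u u
            - ∑ i ∈ Finset.range N, (z (u (i + 1)) * ramp h m s (u (i + 1))
              - z (u i) * ramp h m s (u i))
            - ∑ i ∈ Finset.range N, z s * (ramp h m s (u i) - ramp h m s (u (i + 1))) := by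
            rw [← Finset.mul_sum, t2, t1]; ring
        _ = _ := by
          rw [rsSum, ← Finset.sum_sub_distrib, ← Finset.sum_sub_distrib]
          exact Finset.sum_congr rfl fun i _ => by ring
    rw [e1]
    calc _ ≤ ∑ i ∈ Finset.range N, ε / 2 * (ramp h m s (u i) - ramp h m s (u (i + 1))) := by
          refine (norm_sum_le _ _).trans (Finset.sum_le_sum fun i hi => ?_)
          have hi' := Finset.mem_range.mp hi
          obtain ⟨c1, c2, c3⟩ := hN.cell i hi'
          have hle : u i ≤ u (i + 1) := c1.trans c2
          have hnn : 0 ≤ ramp h m s (u i) - ramp h m s (u (i + 1)) := sub_nonneg.mpr (ramp_anti hle)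
          rw [norm_mul, Real.norm_of_nonneg hnn]
          rw [lt_div_iff₀ hmpos] at c3
          -- Cells within the plateau `1` or the plateau `0` contribute nothing. In the others the
          -- right node lies between `s` and `s + 3/(m+1)`, where `z` is within `ε / 2` of `z s`.
          by_cases hA : (u (i + 1) - s) * (m + 1) ≤ 1
          · rw [ramp_eq_one hs0 hA, ramp_eq_one hs0 (by nlinarith)]; simp
          by_cases hB : 2 ≤ (u i - s) * (m + 1)
          · rw [ramp_eq_zero hs1 hB, ramp_eq_zero hs1 (by nlinarith)]; simp
          push Not at hA hB
          refine mul_le_mul_of_nonneg_right ?_ hnn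
          have hge : s ≤ u (i + 1) := by
            by_contra! hcon
            nlinarith
          have hlt : dist (u (i + 1)) s < d := by
            rw [Real.dist_eq, abs_of_nonneg (by linarith)]
            by_contra! hcon
            have := mul_le_mul_of_nonneg_right hcon hmpos.le
            nlinarith
          have := hz hge hlt
          rw [Real.dist_eq] at this
          exact this.le
      _ = ε / 2 := by
        rw [← Finset.mul_sum, Finset.sum_range_sub' (fun i => ramp h m s (u i)), hr0, hrN]; ring

/-- The variation of the kernel is bounded by the norm of the functional. -/
lemma sum_abs_le (H : IsScalarKernel hh Λ z) {N : ℕ} {s : ℕ → ℝ}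
    (hs : ∀ i ≤ N, s i ∈ Icc 0 h) (hmono : ∀ i < N, s i ≤ s (i + 1)) :
    ∑ i ∈ Finset.range N, |z (s (i + 1)) - z (s i)| ≤ ‖Λ‖ := by
  set ε : ℕ → ℝ := fun i => SignType.sign (z (s (i + 1)) - z (s i))
  have hε : ∀ i, |ε i| ≤ 1 := fun i => by
    simp only [ε]
    rcases lt_trichotomy (z (s (i + 1)) - z (s i)) 0 with h | h | h <;> simp [h]
  -- The extremal test function: signs of the increments times approximate indicators of the cells.
  -- Its norm is at most `1` because ramps increase in `s`, so the cell functions are nonnegative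
  -- with a telescoping sum.
  set ψ : ℕ → C(Icc (-h) 0, ℝ) := fun m =>
    ∑ i ∈ Finset.range N, ε i • (rampC h m (s (i + 1)) - rampC h m (s i))
  have hψ : ∀ m, ‖ψ m‖ ≤ 1 := by
    intro m
    refine (ContinuousMap.norm_le _ zero_le_one).mpr fun x => ?_
    simp only [ψ, ContinuousMap.coe_sum, Finset.sum_apply, ContinuousMap.coe_smul, Pi.smul_apply,
      ContinuousMap.coe_sub, Pi.sub_apply, smul_eq_mul]
    calc _ ≤ ∑ i ∈ Finset.range N, (rampC h m (s (i + 1)) x - rampC h m (s i) x) := by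
          refine (norm_sum_le _ _).trans (Finset.sum_le_sum fun i hi => ?_)
          have h0 : 0 ≤ rampC h m (s (i + 1)) x - rampC h m (s i) x :=
            sub_nonneg.mpr (ramp_mono (hmono i (Finset.mem_range.mp hi)))
          rw [norm_mul, Real.norm_of_nonneg h0, Real.norm_eq_abs]
          exact mul_le_of_le_one_left h0 (hε i)
      _ = rampC h m (s N) x - rampC h m (s 0) x :=
        Finset.sum_range_sub (fun i => rampC h m (s i) x) N
      _ ≤ 1 := by
        have h1 : rampC h m (s N) x ≤ 1 := ramp_le_one
        have h2 : 0 ≤ rampC h m (s 0) x := ramp_nonneg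
        linarith
  have hlim : Tendsto (fun m => Λ (ψ m)) atTop
      (𝓝 (∑ i ∈ Finset.range N, |z (s (i + 1)) - z (s i)|)) := by
    simp only [ψ, map_sum, map_smul, map_sub, smul_eq_mul]
    refine tendsto_finsetSum _ fun i hi => ?_
    have hi' := Finset.mem_range.mp hi
    have := ((H.tendsto_rampC (hs (i + 1) (by omega))).sub
      (H.tendsto_rampC (hs i hi'.le))).const_mul (ε i)
    rwa [show ε i * (z (s (i + 1)) - z (s i)) = |z (s (i + 1)) - z (s i)| from
      sign_mul_self _] at this
  refine le_of_tendsto hlim (Eventually.of_forall fun m => ?_)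
  calc Λ (ψ m) ≤ ‖Λ (ψ m)‖ := Real.le_norm_self _
    _ ≤ ‖Λ‖ * ‖ψ m‖ := Λ.le_opNorm _
    _ ≤ ‖Λ‖ := by nlinarith [norm_nonneg Λ, hψ m]

end IsScalarKernel

/-- Variation along a Lipschitz path of kernels, with increasing times. -/
lemma sum_abs_path_le {h : ℝ} {hh : 0 < h} {R : ℝ → C(Icc (-h) 0, ℝ) →L[ℝ] ℝ} {Z : ℝ → ℝ → ℝ}
    (H : ∀ r, IsScalarKernel hh (R r) (Z r)) {a b δ K : ℝ} (ha : 0 ≤ a) (hb : b ≤ h)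
    (hab : a ≤ b) (hK : 0 ≤ K)
    (hR : ∀ r ∈ Icc a b, ∀ r' ∈ Icc a b, ‖R r - R r'‖ ≤ K * |r - r'|) {N : ℕ} {s c : ℕ → ℝ}
    (hP : IsTagged a b δ N s c) :
    ∑ i ∈ Finset.range N, |Z (c i) (s (i + 1)) - Z (c i) (s i)| ≤ ‖R a‖ + K * (b - a) := by
  have hmem : ∀ i ≤ N, s i ∈ Icc 0 h := fun i hi =>
    ⟨ha.trans (hP.le_node hi), (hP.node_le hi).trans hb⟩
  have hm : ∀ i < N, s i ≤ s (i + 1) := fun i hi => (hP.cell i hi).1.trans (hP.cell i hi).2.1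
  have h1 := (H a).sum_abs_le hmem hm
  have h2 := sum_norm_sub_le_of_lipschitz (K := K) N
    (fun i r => Z r (s (i + 1)) - Z r (s i)) c a b hab hK (fun i hi => hP.tag_mem hi)
    (fun i hi => hP.tag_le_succ hi) (fun r hr r' hr' => by
      refine le_trans (le_of_eq ?_) ((((H r).sub (H r')).sum_abs_le hmem hm).trans
        (hR r hr r' hr'))
      refine Finset.sum_congr rfl fun i _ => ?_
      rw [Real.norm_eq_abs]
      refine congrArg abs ?_
      ring)
  calc _ ≤ ∑ i ∈ Finset.range N, (|Z a (s (i + 1)) - Z a (s i)|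
        + ‖(Z (c i) (s (i + 1)) - Z (c i) (s i)) - (Z a (s (i + 1)) - Z a (s i))‖) := by
        refine Finset.sum_le_sum fun i _ => ?_
        refine le_trans (le_of_eq ?_) (abs_add_le _ _)
        rw [add_sub_cancel]
    _ ≤ _ := by rw [Finset.sum_add_distrib]; exact add_le_add h1 h2

end PeriodicDDE

/-! ### Integrals against fixed kernels and against kernels on a `C¹` path -/

namespace PeriodicDDE

variable {h : ℝ} {hh : 0 < h}

/-- The representation formula covers real continuous integrands on `[0,h]`. Real and imaginary
parts are treated separately, and a constant extension to the left of `a` makes the passage to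
`[a,h]` a case of `HasRSInt.restrict`. -/
lemma IsScalarKernel.exists_hasRSInt {Λ : C(Icc (-h) 0, ℝ) →L[ℝ] ℝ} {z : ℝ → ℝ}
    (H : IsScalarKernel hh Λ z) {a : ℝ} (ha : a ∈ Icc 0 h) {f : ℝ → ℂ}
    (hf : ContinuousOn f (Icc a h)) :
    ∃ I, HasRSInt (fun c s => f c * (z s : ℂ)) a h I := by
  set f' : ℝ → ℂ := IccExtend ha.2 ((Icc a h).domRestrict f)
  have hf' : Continuous f' := hf.domRestrict.Icc_extend'
  have hre : HasRSInt (fun c s => z s * (f' c).re) 0 h _ :=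
    H.hasRSInt_real (f := fun c => (f' c).re) ⟨fun x => (f' (-x)).re, by fun_prop⟩ fun x => rfl
  have him : HasRSInt (fun c s => z s * (f' c).im) 0 h _ :=
    H.hasRSInt_real (f := fun c => (f' c).im) ⟨fun x => (f' (-x)).im, by fun_prop⟩ fun x => rfl
  have hre' := hre.map (Complex.ofRealHom : ℝ →+* ℂ).toAddMonoidHom (K := 1) (fun x => by simp)
  have him' := (him.map (Complex.ofRealHom : ℝ →+* ℂ).toAddMonoidHom (K := 1)
    (fun x => by simp)).const_smul Complex.I
  have key : HasRSInt (fun c s => f' (max c a) * (z s : ℂ)) 0 h _ := (hre'.add him').congr (by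
    intro c hc s _
    have : f' (max c a) = f' c := by
      simp only [f', IccExtend, Function.comp]
      congr 1
      ext
      simp only [coe_projIcc]
      rcases le_total c a with h1 | h1 <;> simp [h1, ha.2]
    rw [this]
    simp only [RingHom.toAddMonoidHom_eq_coe, AddMonoidHom.coe_coe, Complex.ofRealHom_eq_coe,
      smul_eq_mul]
    push_cast
    linear_combination (z s : ℂ) * Complex.re_add_im (f' c))
  refine ⟨_, (HasRSInt.restrict (G := fun c s => f' c * (z s : ℂ)) ha.1 key).congr ?_⟩
  intro c hc s _
  simp only [f']
  rw [IccExtend_of_mem _ _ hc]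
  rfl

lemma norm_rsSum_path_le {R : ℝ → C(Icc (-h) 0, ℝ) →L[ℝ] ℝ} {Z : ℝ → ℝ → ℝ}
    (H : ∀ r, IsScalarKernel hh (R r) (Z r)) {a b δ K C : ℝ} (ha : 0 ≤ a) (hb : b ≤ h)
    (hab : a ≤ b) (hK : 0 ≤ K)
    (hR : ∀ r ∈ Icc a b, ∀ r' ∈ Icc a b, ‖R r - R r'‖ ≤ K * |r - r'|) {f : ℝ → ℂ}
    (hC : 0 ≤ C) (hf : ∀ c ∈ Icc a b, ‖f c‖ ≤ C) {N : ℕ} {s c : ℕ → ℝ}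
    (hP : IsTagged a b δ N s c) :
    ‖rsSum (fun c s => f c * (Z c s : ℂ)) N s c‖ ≤ C * (‖R a‖ + K * (b - a)) := by
  calc _ ≤ ∑ i ∈ Finset.range N, C * |Z (c i) (s (i + 1)) - Z (c i) (s i)| := by
        refine (norm_sum_le _ _).trans (Finset.sum_le_sum fun i hi => ?_)
        rw [← mul_sub, norm_mul, ← Complex.ofReal_sub, Complex.norm_real, Real.norm_eq_abs]
        gcongr
        exact hf _ (hP.tag_mem (Finset.mem_range.mp hi))
    _ ≤ _ := by
      rw [← Finset.mul_sum]
      gcongr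
      exact sum_abs_path_le H ha hb hab hK hR hP

lemma norm_image_sub_sub_smul_le {B : Type*} [NormedAddCommGroup B] [NormedSpace ℝ B]
    {Λ Λ' : ℝ → B} (hΛ : ∀ r, HasDerivAt Λ (Λ' r) r) {u v ε : ℝ} {D : B}
    (hD : ∀ x ∈ Icc u v, ‖Λ' x - D‖ ≤ ε) {x y : ℝ} (hx : x ∈ Icc u v) (hy : y ∈ Icc u v) :
    ‖(Λ y - y • D) - (Λ x - x • D)‖ ≤ ε * |y - x| := by
  have := (convex_Icc u v).norm_image_sub_le_of_norm_hasDerivWithin_le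
    (f := fun r => Λ r - r • D) (f' := fun r => Λ' r - D) (C := ε) (fun r _ =>
      ((hΛ r).sub (by simpa using (hasDerivAt_id r).smul_const D)).hasDerivWithinAt) hD hx hy
  simpa using this

lemma exists_modulus_of_continuous {B : Type*} [NormedAddCommGroup B] {f : ℝ → B}
    (hf : Continuous f) (a b : ℝ) {ε : ℝ} (hε : 0 < ε) :
    ∃ d > 0, ∀ x ∈ Icc a b, ∀ y ∈ Icc a b, |x - y| < d → ‖f x - f y‖ < ε := by
  simpa only [dist_eq_norm, Real.norm_eq_abs] using Metric.uniformContinuousOn_iff.mp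
    (isCompact_Icc.uniformContinuousOn_of_continuous (hf.continuousOn (s := Icc a b))) ε hε

/-- The point of `[u,v]` closest to `c`. -/
noncomputable def clip (u v c : ℝ) : ℝ := max u (min c v)

lemma clip_mem {u v : ℝ} (huv : u ≤ v) (c : ℝ) : clip u v c ∈ Icc u v :=
  ⟨le_max_left _ _, max_le huv (min_le_right _ _)⟩

lemma clip_mono (u v : ℝ) : Monotone (clip u v) := fun c c' hc => by
  unfold clip; gcongr

lemma continuous_clip (u v : ℝ) : Continuous (clip u v) := by
  unfold clip; fun_prop

/-- A cell beyond `c` contributes zero and a cell before `c` its full increment. The range of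
summation is therefore independent of `c`, so that an interpolated path becomes a fixed finite sum
with scalar weights depending on `c`. -/
lemma sum_clip {E : Type*} [AddCommGroup E] {a b δ : ℝ} {N : ℕ} {s t : ℕ → ℝ}
    (hP : IsTagged a b δ N s t) {c : ℝ} (hc : c ∈ Icc a b) (F : ℝ → E) :
    ∑ m ∈ Finset.range N, (F (clip (s m) (s (m + 1)) c) - F (s m)) = F c - F a := by
  have := Finset.sum_range_sub (fun m => F (min c (s m))) N
  rw [hP.left, hP.right, min_eq_left hc.2, min_eq_right hc.1] at this
  rw [← this]
  refine Finset.sum_congr rfl fun m hm => ?_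
  have hm' := hP.cell m (Finset.mem_range.mp hm)
  have hle := hm'.1.trans hm'.2.1
  unfold clip
  rcases le_total c (s m) with h1 | h1
  · rw [min_eq_left (h1.trans hle), max_eq_left h1, min_eq_left h1, sub_self, sub_self]
  · rw [min_eq_right h1, max_eq_right (le_min h1 hle)]

/-- Piecewise linear interpolation of a `C¹` path, with remainder small in the Lipschitz norm. -/
lemma exists_piecewise_linear_approx {B : Type*} [NormedAddCommGroup B] [NormedSpace ℝ B]
    {Λ Λ' : ℝ → B} (hΛ : ∀ r, HasDerivAt Λ (Λ' r) r) (hΛ' : Continuous Λ') {a b : ℝ}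
    (hab : a ≤ b) {ε : ℝ} (hε : 0 < ε) :
    ∃ (M : ℕ) (r : ℕ → ℝ), ∀ R : ℝ → B,
      (∀ c, R c = Λ c - (Λ a + ∑ m ∈ Finset.range M, (clip (r m) (r (m + 1)) c - r m) •
        ((r (m + 1) - r m)⁻¹ • (Λ (r (m + 1)) - Λ (r m))))) →
      ‖R a‖ = 0 ∧ ∀ x ∈ Icc a b, ∀ y ∈ Icc a b, ‖R x - R y‖ ≤ ε * |x - y| := by
  obtain ⟨d, hd, hunif⟩ := exists_modulus_of_continuous hΛ' a b hε
  obtain ⟨M, r, t, hM⟩ := exists_tagged hab hd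
  have hrle : ∀ m < M, r m ≤ r (m + 1) := fun m hm => (hM.cell m hm).1.trans (hM.cell m hm).2.1
  refine ⟨M, r, fun R hR => ?_⟩
  set D : ℕ → B := fun m => (r (m + 1) - r m)⁻¹ • (Λ (r (m + 1)) - Λ (r m)) with hD
  have hLip : ∀ m < M, ∀ x ∈ Icc (r m) (r (m + 1)), ∀ y ∈ Icc (r m) (r (m + 1)),
      ‖(Λ y - y • D m) - (Λ x - x • D m)‖ ≤ ε * |y - x| := by
    intro m hm x hx y hy
    -- Partitions may have cells of length zero, for which the slope `D m` carries no information.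
    rcases (hrle m hm).eq_or_lt with heq | hlt
    · rw [← heq, Icc_self, mem_singleton_iff] at hx hy
      simp [hx, hy]
    refine norm_image_sub_sub_smul_le hΛ (fun w hw => ?_) hx hy
    have hsub : ∀ x ∈ Icc (r m) (r (m + 1)), x ∈ Icc a b := fun x hx =>
      ⟨(hM.le_node hm.le).trans hx.1, hx.2.trans (hM.node_le hm)⟩
    -- The slope of the chord is within `ε` of the derivative at any point `w` of the cell, since
    -- `Λ'` oscillates by less than `ε` there.
    have h1 := norm_image_sub_sub_smul_le hΛ (D := Λ' w) (ε := ε) (u := r m) (v := r (m + 1))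
      (fun x hx => by
        have := hunif x (hsub x hx) w (hsub w hw) (by
          rw [abs_lt]
          have := (hM.cell m hm).2.2
          constructor <;> linarith [hx.1, hx.2, hw.1, hw.2])
        exact this.le) (left_mem_Icc.mpr hlt.le) (right_mem_Icc.mpr hlt.le)
    have hη : 0 < r (m + 1) - r m := sub_pos.mpr hlt
    have e : Λ' w - D m = -((r (m + 1) - r m)⁻¹ •
        ((Λ (r (m + 1)) - r (m + 1) • Λ' w) - (Λ (r m) - r m • Λ' w))) := by
      have : (Λ (r (m + 1)) - r (m + 1) • Λ' w) - (Λ (r m) - r m • Λ' w)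
          = (Λ (r (m + 1)) - Λ (r m)) - (r (m + 1) - r m) • Λ' w := by
        rw [sub_smul]; abel
      rw [this, smul_sub, smul_smul, inv_mul_cancel₀ hη.ne', one_smul]
      simp only [D]
      abel
    rw [e, norm_neg, norm_smul, norm_inv, Real.norm_of_nonneg hη.le, inv_mul_le_iff₀ hη]
    rw [abs_of_pos hη] at h1
    linarith
  have hRsum : ∀ c ∈ Icc a b, R c = ∑ m ∈ Finset.range M,
      ((Λ (clip (r m) (r (m + 1)) c) - clip (r m) (r (m + 1)) c • D m) - (Λ (r m) - r m • D m)) := by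
    intro c hc
    have := sum_clip hM hc Λ
    rw [hR, ← sub_sub, ← this, ← Finset.sum_sub_distrib]
    exact Finset.sum_congr rfl fun m _ => by rw [sub_smul]; abel
  constructor
  · rw [hRsum a ⟨le_rfl, hab⟩, norm_eq_zero]
    refine Finset.sum_eq_zero fun m hm => ?_
    have hm' := Finset.mem_range.mp hm
    have : clip (r m) (r (m + 1)) a = r m := by
      unfold clip
      rw [max_eq_left ((min_le_left _ _).trans (hM.le_node hm'.le))]
    rw [this, sub_self]
  have hwlog : ∀ x ∈ Icc a b, ∀ y ∈ Icc a b, y ≤ x → ‖R x - R y‖ ≤ ε * |x - y| := by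
    intro x hx y hy hyx
    rw [hRsum x hx, hRsum y hy, ← Finset.sum_sub_distrib]
    calc _ ≤ ∑ m ∈ Finset.range M, ε * ((clip (r m) (r (m + 1)) x - r m)
          - (clip (r m) (r (m + 1)) y - r m)) := by
          refine (norm_sum_le _ _).trans (Finset.sum_le_sum fun m hm => ?_)
          have hm' := Finset.mem_range.mp hm
          rw [sub_sub_sub_cancel_right, sub_sub_sub_cancel_right]
          refine (hLip m hm' _ (clip_mem (hrle m hm') y) _ (clip_mem (hrle m hm') x)).trans ?_
          rw [abs_of_nonneg (sub_nonneg.mpr (clip_mono _ _ hyx))]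
      _ = ε * |x - y| := by
        rw [← Finset.mul_sum, Finset.sum_sub_distrib, sum_clip hM hx (fun x => x),
          sum_clip hM hy (fun x => x), abs_of_nonneg (by linarith)]
        ring
  intro x hx y hy
  rcases le_total y x with h1 | h1
  · exact hwlog x hx y hy h1
  · rw [norm_sub_rev, abs_sub_comm]
    exact hwlog y hy x hx h1

/-- Integrals against a kernel that moves along a `C¹` path. -/
theorem exists_hasRSInt_path {Λ Λ' : ℝ → C(Icc (-h) 0, ℝ) →L[ℝ] ℝ} {z : ℝ → ℝ → ℝ}
    (H : ∀ r, IsScalarKernel hh (Λ r) (z r)) (hΛ : ∀ r, HasDerivAt Λ (Λ' r) r)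
    (hΛ' : Continuous Λ') {a : ℝ} (ha : a ∈ Icc 0 h) {f : ℝ → ℂ}
    (hf : ContinuousOn f (Icc a h)) :
    ∃ I, HasRSInt (fun c s => f c * (z c s : ℂ)) a h I := by
  obtain ⟨C, hC⟩ := isCompact_Icc.exists_bound_of_continuousOn hf
  have hC0 : 0 ≤ C := (norm_nonneg _).trans (hC a ⟨le_rfl, ha.2⟩)
  refine exists_hasRSInt_of_approx ha.2 fun ε hε => ?_
  have hha : 0 ≤ h - a := sub_nonneg.mpr ha.2
  -- Chosen so that `C * (ε' * (h - a)) ≤ ε`, which bounds the sums of the remainder; the added ones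
  -- keep the denominator positive.
  set ε' := ε / ((C + 1) * (h - a + 1)) with hε'
  have hε'0 : 0 < ε' := by positivity
  obtain ⟨M, r, hMr⟩ := exists_piecewise_linear_approx (B := C(Icc (-h) 0, ℝ) →L[ℝ] ℝ) hΛ hΛ'
    ha.2 hε'0
  obtain ⟨hRa, hRL⟩ := hMr _ fun _ => rfl
  set zD : ℕ → ℝ → ℝ := fun m s => (r (m + 1) - r m)⁻¹ * (z (r (m + 1)) s - z (r m) s)
  have hDz : ∀ m, IsScalarKernel hh ((r (m + 1) - r m)⁻¹ • (Λ (r (m + 1)) - Λ (r m))) (zD m) :=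
    fun m => ((H _).sub (H _)).smul _
  set g : ℕ → ℝ → ℝ := fun m c => clip (r m) (r (m + 1)) c - r m
  -- For the interpolated path the dependence on the tag splits off as the scalar weights `g m c`,
  -- so its integral is a finite sum of integrals against fixed kernels with continuous integrands
  -- `f * g m`.
  set zM : ℝ → ℝ → ℝ := fun c s => z a s + ∑ m ∈ Finset.range M, g m c * zD m s
  have hRk : ∀ c, IsScalarKernel hh (Λ c - (Λ a + ∑ m ∈ Finset.range M, g m c •
      ((r (m + 1) - r m)⁻¹ • (Λ (r (m + 1)) - Λ (r m))))) (fun s => z c s - zM c s) := fun c =>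
    (H c).sub ((H a).add (IsScalarKernel.sum fun m _ => (hDz m).smul _))
  obtain ⟨I₀, hI₀⟩ := (H a).exists_hasRSInt ha hf
  have hex : ∀ m, ∃ I, HasRSInt (fun c s => (f c * (g m c : ℂ)) * (zD m s : ℂ)) a h I := fun m =>
    (hDz m).exists_hasRSInt ha (hf.mul (Complex.continuous_ofReal.comp
      ((continuous_clip _ _).sub continuous_const)).continuousOn)
  choose J hJ using hex
  refine ⟨fun c s => f c * (zM c s : ℂ), _, (hI₀.add (HasRSInt.finset_sum fun m (_ : m ∈
    Finset.range M) => hJ m)).congr ?_, 1, one_pos, fun N s c hP => ?_⟩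
  · intro c _ s _
    simp only [zM]
    push_cast
    rw [mul_add, Finset.mul_sum]
    congr 1
    exact Finset.sum_congr rfl fun m _ => by ring
  -- The remainder is a path of functionals that starts at `0` and is `ε'`-Lipschitz, so its sums
  -- are small for every partition, however fine.
  · have h1 := norm_rsSum_path_le hRk ha.1 le_rfl ha.2 hε'0.le hRL hC0 hC hP
    have e : rsSum (fun c s => f c * (z c s : ℂ)) N s c - rsSum (fun c s => f c * (zM c s : ℂ)) N s c
        = rsSum (fun c s => f c * ((z c s - zM c s : ℝ) : ℂ)) N s c := by
      simp only [rsSum, ← Finset.sum_sub_distrib]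
      exact Finset.sum_congr rfl fun i _ => by push_cast; ring
    rw [e]
    refine (h1.trans_eq (congrArg (fun x => C * (x + ε' * (h - a))) hRa)).trans ?_
    rw [zero_add, hε', mul_comm, div_mul_eq_mul_div, div_mul_eq_mul_div,
      div_le_iff₀ (by positivity)]
    have : (h - a) * C ≤ (C + 1) * (h - a + 1) := by nlinarith
    nlinarith

end PeriodicDDE

/-! ### Uniform bounds for the kernel `ζ` -/

namespace PeriodicDDE

/-- The facts about the kernel `ζ` on which the remaining analysis depends; `K` bounds
its variation. -/
structure KernelBounds {n : ℕ} (h T K : ℝ) (ζ : ℝ → ℝ → Matrix (Fin n) (Fin n) ℝ) : Prop where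
  pos : 0 < h
  nonneg : 0 ≤ K
  periodic : ∀ t, ∀ θ ∈ Icc 0 h, ζ (t + T) θ = ζ t θ
  right : ∀ t i j, ∀ θ ∈ Ioo 0 h, ContinuousWithinAt (fun θ => ζ t θ i j) (Ici θ) θ
  sum_abs_le : ∀ t i j {N : ℕ} {δ : ℝ} {s c : ℕ → ℝ}, IsTagged 0 h δ N s c →
    ∑ k ∈ Finset.range N, |ζ t (s (k + 1)) i j - ζ t (s k) i j| ≤ K
  sum_abs_path_le : ∀ t i j {N : ℕ} {a δ : ℝ} {s c : ℕ → ℝ}, a ∈ Icc 0 h → IsTagged a h δ N s c →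
    ∑ k ∈ Finset.range N, |ζ (t + c k) (s (k + 1)) i j - ζ (t + c k) (s k) i j| ≤ K
  continuous : ∀ i j, ∀ s ∈ Icc 0 h, Continuous fun t => ζ t s i j
  exists_hasRSInt : ∀ t i j (f : ℝ → ℂ), ContinuousOn f (Icc 0 h) →
    ∃ I, HasRSInt (fun c s => f c * (ζ t s i j : ℂ)) 0 h I
  exists_hasRSInt_path : ∀ t i j, ∀ a ∈ Icc 0 h, ∀ f : ℝ → ℂ, ContinuousOn f (Icc a h) →
    ∃ I, HasRSInt (fun c s => f c * (ζ (t + c) s i j : ℂ)) a h I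

section entry

variable {n : ℕ} {h T : ℝ}

/-- The `(i,j)` entry of an operator from `C([-h,0], ℝⁿ)` to `ℝⁿ`. -/
noncomputable def entry (h : ℝ) (i j : Fin n) :
    (C(Icc (-h) 0, Fin n → ℝ) →L[ℝ] (Fin n → ℝ)) →L[ℝ] (C(Icc (-h) 0, ℝ) →L[ℝ] ℝ) :=
  (ContinuousLinearMap.precomp ℝ (ContinuousLinearMap.compLeftContinuous ℝ (Icc (-h) 0)
      (ContinuousLinearMap.single ℝ (fun _ : Fin n => ℝ) j))).comp
    (ContinuousLinearMap.postcomp _ (ContinuousLinearMap.proj i))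

lemma entry_apply (i j : Fin n) (A : C(Icc (-h) 0, Fin n → ℝ) →L[ℝ] (Fin n → ℝ))
    (φ : C(Icc (-h) 0, ℝ)) : entry h i j A φ =
      A (ContinuousLinearMap.compLeftContinuous ℝ (Icc (-h) 0)
      (ContinuousLinearMap.single ℝ (fun _ : Fin n => ℝ) j) φ) i := rfl

lemma IsKernel.isScalarKernel {hh : 0 < h}
    {L : ℝ → C(Icc (-h) 0, Fin n → ℝ) →L[ℝ] (Fin n → ℝ)}
    {ζ : ℝ → ℝ → Matrix (Fin n) (Fin n) ℝ} (hζ : IsKernel h T hh L ζ) (t : ℝ) (i j : Fin n) :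
    IsScalarKernel hh (entry h i j (L t)) (fun s => ζ t s i j) := by
  refine ⟨by simp [hζ.zero], hζ.rightContinuous t i j, fun φ => ?_⟩
  rw [entry_apply]
  refine ((hζ.represents t _).apply i).congr fun c hc s _ => ?_
  rw [IccExtend_of_mem _ _ ⟨by linarith [hc.2], by linarith [hc.1]⟩,
    IccExtend_of_mem _ _ ⟨by linarith [hc.2], by linarith [hc.1]⟩]
  change ∑ k, ζ t s i k * (Pi.single j (φ _) : Fin n → ℝ) k = _
  simp [Pi.single_apply]

lemma exists_bound_of_periodic {B : Type*} [NormedAddCommGroup B] {f : ℝ → B} {T : ℝ} (hT : 0 < T)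
    (hf : Continuous f) (hp : Function.Periodic f T) : ∃ C, 0 ≤ C ∧ ∀ t, ‖f t‖ ≤ C := by
  obtain ⟨C, hC⟩ := (hp.isBounded_of_continuous hT.ne' hf).exists_norm_le
  exact ⟨C, (norm_nonneg _).trans (hC (f 0) (mem_range_self 0)), fun t => hC _ (mem_range_self t)⟩

lemma IsCT.exists_lipschitz {B : Type*} [NormedAddCommGroup B] [NormedSpace ℝ B] {f : ℝ → B}
    {T : ℝ} (hT : 0 < T) (hf : IsCT T 1 f) :
    ∃ C, 0 ≤ C ∧ (∀ t, ‖f t‖ ≤ C) ∧ ∀ r r', ‖f r - f r'‖ ≤ C * |r - r'| := by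
  have hd : Continuous (deriv f) := hf.1.continuous_deriv le_rfl
  obtain ⟨C, hC, h1⟩ := exists_bound_of_periodic hT hf.1.continuous hf.2
  obtain ⟨C', hC', h2⟩ := exists_bound_of_periodic hT hd fun t => by
    rw [← deriv_comp_add_const]
    exact congrFun (congrArg deriv (funext hf.2)) t
  refine ⟨max C C', hC.trans (le_max_left _ _), fun t => (h1 t).trans (le_max_left _ _),
    fun r r' => ?_⟩
  have := convex_univ.norm_image_sub_le_of_norm_deriv_le (f := f) (C := max C C')
    (fun x _ => (hf.1.differentiable one_ne_zero) x) (fun x _ => (h2 x).trans (le_max_right _ _))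
    (mem_univ r') (mem_univ r)
  simpa using this

lemma IsCT.clm {B B' : Type*} [NormedAddCommGroup B] [NormedSpace ℝ B] [NormedAddCommGroup B']
    [NormedSpace ℝ B'] {f : ℝ → B} {l : ℕ} (hf : IsCT T l f) (A : B →L[ℝ] B') :
    IsCT T l (fun t => A (f t)) :=
  ⟨A.contDiff.comp hf.1, fun t => congrArg A (hf.2 t)⟩

lemma IsCT.hasDerivAt {B : Type*} [NormedAddCommGroup B] [NormedSpace ℝ B] {f : ℝ → B}
    (hf : IsCT T 1 f) (t : ℝ) : HasDerivAt f (deriv f t) t :=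
  (hf.1.differentiable one_ne_zero t).hasDerivAt

/-- Each entry of `L` is a periodic `C¹` path of functionals, hence bounded and Lipschitz, here with
one constant `C₀` for all entries. The variation along moving tags is at most the norm at the
starting point plus the drift over a length at most `h`, which is where `C₀ + C₀ * h` comes from. -/
theorem IsKernel.exists_kernelBounds {hh : 0 < h} (hT : 0 < T)
    {L : ℝ → C(Icc (-h) 0, Fin n → ℝ) →L[ℝ] (Fin n → ℝ)} (hL : IsCT T 1 L)
    {ζ : ℝ → ℝ → Matrix (Fin n) (Fin n) ℝ} (hζ : IsKernel h T hh L ζ) :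
    ∃ K, KernelBounds h T K ζ := by
  have hE : ∀ i j, IsCT T 1 (fun t => entry h i j (L t)) := fun i j => hL.clm _
  choose C hC0 hC hLip using fun i j => (hE i j).exists_lipschitz hT
  obtain ⟨C₀, hC₀, hle⟩ : ∃ C₀, 0 ≤ C₀ ∧ ∀ i j, C i j ≤ C₀ :=
    ⟨∑ i, ∑ j, C i j, Finset.sum_nonneg fun i _ => Finset.sum_nonneg fun j _ => hC0 i j,
      fun i j => (Finset.single_le_sum (f := fun j => C i j) (fun j _ => hC0 i j)
        (Finset.mem_univ j)).trans (Finset.single_le_sum (f := fun i => ∑ j, C i j)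
        (fun i _ => Finset.sum_nonneg fun j _ => hC0 i j) (Finset.mem_univ i))⟩
  have hmono : C₀ ≤ C₀ + C₀ * h := by nlinarith [mul_nonneg hC₀ hh.le]
  refine ⟨C₀ + C₀ * h, hh, by positivity, hζ.periodic, hζ.rightContinuous, ?_, ?_, ?_, ?_, ?_⟩
  · intro t i j N δ s c hP
    exact ((hζ.isScalarKernel t i j).sum_abs_le (fun k hk => hP.node_mem hk)
      (fun k hk => (hP.cell k hk).1.trans (hP.cell k hk).2.1)).trans
      (((hC i j t).trans (hle i j)).trans hmono)
  · intro t i j N a δ s c ha hP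
    refine (sum_abs_path_le (fun r => hζ.isScalarKernel (t + r) i j) ha.1 le_rfl ha.2 hC₀
      (fun r _ r' _ => ?_) hP).trans ?_
    · refine (hLip i j _ _).trans ?_
      rw [add_sub_add_left_eq_sub]
      exact mul_le_mul_of_nonneg_right (hle i j) (abs_nonneg _)
    · have := (hC i j (t + a)).trans (hle i j)
      exact add_le_add this (mul_le_mul_of_nonneg_left (by linarith [ha.1]) hC₀)
  · intro i j s hs
    have : LipschitzWith (Real.toNNReal C₀) fun t => ζ t s i j := by
      refine LipschitzWith.of_dist_le_mul fun t t' => ?_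
      -- The partition with the single cell `[0,s]`: as `ζ(t,0) = 0`, the variation bound for
      -- `ζ(t,·) - ζ(t',·)` controls its value at `s`.
      have h1 := ((hζ.isScalarKernel t i j).sub (hζ.isScalarKernel t' i j)).sum_abs_le (N := 1)
        (s := fun k => if k = 0 then 0 else s) (fun k _ => by
          split_ifs
          exacts [⟨le_rfl, hh.le⟩, hs]) (fun k hk => by
          obtain rfl : k = 0 := by omega
          simpa using hs.1)
      simp only [Finset.range_one, Finset.sum_singleton, zero_add, one_ne_zero, if_false, if_true,
        hζ.zero, Matrix.zero_apply, sub_zero] at h1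
      rw [Real.dist_eq, Real.dist_eq, Real.coe_toNNReal _ hC₀]
      exact (h1.trans (hLip i j t t')).trans
        (mul_le_mul_of_nonneg_right (hle i j) (abs_nonneg _))
    exact this.continuous
  · exact fun t i j f hf => (hζ.isScalarKernel t i j).exists_hasRSInt ⟨le_rfl, hh.le⟩ hf
  · intro t i j a ha f hf
    have hd := fun r => ((hE i j).hasDerivAt (t + r)).comp_const_add t r
    refine exists_hasRSInt_path (fun r => hζ.isScalarKernel (t + r) i j) hd ?_ ha hf
    exact ((hE i j).1.continuous_deriv le_rfl).comp (continuous_const.add continuous_id)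

end entry

end PeriodicDDE

/-! ### The kernel integral and the adjoint integrals -/

namespace PeriodicDDE

variable {n : ℕ} {h T K : ℝ} {ζ : ℝ → ℝ → Matrix (Fin n) (Fin n) ℝ}

namespace KernelBounds

lemma exists_hasRSInt_mulVec (B : KernelBounds h T K ζ) (t : ℝ) {f : ℝ → Fin n → ℂ}
    (hf : ContinuousOn f (Icc 0 h)) :
    ∃ I, HasRSInt (fun c s => (cMat ζ t s).mulVec (f c)) 0 h I := by
  choose J hJ using fun i j => B.exists_hasRSInt t i j (fun c => f c j)
    ((continuous_apply j).comp_continuousOn hf)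
  refine ⟨fun i => ∑ j, J i j, hasRSInt_pi fun i =>
    (HasRSInt.finset_sum fun j (_ : j ∈ Finset.univ) => hJ i j).congr fun c _ s _ => ?_⟩
  simp [Matrix.mulVec, dotProduct, cMat, mul_comm]

lemma hasRSInt_kerInt (B : KernelBounds h T K ζ) (t : ℝ) {f : ℝ → Fin n → ℂ}
    (hf : ContinuousOn f (Icc 0 h)) :
    HasRSInt (fun c s => (cMat ζ t s).mulVec (f c)) 0 h (kerInt h ζ t f) := by
  obtain ⟨I, hI⟩ := B.exists_hasRSInt_mulVec t hf
  rwa [kerInt, hI.rsInt_eq B.pos.le]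

lemma norm_rsSum_mulVec_le (B : KernelBounds h T K ζ) (t : ℝ) {f : ℝ → Fin n → ℂ} {C : ℝ}
    (hC : ∀ c ∈ Icc 0 h, ‖f c‖ ≤ C) {N : ℕ} {δ : ℝ} {s c : ℕ → ℝ} (hP : IsTagged 0 h δ N s c) :
    ‖rsSum (fun c s => (cMat ζ t s).mulVec (f c)) N s c‖ ≤ n * (C * K) := by
  have hC0 : 0 ≤ C := (norm_nonneg _).trans (hC 0 ⟨le_rfl, B.pos.le⟩)
  refine (pi_norm_le_iff_of_nonneg (by have := B.nonneg; positivity)).mpr fun i => ?_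
  rw [rsSum_apply]
  calc _ ≤ ∑ k ∈ Finset.range N, ∑ j, C * |ζ t (s (k + 1)) i j - ζ t (s k) i j| := by
        refine (norm_sum_le _ _).trans (Finset.sum_le_sum fun k hk => ?_)
        simp only [Matrix.mulVec, dotProduct, cMat, Matrix.map_apply]
        rw [← Finset.sum_sub_distrib]
        refine (norm_sum_le _ _).trans (Finset.sum_le_sum fun j _ => ?_)
        rw [← sub_mul, norm_mul, ← Complex.ofReal_sub, Complex.norm_real, Real.norm_eq_abs,
          mul_comm]
        gcongr
        exact (norm_le_pi_norm _ j).trans (hC _ (hP.tag_mem (Finset.mem_range.mp hk)))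
    _ = ∑ j, C * ∑ k ∈ Finset.range N, |ζ t (s (k + 1)) i j - ζ t (s k) i j| := by
        rw [Finset.sum_comm]
        simp only [Finset.mul_sum]
    _ ≤ ∑ _j : Fin n, C * K := Finset.sum_le_sum fun j _ =>
        mul_le_mul_of_nonneg_left (B.sum_abs_le t i j hP) hC0
    _ = _ := by simp

lemma norm_kerInt_le (B : KernelBounds h T K ζ) (t : ℝ) {f : ℝ → Fin n → ℂ}
    (hf : ContinuousOn f (Icc 0 h)) {C : ℝ} (hC : ∀ c ∈ Icc 0 h, ‖f c‖ ≤ C) :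
    ‖kerInt h ζ t f‖ ≤ n * (C * K) :=
  (B.hasRSInt_kerInt t hf).norm_le B.pos.le fun _ _ _ hP => B.norm_rsSum_mulVec_le t hC hP

lemma kerInt_add (B : KernelBounds h T K ζ) (t : ℝ) {f g : ℝ → Fin n → ℂ}
    (hf : ContinuousOn f (Icc 0 h)) (hg : ContinuousOn g (Icc 0 h)) :
    kerInt h ζ t (fun θ => f θ + g θ) = kerInt h ζ t f + kerInt h ζ t g := by
  have := (B.hasRSInt_kerInt t hf).add (B.hasRSInt_kerInt t hg)
  simp only [← Matrix.mulVec_add] at this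
  exact this.rsInt_eq B.pos.le

lemma kerInt_smul (B : KernelBounds h T K ζ) (t : ℝ) {f : ℝ → Fin n → ℂ}
    (hf : ContinuousOn f (Icc 0 h)) (k : ℂ) :
    kerInt h ζ t (fun θ => k • f θ) = k • kerInt h ζ t f := by
  have := (B.hasRSInt_kerInt t hf).const_smul k
  simp only [← Matrix.mulVec_smul] at this
  exact this.rsInt_eq B.pos.le

lemma kerInt_sub (B : KernelBounds h T K ζ) (t : ℝ) {f g : ℝ → Fin n → ℂ}
    (hf : ContinuousOn f (Icc 0 h)) (hg : ContinuousOn g (Icc 0 h)) :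
    kerInt h ζ t (fun θ => f θ - g θ) = kerInt h ζ t f - kerInt h ζ t g := by
  have h1 := B.kerInt_add t (hf.sub hg) hg
  simp only [sub_add_cancel, Pi.sub_apply] at h1
  rw [h1, add_sub_cancel_right]
  rfl

end KernelBounds

lemma kerInt_congr (t : ℝ) {f g : ℝ → Fin n → ℂ} (hfg : ∀ θ ∈ Icc 0 h, f θ = g θ) :
    kerInt h ζ t f = kerInt h ζ t g :=
  rsInt_congr fun c hc _ _ => by rw [hfg c hc]

/-! ### The adjoint integrals -/

/-- The increment over `[s,s']` of `f ζ(t, ·)`, for a row vector `f`. -/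
def rowInc (ζ : ℝ → ℝ → Matrix (Fin n) (Fin n) ℝ) (f : Fin n → ℂ) (t s s' : ℝ) : Fin n → ℂ :=
  Matrix.vecMul f (cMat ζ t s') - Matrix.vecMul f (cMat ζ t s)

lemma rowInc_apply (f : Fin n → ℂ) (t s s' : ℝ) (j : Fin n) :
    rowInc ζ f t s s' j = ∑ i, f i * ((ζ t s' i j - ζ t s i j : ℝ) : ℂ) := by
  simp [rowInc, Matrix.vecMul, dotProduct, cMat, mul_sub, Finset.sum_sub_distrib]

/-- The integral `∫_θ^h e^{-σs} p(t+s) d_2ζ(t+s,s)`. -/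
noncomputable def adjInt (h : ℝ) (ζ : ℝ → ℝ → Matrix (Fin n) (Fin n) ℝ) (σ : ℂ)
    (p : ℝ → Fin n → ℂ) (t θ : ℝ) : Fin n → ℂ :=
  rsInt (fun c s => Matrix.vecMul (Complex.exp (-σ * c) • p (t + c)) (cMat ζ (t + c) s)) θ h

/-- The contribution of the cell `[u, u']` to a Riemann-Stieltjes sum for `adjInt`. -/
noncomputable def adjCell (ζ : ℝ → ℝ → Matrix (Fin n) (Fin n) ℝ) (σ : ℂ)
    (p : ℝ → Fin n → ℂ) (u u' t : ℝ) : Fin n → ℂ :=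
  rowInc ζ (Complex.exp (-σ * u) • p (t + u)) (t + u) u u'

/-- Riemann sums for `adjInt`, over the cells to the right of `θ`. -/
noncomputable def adjSum (h : ℝ) (ζ : ℝ → ℝ → Matrix (Fin n) (Fin n) ℝ) (σ : ℂ)
    (p : ℝ → Fin n → ℂ) (N : ℕ) (t θ : ℝ) : Fin n → ℂ :=
  ∑ k ∈ Finset.range N, if θ ≤ uniformNode 0 h N k then
    adjCell ζ σ p (uniformNode 0 h N k) (uniformNode 0 h N (k + 1)) t else 0

namespace KernelBounds

variable {σ : ℂ} {p : ℝ → Fin n → ℂ}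

lemma exists_hasRSInt_vecMul (B : KernelBounds h T K ζ) (t : ℝ) {θ : ℝ} (hθ : θ ∈ Icc 0 h)
    {f : ℝ → Fin n → ℂ} (hf : ContinuousOn f (Icc θ h)) :
    ∃ I, HasRSInt (fun c s => Matrix.vecMul (f c) (cMat ζ (t + c) s)) θ h I := by
  choose J hJ using fun j i => B.exists_hasRSInt_path t i j θ hθ (fun c => f c i)
    ((continuous_apply i).comp_continuousOn hf)
  refine ⟨fun j => ∑ i, J j i, hasRSInt_pi fun j =>
    (HasRSInt.finset_sum fun i (_ : i ∈ Finset.univ) => hJ j i).congr fun c _ s _ => ?_⟩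
  simp [Matrix.vecMul, dotProduct, cMat]

lemma hasRSInt_adjInt (B : KernelBounds h T K ζ) (hp : Continuous p) (t : ℝ) {θ : ℝ}
    (hθ : θ ∈ Icc 0 h) :
    HasRSInt (fun c s => Matrix.vecMul (Complex.exp (-σ * c) • p (t + c)) (cMat ζ (t + c) s)) θ h
      (adjInt h ζ σ p t θ) := by
  obtain ⟨I, hI⟩ := B.exists_hasRSInt_vecMul t hθ
    (f := fun c => Complex.exp (-σ * c) • p (t + c)) (by fun_prop)
  rwa [adjInt, hI.rsInt_eq hθ.2]

/-- Taking out `e^{σθ}` leaves the same adjoint integral at time `τ - θ` that occurs in `muCoeff`;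
the factor cancels against the `e^{-σθ}` of eigenfunctions and solutions evaluated at `-θ`. -/
lemma adjEig_eq (B : KernelBounds h T K ζ) (hp : Continuous p) (τ : ℝ) {θ : ℝ}
    (hθ : θ ∈ Icc 0 h) :
    adjEig h ζ σ p τ θ = Complex.exp (σ * θ) • adjInt h ζ σ p (τ - θ) θ := by
  refine HasRSInt.rsInt_eq ?_ hθ.2
  refine ((B.hasRSInt_adjInt (σ := σ) hp (τ - θ) hθ).const_smul (Complex.exp (σ * θ))).congr
    fun c _ s _ => ?_
  rw [← Matrix.smul_vecMul, smul_smul, ← Complex.exp_add]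
  rw [show τ - θ + c = τ + c - θ by ring, show σ * θ + -σ * c = σ * (θ - c) by ring]

lemma muCoeff_integrand_eq (τ θ : ℝ) :
    rsInt (fun c s => Matrix.vecMul (Complex.exp (-σ * c) • p (c + τ - θ))
      (cMat ζ (τ + c - θ) s)) θ h = adjInt h ζ σ p (τ - θ) θ :=
  rsInt_congr fun c _ s _ => by
    rw [show c + τ - θ = τ - θ + c by ring, show τ + c - θ = τ - θ + c by ring]

/-- The dominating constant for bounded convergence, uniform in `N`, `t` and `θ`: dropping the cells
left of `θ` only lowers the variation over all of `[0,h]`. -/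
lemma norm_adjSum_le (B : KernelBounds h T K ζ) {C : ℝ}
    (hC : ∀ t, ∀ c ∈ Icc 0 h, ‖Complex.exp (-σ * c) • p (t + c)‖ ≤ C) (N : ℕ) (t θ : ℝ) :
    ‖adjSum h ζ σ p N t θ‖ ≤ n * (C * K) := by
  have hC0 : 0 ≤ C := (norm_nonneg _).trans (hC 0 0 ⟨le_rfl, B.pos.le⟩)
  have hKC : 0 ≤ n * (C * K) := by have := B.nonneg; positivity
  rcases Nat.eq_zero_or_pos N with rfl | hN
  · simpa [adjSum] using hKC
  have hP := uniformNode_tagged B.pos.le hN (lt_add_one ((h - 0) / N))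
  set u := uniformNode 0 h N with hu
  refine (pi_norm_le_iff_of_nonneg hKC).mpr fun j => ?_
  rw [adjSum, Finset.sum_apply, ← hu]
  calc _ ≤ ∑ k ∈ Finset.range N, ∑ i, C * |ζ (t + u k) (u (k + 1)) i j - ζ (t + u k) (u k) i j| := by
        refine (norm_sum_le _ _).trans (Finset.sum_le_sum fun k hk => ?_)
        split_ifs
        · rw [adjCell, rowInc_apply]
          refine (norm_sum_le _ _).trans (Finset.sum_le_sum fun i _ => ?_)
          rw [norm_mul, Complex.norm_real, Real.norm_eq_abs]
          gcongr
          exact (norm_le_pi_norm _ i).trans (hC _ _ (hP.tag_mem (Finset.mem_range.mp hk)))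
        · simp only [Pi.zero_apply, norm_zero]
          positivity
    _ = ∑ i, C * ∑ k ∈ Finset.range N,
        |ζ (t + u k) (u (k + 1)) i j - ζ (t + u k) (u k) i j| := by
        rw [Finset.sum_comm]
        simp only [Finset.mul_sum]
    _ ≤ ∑ _i : Fin n, C * K := Finset.sum_le_sum fun i _ =>
        mul_le_mul_of_nonneg_left (B.sum_abs_path_le t i j ⟨le_rfl, B.pos.le⟩ hP) hC0
    _ = _ := by simp

/-- Up to the single cell straddling `θ`, `adjSum` is a Riemann sum over `[θ,h]`. The missing piece
is an increment of the kernel just to the right of `θ`, which is small by right-continuity; hence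
`θ` is interior. -/
lemma tendsto_adjSum (B : KernelBounds h T K ζ) (hp : Continuous p) (t : ℝ) {θ : ℝ}
    (hθ : θ ∈ Ioo 0 h) :
    Tendsto (fun N => adjSum h ζ σ p N t θ) atTop (𝓝 (adjInt h ζ σ p t θ)) := by
  set f : ℝ → Fin n → ℂ := fun c => Complex.exp (-σ * c) • p (t + c) with hf
  set G : ℝ → ℝ → Fin n → ℂ := fun c s => Matrix.vecMul (f c) (cMat ζ (t + c) s) with hG
  have hI : HasRSInt G θ h (adjInt h ζ σ p t θ) := B.hasRSInt_adjInt hp t ⟨hθ.1.le, hθ.2.le⟩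
  have hright : ContinuousWithinAt (G θ) (Ici θ) θ := by
    refine continuousWithinAt_pi.mpr fun j => ?_
    simp only [hG, Matrix.vecMul, dotProduct, cMat, Matrix.map_apply]
    refine tendsto_finsetSum _ fun i _ => ?_
    exact ((Complex.continuous_ofReal.continuousAt.comp_continuousWithinAt
      (B.right (t + θ) i j θ hθ)).const_mul _ : ContinuousWithinAt _ _ _)
  rw [Metric.tendsto_atTop']
  intro ε hε
  obtain ⟨δ₁, hδ₁, h1⟩ := hasRSInt_iff.mp hI (ε / 2) (by positivity)
  obtain ⟨δ₂, hδ₂, h2⟩ := Metric.continuousWithinAt_iff.mp hright (ε / 2) (by positivity)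
  obtain ⟨N₀, hN₀⟩ := eventually_atTop.mp
    (eventually_uniformNode_tagged B.pos.le (lt_min hδ₁ hδ₂))
  refine ⟨N₀, fun N hN => ?_⟩
  have hP := hN₀ N hN.le
  have hsum : adjSum h ζ σ p N t θ = ∑ k ∈ Finset.range N, if θ ≤ uniformNode 0 h N k then
      G (uniformNode 0 h N k) (uniformNode 0 h N (k + 1))
        - G (uniformNode 0 h N k) (uniformNode 0 h N k) else 0 := rfl
  set u := uniformNode 0 h N with hu
  -- Nodes left of `θ` are pushed onto `θ`, which turns the partition of `[0,h]` into one of `[θ,h]`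
  -- whose extra cells are degenerate.
  set s : ℕ → ℝ := fun k => max θ (u k) with hs
  have hu0 : u 0 = 0 := hP.left
  have huN : u N = h := hP.right
  have hPs : IsTagged θ h δ₁ N s s := by
    refine ⟨by simp [hs, hu0, hθ.1.le], by simp [hs, huN, hθ.2.le], fun k hk => ?_⟩
    have hc := hP.cell k hk
    have hle := hc.1.trans hc.2.1
    refine ⟨le_rfl, max_le_max le_rfl hle, ?_⟩
    have h3 := hc.2.2.trans_le (min_le_left δ₁ δ₂)
    simp only [hs]
    rcases le_total θ (u (k + 1)) with h4 | h4
    · rw [max_eq_right h4]; linarith [le_max_right θ (u k)]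
    · rw [max_eq_left h4]; linarith [le_max_left θ (u k)]
  have hdiff : rsSum G N s s - adjSum h ζ σ p N t θ
      = ∑ k ∈ Finset.range N, if θ ≤ u k then 0 else G θ (max θ (u (k + 1))) - G θ θ := by
    rw [hsum, rsSum, ← Finset.sum_sub_distrib]
    refine Finset.sum_congr rfl fun k hk => ?_
    have hc := hP.cell k (Finset.mem_range.mp hk)
    simp only [hs]
    split_ifs with h4
    · rw [max_eq_right h4, max_eq_right (h4.trans (hc.1.trans hc.2.1)), sub_self]
    · rw [max_eq_left (not_le.mp h4).le, sub_zero]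
  have hsmall : ‖rsSum G N s s - adjSum h ζ σ p N t θ‖ ≤ ε / 2 := by
    rw [hdiff]
    by_cases hex : ∃ k < N, u k < θ ∧ θ < u (k + 1)
    · obtain ⟨k, hk, hk1, hk2⟩ := hex
      rw [Finset.sum_eq_single k]
      · rw [if_neg (not_le.mpr hk1), max_eq_right hk2.le, ← dist_eq_norm]
        refine (h2 hk2.le ?_).le
        rw [Real.dist_eq, abs_of_nonneg (by linarith)]
        linarith [(hP.cell k hk).2.2.trans_le (min_le_right δ₁ δ₂)]
      · intro m hm hmk
        have hm' := Finset.mem_range.mp hm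
        rcases lt_or_gt_of_ne hmk with h4 | h4
        · have := hP.le_of_le (show m + 1 ≤ k by omega) hk.le
          rw [max_eq_left (this.trans hk1.le), sub_self, ite_self]
        · rw [if_pos (hk2.le.trans (hP.le_of_le (show k + 1 ≤ m by omega) hm'.le))]
      · intro hk'
        exact absurd (Finset.mem_range.mpr hk) hk'
    · push Not at hex
      rw [Finset.sum_eq_zero]
      · rw [norm_zero]; positivity
      · intro k hk
        split_ifs with h4
        · rfl
        · rw [max_eq_left (hex k (Finset.mem_range.mp hk) (not_le.mp h4)), sub_self]
  rw [dist_eq_norm]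
  calc _ = ‖(rsSum G N s s - adjInt h ζ σ p t θ) - (rsSum G N s s - adjSum h ζ σ p N t θ)‖ := by
        congr 1; abel
    _ ≤ _ := norm_sub_le _ _
    _ < ε / 2 + ε / 2 := add_lt_add_of_lt_of_le (h1 N s s hPs) hsmall
    _ = ε := by ring

lemma continuous_adjCell (B : KernelBounds h T K ζ) (hp : Continuous p) {u u' : ℝ}
    (hu : u ∈ Icc 0 h) (hu' : u' ∈ Icc 0 h) : Continuous (adjCell ζ σ p u u') := by
  refine continuous_pi fun j => ?_
  simp only [adjCell, rowInc_apply]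
  refine continuous_finsetSum _ fun i _ => ?_
  have h1 := (B.continuous i j u hu).comp (continuous_id.add (continuous_const (y := u)))
  have h2 := (B.continuous i j u' hu').comp (continuous_id.add (continuous_const (y := u)))
  refine Continuous.mul (by fun_prop) (Complex.continuous_ofReal.comp (h2.sub h1))

end KernelBounds

end PeriodicDDE

/-! ### Bounded convergence and the identity for the double adjoint integral -/

namespace PeriodicDDE

lemma norm_dotProduct_le {n : ℕ} (a b : Fin n → ℂ) : ‖a ⬝ᵥ b‖ ≤ n * (‖a‖ * ‖b‖) := by
  calc _ ≤ ∑ _i : Fin n, ‖a‖ * ‖b‖ := by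
        refine (norm_sum_le _ _).trans (Finset.sum_le_sum fun i _ => ?_)
        rw [norm_mul]
        gcongr <;> exact norm_le_pi_norm _ i
    _ = _ := by simp

/-- Bounded convergence on an interval. -/
lemma tendsto_intervalIntegral_of_bounded {E : Type*} [NormedAddCommGroup E] [NormedSpace ℝ E]
    {F : ℕ → ℝ → E} {f : ℝ → E} {a b C : ℝ} (hab : a ≤ b)
    (hF : ∀ N, IntervalIntegrable (F N) volume a b) (hC : ∀ N, ∀ x ∈ Ioo a b, ‖F N x‖ ≤ C)
    (hlim : ∀ x ∈ Ioo a b, Tendsto (fun N => F N x) atTop (𝓝 (f x))) :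
    IntervalIntegrable f volume a b ∧
      Tendsto (fun N => ∫ x in a..b, F N x) atTop (𝓝 (∫ x in a..b, f x)) := by
  have hae : ∀ᵐ x ∂(volume : Measure ℝ), x ∈ uIoc a b → x ∈ Ioo a b := by
    filter_upwards [Measure.ae_ne volume b] with x hx hx'
    rw [uIoc_of_le hab] at hx'
    exact ⟨hx'.1, lt_of_le_of_ne hx'.2 hx⟩
  have hae' : ∀ᵐ x ∂(volume.restrict (uIoc a b)), x ∈ Ioo a b :=
    (ae_restrict_iff' measurableSet_uIoc).mpr hae
  have hmeas : ∀ N, AEStronglyMeasurable (F N) (volume.restrict (uIoc a b)) := fun N =>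
    ((intervalIntegrable_iff).mp (hF N)).aestronglyMeasurable
  constructor
  · have hf : AEStronglyMeasurable f (volume.restrict (uIoc a b)) :=
      aestronglyMeasurable_of_tendsto_ae atTop hmeas (hae'.mono fun x hx => hlim x hx)
    refine (intervalIntegrable_const (c := C)).mono_fun hf ?_
    filter_upwards [hae'] with x hx
    exact (le_of_tendsto (hlim x hx).norm (Eventually.of_forall fun N => hC N x hx)).trans
      (Real.le_norm_self C)
  · exact intervalIntegral.tendsto_integral_filter_of_dominated_convergence (fun _ => C)
      (Eventually.of_forall hmeas)
      (Eventually.of_forall fun N => hae.mono fun x hx hx' => hC N x (hx hx'))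
      intervalIntegrable_const (hae.mono fun x hx hx' => hlim x (hx hx'))

lemma intervalIntegral_swap {F : ℝ → ℝ → ℂ} (hF : Continuous (Function.uncurry F)) {a b c d : ℝ}
    (hab : a ≤ b) (hcd : c ≤ d) :
    ∫ x in a..b, ∫ y in c..d, F x y = ∫ y in c..d, ∫ x in a..b, F x y := by
  simp only [intervalIntegral.integral_of_le hab, intervalIntegral.integral_of_le hcd]
  refine integral_integral_swap ?_
  rw [Measure.prod_restrict]
  exact (hF.continuousOn.integrableOn_compact (isCompact_Icc.prod isCompact_Icc)).mono_set
    (prod_mono Ioc_subset_Icc_self Ioc_subset_Icc_self)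

lemma continuous_dotProduct {X : Type*} [TopologicalSpace X] {n : ℕ} {f g : X → Fin n → ℂ}
    (hf : Continuous f) (hg : Continuous g) : Continuous fun x => f x ⬝ᵥ g x := by
  unfold dotProduct; fun_prop

variable {n : ℕ} {h T K : ℝ} {ζ : ℝ → ℝ → Matrix (Fin n) (Fin n) ℝ} {σ : ℂ}
  {p : ℝ → Fin n → ℂ}

lemma exists_adjWeight_bound (hT : 0 < T) (hp : Continuous p) (hpT : Function.Periodic p T) :
    ∃ C, ∀ t, ∀ c ∈ Icc 0 h, ‖Complex.exp (-σ * c) • p (t + c)‖ ≤ C := by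
  obtain ⟨C, hC0, hC⟩ := exists_bound_of_periodic hT hp hpT
  obtain ⟨C', hC'⟩ := (isCompact_Icc (a := (0 : ℝ)) (b := h)).exists_bound_of_continuousOn
    (f := fun c : ℝ => Complex.exp (-σ * c)) (by fun_prop)
  refine ⟨C' * C, fun t c hc => ?_⟩
  rw [norm_smul]
  exact mul_le_mul (hC' c hc) (hC _) (norm_nonneg _) ((norm_nonneg _).trans (hC' c hc))

lemma rowInc_smul (k : ℂ) (f : Fin n → ℂ) (t s s' : ℝ) :
    rowInc ζ (k • f) t s s' = k • rowInc ζ f t s s' := by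
  simp only [rowInc, Matrix.smul_vecMul, smul_sub]

namespace KernelBounds

lemma adjSum_dotProduct (N : ℕ) (t θ : ℝ) (x : Fin n → ℂ) :
    adjSum h ζ σ p N t θ ⬝ᵥ x = ∑ k ∈ Finset.range N, indicator {θ | θ ≤ uniformNode 0 h N k}
      (fun _ => adjCell ζ σ p (uniformNode 0 h N k) (uniformNode 0 h N (k + 1)) t ⬝ᵥ x) θ := by
  rw [adjSum, sum_dotProduct]
  refine Finset.sum_congr rfl fun k _ => ?_
  by_cases hk : θ ≤ uniformNode 0 h N k
  · rw [if_pos hk, indicator_of_mem (by exact hk)]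
  · rw [if_neg hk, indicator_of_notMem (by exact hk), zero_dotProduct]

lemma uniformNode_mem (B : KernelBounds h T K ζ) {N k : ℕ} (hk : k ≤ N) :
    uniformNode 0 h N k ∈ Icc 0 h := by
  rcases Nat.eq_zero_or_pos N with rfl | hN
  · simp [uniformNode, B.pos.le]
  · exact (uniformNode_tagged B.pos.le hN (lt_add_one ((h - 0) / N))).node_mem hk

lemma continuous_adjCell_dotProduct (B : KernelBounds h T K ζ) (hp : Continuous p)
    {Φ : ℝ → ℝ → Fin n → ℂ} (hΦ : Continuous (Function.uncurry Φ)) {N k : ℕ} (hk : k < N) :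
    Continuous (Function.uncurry fun τ θ => adjCell ζ σ p (uniformNode 0 h N k)
      (uniformNode 0 h N (k + 1)) (τ - θ) ⬝ᵥ Φ τ θ) :=
  continuous_dotProduct ((B.continuous_adjCell hp (B.uniformNode_mem hk.le)
    (B.uniformNode_mem hk)).comp (continuous_fst.sub continuous_snd)) hΦ

lemma intervalIntegrable_adjSum (B : KernelBounds h T K ζ) (hp : Continuous p)
    {Φ : ℝ → ℝ → Fin n → ℂ} (hΦ : Continuous (Function.uncurry Φ)) (N : ℕ) (τ : ℝ) :
    IntervalIntegrable (fun θ => adjSum h ζ σ p N (τ - θ) θ ⬝ᵥ Φ τ θ) volume 0 h := by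
  simp only [adjSum_dotProduct]
  have := fun k (hk : k ∈ Finset.range N) =>
    ((intervalIntegrable_iff.mp (((B.continuous_adjCell_dotProduct (σ := σ) hp hΦ
      (Finset.mem_range.mp hk)).comp (continuous_const.prodMk continuous_id :
        Continuous fun θ : ℝ => (τ, θ))).intervalIntegrable (μ := volume) 0 h)).indicator
      (measurableSet_Iic (a := uniformNode 0 h N k)))
  rw [intervalIntegrable_iff]
  refine integrable_finsetSum _ fun k hk => (this k hk).congr (ae_of_all _ fun θ => ?_)
  rfl

lemma integral_adjSum (B : KernelBounds h T K ζ) (hp : Continuous p)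
    {Φ : ℝ → ℝ → Fin n → ℂ} (hΦ : Continuous (Function.uncurry Φ)) (N : ℕ) (τ : ℝ) :
    ∫ θ in (0 : ℝ)..h, adjSum h ζ σ p N (τ - θ) θ ⬝ᵥ Φ τ θ = ∑ k ∈ Finset.range N,
      ∫ θ in (0 : ℝ)..uniformNode 0 h N k, adjCell ζ σ p (uniformNode 0 h N k)
        (uniformNode 0 h N (k + 1)) (τ - θ) ⬝ᵥ Φ τ θ := by
  simp only [adjSum_dotProduct]
  have hk := fun k (hk : k ∈ Finset.range N) =>
    ((B.continuous_adjCell_dotProduct (σ := σ) hp hΦ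
      (Finset.mem_range.mp hk)).comp (continuous_const.prodMk continuous_id :
        Continuous fun θ : ℝ => (τ, θ))).intervalIntegrable (μ := volume) 0 h
  have hi : ∀ k ∈ Finset.range N, IntervalIntegrable (indicator {θ | θ ≤ uniformNode 0 h N k}
      (fun θ => adjCell ζ σ p (uniformNode 0 h N k)
        (uniformNode 0 h N (k + 1)) (τ - θ) ⬝ᵥ Φ τ θ)) volume 0 h := fun k hk' => by
    rw [intervalIntegrable_iff]
    exact (intervalIntegrable_iff.mp (hk k hk')).indicator
      (measurableSet_Iic (a := uniformNode 0 h N k))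
  calc
    _ = ∫ θ in (0 : ℝ)..h, ∑ k ∈ Finset.range N, indicator {θ | θ ≤ uniformNode 0 h N k}
          (fun θ => adjCell ζ σ p (uniformNode 0 h N k)
            (uniformNode 0 h N (k + 1)) (τ - θ) ⬝ᵥ Φ τ θ) θ := rfl
    _ = _ := by
      rw [intervalIntegral.integral_finsetSum hi]
      exact Finset.sum_congr rfl fun k hk' => intervalIntegral.integral_indicator
        (B.uniformNode_mem (Finset.mem_range.mp hk').le)

lemma continuous_integral_adjSum (B : KernelBounds h T K ζ) (hp : Continuous p)
    {Φ : ℝ → ℝ → Fin n → ℂ} (hΦ : Continuous (Function.uncurry Φ)) (N : ℕ) :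
    Continuous fun τ => ∫ θ in (0 : ℝ)..h, adjSum h ζ σ p N (τ - θ) θ ⬝ᵥ Φ τ θ := by
  simp only [B.integral_adjSum hp hΦ N]
  exact continuous_finsetSum _ fun k hk =>
    intervalIntegral.continuous_parametric_intervalIntegral_of_continuous'
      (B.continuous_adjCell_dotProduct hp hΦ (Finset.mem_range.mp hk)) _ _

/-- In `adjSum` the variable `θ` enters through indicators and continuous cell functions only.
Measurability of `adjInt` along `(τ - θ, θ)`, not evident from its definition, is inherited from
these sums in the limit. -/
lemma tendsto_integral_adjSum (B : KernelBounds h T K ζ) (hT : 0 < T) (hp : Continuous p)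
    (hpT : Function.Periodic p T) {Φ : ℝ → ℝ → Fin n → ℂ}
    (hΦ : Continuous (Function.uncurry Φ)) (τ : ℝ) :
    IntervalIntegrable (fun θ => adjInt h ζ σ p (τ - θ) θ ⬝ᵥ Φ τ θ) volume 0 h ∧
    Tendsto (fun N => ∫ θ in (0 : ℝ)..h, adjSum h ζ σ p N (τ - θ) θ ⬝ᵥ Φ τ θ) atTop
      (𝓝 (∫ θ in (0 : ℝ)..h, adjInt h ζ σ p (τ - θ) θ ⬝ᵥ Φ τ θ)) := by
  obtain ⟨C, hC⟩ := exists_adjWeight_bound (h := h) (σ := σ) hT hp hpT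
  obtain ⟨D, hD⟩ := (isCompact_Icc (a := (0 : ℝ)) (b := h)).exists_bound_of_continuousOn
    (f := fun θ => Φ τ θ) (hΦ.comp (continuous_const.prodMk continuous_id)).continuousOn
  refine tendsto_intervalIntegral_of_bounded (C := n * (n * (C * K) * D)) B.pos.le
    (fun N => B.intervalIntegrable_adjSum hp hΦ N τ) (fun N θ hθ => ?_) (fun θ hθ => ?_)
  · refine (norm_dotProduct_le _ _).trans ?_
    have h1 := B.norm_adjSum_le hC N (τ - θ) θ
    have h2 := hD θ (Ioo_subset_Icc_self hθ)
    have := (norm_nonneg _).trans h1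
    gcongr
  · exact ((continuous_dotProduct continuous_id continuous_const).tendsto _).comp
      (B.tendsto_adjSum hp (τ - θ) hθ)

lemma tendsto_integral_integral_adjSum (B : KernelBounds h T K ζ) (hT : 0 < T) (hp : Continuous p)
    (hpT : Function.Periodic p T) {Φ : ℝ → ℝ → Fin n → ℂ}
    (hΦ : Continuous (Function.uncurry Φ)) :
    IntervalIntegrable (fun τ => ∫ θ in (0 : ℝ)..h, adjInt h ζ σ p (τ - θ) θ ⬝ᵥ Φ τ θ)
      volume 0 T ∧
    Tendsto (fun N => ∫ τ in (0 : ℝ)..T, ∫ θ in (0 : ℝ)..h,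
        adjSum h ζ σ p N (τ - θ) θ ⬝ᵥ Φ τ θ) atTop
      (𝓝 (∫ τ in (0 : ℝ)..T, ∫ θ in (0 : ℝ)..h, adjInt h ζ σ p (τ - θ) θ ⬝ᵥ Φ τ θ)) := by
  obtain ⟨C, hC⟩ := exists_adjWeight_bound (h := h) (σ := σ) hT hp hpT
  obtain ⟨D, hD⟩ := ((isCompact_Icc (a := (0 : ℝ)) (b := T)).prod
    (isCompact_Icc (a := (0 : ℝ)) (b := h))).exists_bound_of_continuousOn hΦ.continuousOn
  refine tendsto_intervalIntegral_of_bounded (C := n * (n * (C * K) * D) * |h - 0|) hT.le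
    (fun N => (B.continuous_integral_adjSum hp hΦ N).intervalIntegrable _ _)
    (fun N τ hτ => ?_) (fun τ _ => (B.tendsto_integral_adjSum hT hp hpT hΦ τ).2)
  refine intervalIntegral.norm_integral_le_of_norm_le_const fun θ hθ => ?_
  rw [uIoc_of_le B.pos.le] at hθ
  refine (norm_dotProduct_le _ _).trans ?_
  have h1 := B.norm_adjSum_le hC N (τ - θ) θ
  have h2 := hD (τ, θ) ⟨Ioo_subset_Icc_self hτ, Ioc_subset_Icc_self hθ⟩
  have := (norm_nonneg _).trans h1
  gcongr
  exact h2

/-- Riemann sums for the kernel integral in the derivative of the characteristic operator. -/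
lemma dotProduct_rsSum (N : ℕ) (t : ℝ) (x : Fin n → ℂ) (f : ℝ → Fin n → ℂ) (k : ℝ → ℂ)
    (u : ℕ → ℝ) :
    x ⬝ᵥ rsSum (fun c s => (cMat ζ t s).mulVec (k c • f c)) N u u
      = ∑ i ∈ Finset.range N, rowInc ζ (k (u i) • x) t (u i) (u (i + 1)) ⬝ᵥ f (u i) := by
  rw [rsSum, dotProduct_sum]
  refine Finset.sum_congr rfl fun i _ => ?_
  rw [rowInc, dotProduct_sub, sub_dotProduct, Matrix.smul_vecMul, Matrix.smul_vecMul,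
    Matrix.mulVec_smul, Matrix.mulVec_smul, dotProduct_smul, dotProduct_smul, smul_dotProduct,
    smul_dotProduct, Matrix.dotProduct_mulVec, Matrix.dotProduct_mulVec]

/-- Formally Fubini and a shift: at fixed `s` the integrand depends on `τ` and `θ` through `τ - θ`
alone and is `T`-periodic in it, so integration over `θ ∈ [0,s]` produces the factor `s`, and `t = τ
- θ + s` becomes the new time. The exchange is made for the finite sums, where all integrands are
continuous, and then passed to the limit. -/
theorem integral_adjInt (B : KernelBounds h T K ζ) (hT : 0 < T) (hp : Continuous p)
    (hpT : Function.Periodic p T) {ξ : ℝ → Fin n → ℂ} (hξ : Continuous ξ)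
    (hξT : Function.Periodic ξ T) :
    IntervalIntegrable (fun t => p t ⬝ᵥ kerInt h ζ t fun s =>
      ((s : ℂ) * Complex.exp (-σ * s)) • ξ (t - s)) volume 0 T ∧
    ∫ τ in (0 : ℝ)..T, ∫ θ in (0 : ℝ)..h, adjInt h ζ σ p (τ - θ) θ ⬝ᵥ ξ (τ - θ)
      = ∫ t in (0 : ℝ)..T, p t ⬝ᵥ kerInt h ζ t fun s =>
        ((s : ℂ) * Complex.exp (-σ * s)) • ξ (t - s) := by
  have hΦ : Continuous (Function.uncurry fun τ θ => ξ (τ - θ)) :=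
    hξ.comp (continuous_fst.sub continuous_snd)
  have hlim := (B.tendsto_integral_integral_adjSum (σ := σ) hT hp hpT hΦ).2
  set S : ℕ → ℝ → ℂ := fun N t => p t ⬝ᵥ rsSum (fun c s => (cMat ζ t s).mulVec
    (((c : ℂ) * Complex.exp (-σ * c)) • ξ (t - c))) N (uniformNode 0 h N) (uniformNode 0 h N)
    with hS
  have hScont : ∀ N, Continuous (S N) := by
    intro N
    simp only [hS, dotProduct_rsSum]
    refine continuous_finsetSum _ fun i hi => continuous_dotProduct (continuous_pi fun j => ?_)
      (by fun_prop)
    have hi' := Finset.mem_range.mp hi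
    simp only [rowInc_apply]
    refine continuous_finsetSum _ fun m _ => Continuous.mul (by fun_prop)
      (Complex.continuous_ofReal.comp ((B.continuous _ _ _ (B.uniformNode_mem hi')).sub
        (B.continuous _ _ _ (B.uniformNode_mem hi'.le))))
  -- Cell by cell: after the swap the inner integral over a period does not depend on `θ`, so the
  -- outer one over `[0, u k]` gives the factor `u k`.
  have hfin : ∀ N, ∫ τ in (0 : ℝ)..T, ∫ θ in (0 : ℝ)..h,
      adjSum h ζ σ p N (τ - θ) θ ⬝ᵥ ξ (τ - θ) = ∫ t in (0 : ℝ)..T, S N t := by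
    intro N
    simp only [B.integral_adjSum hp hΦ N]
    set u := uniformNode 0 h N with hu
    have hc : ∀ k ∈ Finset.range N, Continuous (Function.uncurry fun τ θ =>
        adjCell ζ σ p (u k) (u (k + 1)) (τ - θ) ⬝ᵥ ξ (τ - θ)) := fun k hk =>
      B.continuous_adjCell_dotProduct hp hΦ (Finset.mem_range.mp hk)
    rw [intervalIntegral.integral_finsetSum fun k hk =>
      (intervalIntegral.continuous_parametric_intervalIntegral_of_continuous' (hc k hk) _
        _).intervalIntegrable _ _]
    have hSi : ∀ k ∈ Finset.range N, IntervalIntegrable (fun t => (u k : ℂ) *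
        (adjCell ζ σ p (u k) (u (k + 1)) (t - u k) ⬝ᵥ ξ (t - u k))) volume 0 T := fun k hk =>
      (continuous_const.mul ((hc k hk).comp (continuous_id.prodMk
        continuous_const : Continuous fun t : ℝ => (t, u k)))).intervalIntegrable _ _
    have hSe : ∀ t, S N t = ∑ k ∈ Finset.range N, (u k : ℂ) *
        (adjCell ζ σ p (u k) (u (k + 1)) (t - u k) ⬝ᵥ ξ (t - u k)) := by
      intro t
      simp only [hS]
      rw [dotProduct_rsSum N t (p t) (fun c => ξ (t - c)) (fun c => (c : ℂ) * Complex.exp (-σ * c))]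
      refine Finset.sum_congr rfl fun k _ => ?_
      rw [adjCell, sub_add_cancel, mul_smul, rowInc_smul, smul_dotProduct, smul_eq_mul]
    simp only [hSe]
    rw [intervalIntegral.integral_finsetSum hSi]
    refine Finset.sum_congr rfl fun k hk => ?_
    have hk' := Finset.mem_range.mp hk
    have huk := B.uniformNode_mem hk'.le
    have huk' := B.uniformNode_mem hk'
    have hper : Function.Periodic (fun t => adjCell ζ σ p (u k) (u (k + 1)) t ⬝ᵥ ξ t) T := by
      intro t
      simp only [adjCell, rowInc, cMat]
      rw [hξT, add_right_comm, hpT, B.periodic _ _ huk, B.periodic _ _ huk']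
    have hshift : ∀ a, ∫ t in (0 : ℝ)..T, adjCell ζ σ p (u k) (u (k + 1)) (t - a) ⬝ᵥ ξ (t - a)
        = ∫ t in (0 : ℝ)..T, adjCell ζ σ p (u k) (u (k + 1)) t ⬝ᵥ ξ t := by
      intro a
      rw [intervalIntegral.integral_comp_sub_right
        (fun t => adjCell ζ σ p (u k) (u (k + 1)) t ⬝ᵥ ξ t) a]
      have := hper.intervalIntegral_add_eq (0 - a) 0
      rw [zero_add] at this
      rw [← this]
      congr 1
      ring
    rw [intervalIntegral_swap (hc k hk) hT.le huk.1]
    simp only [hshift]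
    rw [intervalIntegral.integral_const, intervalIntegral.integral_const_mul, hshift, sub_zero,
      Complex.real_smul]
  obtain ⟨Cp, hCp0, hCp⟩ := exists_bound_of_periodic hT hp hpT
  obtain ⟨Cξ, hCξ0, hCξ⟩ := exists_bound_of_periodic hT hξ hξT
  obtain ⟨C', hC'⟩ := (isCompact_Icc (a := (0 : ℝ)) (b := h)).exists_bound_of_continuousOn
    (f := fun c : ℝ => (c : ℂ) * Complex.exp (-σ * c)) (by fun_prop)
  have hC'0 : 0 ≤ C' := (norm_nonneg _).trans (hC' 0 ⟨le_rfl, B.pos.le⟩)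
  -- The index is shifted to `N + 1` because a uniform partition, and with it the uniform bound,
  -- needs at least one cell.
  have hdct := tendsto_intervalIntegral_of_bounded (F := fun N => S (N + 1))
    (f := fun t => p t ⬝ᵥ kerInt h ζ t fun s => ((s : ℂ) * Complex.exp (-σ * s)) • ξ (t - s))
    (C := n * (Cp * (n * (C' * Cξ * K)))) hT.le
    (fun N => (hScont _).intervalIntegrable _ _) (fun N t _ => by
      refine (norm_dotProduct_le _ _).trans ?_
      have := B.norm_rsSum_mulVec_le t (C := C' * Cξ)
        (f := fun c => ((c : ℂ) * Complex.exp (-σ * c)) • ξ (t - c)) (fun c hc => by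
          rw [norm_smul]
          exact mul_le_mul (hC' c hc) (hCξ _) (norm_nonneg _) hC'0)
        (uniformNode_tagged B.pos.le (Nat.succ_pos N) (lt_add_one _))
      gcongr
      exact hCp t) (fun t _ => by
      have h1 := (B.hasRSInt_kerInt t (f := fun s => ((s : ℂ) * Complex.exp (-σ * s)) • ξ (t - s))
        (by fun_prop)).tendsto B.pos.le
      exact ((continuous_dotProduct (continuous_const (y := p t)) continuous_id).tendsto _).comp
        (h1.comp (tendsto_add_atTop_nat 1)))
  refine ⟨hdct.1, tendsto_nhds_unique (hlim.comp (tendsto_add_atTop_nat 1)) ?_⟩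
  refine hdct.2.congr fun N => ?_
  exact (hfin (N + 1)).symm

end KernelBounds

end PeriodicDDE

namespace PeriodicDDE

variable {n : ℕ} {h T K : ℝ} {ζ : ℝ → ℝ → Matrix (Fin n) (Fin n) ℝ} {σ : ℂ}

/-! ### The characteristic operator -/

namespace IsCT

variable {E : Type*} [NormedAddCommGroup E] [NormedSpace ℝ E] {f g : ℝ → E} {l : ℕ}

lemma sub (hf : IsCT T l f) (hg : IsCT T l g) : IsCT T l (fun t => f t - g t) :=
  ⟨hf.1.sub hg.1, fun t => by simp only [hf.2 t, hg.2 t]⟩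

lemma const_smul [NormedSpace ℂ E] (k : ℂ) (hf : IsCT T l f) : IsCT T l (fun t => k • f t) :=
  ⟨contDiff_const.smul hf.1, fun t => by simp only [hf.2 t]⟩

end IsCT

namespace KernelBounds

lemma charOp_sub (B : KernelBounds h T K ζ) {ξ q : ℝ → Fin n → ℂ} (hξ : IsCT T 1 ξ)
    (hq : IsCT T 1 q) (τ : ℝ) :
    charOp h ζ σ (fun t => ξ t - q t) τ = charOp h ζ σ ξ τ - charOp h ζ σ q τ := by
  have hξc := hξ.1.continuous
  have hqc := hq.1.continuous
  have h1 := B.kerInt_sub τ (f := fun θ => Complex.exp (-σ * θ) • ξ (τ - θ))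
    (g := fun θ => Complex.exp (-σ * θ) • q (τ - θ)) (by fun_prop) (by fun_prop)
  simp only [charOp, smul_sub, h1]
  rw [show deriv (fun t => ξ t - q t) τ = deriv ξ τ - deriv q τ from
    ((hξ.hasDerivAt τ).sub (hq.hasDerivAt τ)).deriv]
  abel

lemma charOp_smul (B : KernelBounds h T K ζ) {q : ℝ → Fin n → ℂ} (hq : IsCT T 1 q) (k : ℂ)
    (τ : ℝ) : charOp h ζ σ (fun t => k • q t) τ = k • charOp h ζ σ q τ := by
  have hqc := hq.1.continuous
  have h1 := B.kerInt_smul τ (f := fun θ => Complex.exp (-σ * θ) • q (τ - θ)) (by fun_prop) k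
  rw [charOp, charOp, show deriv (fun t => k • q t) τ = k • deriv q τ from
    ((hq.hasDerivAt τ).const_smul k).deriv, smul_sub, smul_add, ← h1, smul_comm σ k]
  congr 1
  exact kerInt_congr τ fun θ _ => smul_comm _ _ _

/-- Differentiation under the kernel integral, justified by `|e^{-kθ} - 1 + kθ| ≤ |kθ|²` uniformly
on `[0,h]` and the bound `norm_kerInt_le`. -/
theorem charOpDeriv_eq (B : KernelBounds h T K ζ) {ξ : ℝ → Fin n → ℂ} (hξ : Continuous ξ)
    (τ : ℝ) : charOpDeriv h ζ σ ξ τ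
      = ξ τ + kerInt h ζ τ fun s => ((s : ℂ) * Complex.exp (-σ * s)) • ξ (τ - s) := by
  obtain ⟨C, hC⟩ := (isCompact_Icc (a := (0 : ℝ)) (b := h)).exists_bound_of_continuousOn
    (f := fun c : ℝ => Complex.exp (-σ * c) • ξ (τ - c)) (by fun_prop)
  have hC0 : 0 ≤ C := (norm_nonneg _).trans (hC 0 ⟨le_rfl, B.pos.le⟩)
  set F : ℂ → Fin n → ℂ := fun z => kerInt h ζ τ fun θ => Complex.exp (-z * θ) • ξ (τ - θ)
  set J : Fin n → ℂ := kerInt h ζ τ fun s => ((s : ℂ) * Complex.exp (-σ * s)) • ξ (τ - s)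
  have key : HasDerivAt F (-J) σ := by
    rw [hasDerivAt_iff_isLittleO_nhds_zero]
    refine Asymptotics.IsBigO.trans_isLittleO (g := fun k : ℂ => k ^ 2) ?_
      (Asymptotics.isLittleO_pow_id one_lt_two)
    refine Asymptotics.IsBigO.of_bound (n * ((h ^ 2 * C) * K)) ?_
    -- With this radius `‖k‖ * h ≤ 1`, as the quadratic estimate of the exponential requires.
    have hball : Metric.ball (0 : ℂ) (1 / (h + 1)) ∈ 𝓝 (0 : ℂ) :=
      Metric.ball_mem_nhds _ (by have := B.pos; positivity)
    filter_upwards [hball] with k hk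
    rw [mem_ball_zero_iff, lt_div_iff₀ (by linarith [B.pos])] at hk
    have e : F (σ + k) - F σ - k • -J = kerInt h ζ τ fun θ =>
        (Complex.exp (-k * θ) - 1 - (-k * θ)) • (Complex.exp (-σ * θ) • ξ (τ - θ)) := by
      have h1 := B.kerInt_sub τ (f := fun θ => Complex.exp (-(σ + k) * θ) • ξ (τ - θ))
        (g := fun θ => Complex.exp (-σ * θ) • ξ (τ - θ)) (by fun_prop) (by fun_prop)
      have h2 := B.kerInt_smul τ (f := fun s => ((s : ℂ) * Complex.exp (-σ * s)) • ξ (τ - s))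
        (by fun_prop) k
      have h3 := B.kerInt_add τ
        (f := fun θ => Complex.exp (-(σ + k) * θ) • ξ (τ - θ) - Complex.exp (-σ * θ) • ξ (τ - θ))
        (g := fun s => k • ((s : ℂ) * Complex.exp (-σ * s)) • ξ (τ - s))
        (by fun_prop) (by fun_prop)
      simp only [F, J]
      rw [smul_neg, sub_neg_eq_add, ← h1, ← h2, ← h3]
      refine kerInt_congr τ fun θ _ => ?_
      rw [← sub_smul, smul_smul, smul_smul, ← add_smul]
      congr 1
      rw [show -(σ + k) * (θ : ℂ) = -k * θ + -σ * θ by ring, Complex.exp_add]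
      ring
    rw [e, norm_pow]
    refine (B.norm_kerInt_le τ (C := h ^ 2 * C * ‖k‖ ^ 2) (by fun_prop) fun θ hθ => ?_).trans
      (le_of_eq (by ring))
    have hkθ : ‖-k * (θ : ℂ)‖ ≤ ‖k‖ * h := by
      rw [norm_mul, norm_neg, Complex.norm_real, Real.norm_of_nonneg hθ.1]
      exact mul_le_mul_of_nonneg_left hθ.2 (norm_nonneg k)
    have h4 := Complex.norm_exp_sub_one_sub_id_le (x := -k * θ)
      (hkθ.trans (by nlinarith [norm_nonneg k]))
    rw [norm_smul]
    calc _ ≤ (‖k‖ * h) ^ 2 * C := mul_le_mul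
          (h4.trans (pow_le_pow_left₀ (norm_nonneg _) hkθ 2)) (hC θ hθ) (norm_nonneg _)
          (by positivity)
      _ = _ := by ring
  have h5 : HasDerivAt (fun z : ℂ => charOp h ζ z ξ τ) ((1 : ℂ) • ξ τ - -J) σ :=
    (((hasDerivAt_id σ).smul_const (ξ τ)).const_add (deriv ξ τ)).sub key
  rw [charOpDeriv, h5.deriv, one_smul, sub_neg_eq_add]

theorem pairT_charOpDeriv (B : KernelBounds h T K ζ) (hT : 0 < T) {p ξ : ℝ → Fin n → ℂ}
    (hp : IsCT T 1 p) (hξ : IsCT T 1 ξ) :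
    pairT T p (charOpDeriv h ζ σ ξ) = pairT T p ξ + ∫ τ in (0 : ℝ)..T, ∫ θ in (0 : ℝ)..h,
      adjInt h ζ σ p (τ - θ) θ ⬝ᵥ ξ (τ - θ) := by
  have h1 := B.integral_adjInt (σ := σ) hT hp.1.continuous hp.2 hξ.1.continuous hξ.2
  rw [h1.2, pairT, pairT, ← intervalIntegral.integral_add _ h1.1]
  · exact intervalIntegral.integral_congr fun τ _ => by
      simp only [B.charOpDeriv_eq hξ.1.continuous, dotProduct_add]
  · exact (continuous_dotProduct hp.1.continuous hξ.1.continuous).intervalIntegrable _ _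

lemma deriv_eq_of_charOp_eq_zero {q : ℝ → Fin n → ℂ} {τ : ℝ} (hq : charOp h ζ σ q τ = 0) :
    deriv q τ = kerInt h ζ τ (fun θ => Complex.exp (-σ * θ) • q (τ - θ)) - σ • q τ := by
  rw [charOp, sub_eq_zero] at hq
  rw [← hq, add_sub_cancel_right]

/-- Forward uniqueness for the delay equation by steps: over a short interval the maximum of `‖d‖`
is at most half of itself. Periodicity then carries the vanishing to negative times. -/
theorem eq_zero_of_charOp_eq_zero (B : KernelBounds h T K ζ) (hT : 0 < T) {d : ℝ → Fin n → ℂ}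
    (hd : IsCT T 1 d) (hd0 : ∀ τ, charOp h ζ σ d τ = 0) (hz : ∀ t ∈ Icc (-h) 0, d t = 0) :
    ∀ t, d t = 0 := by
  have hdc := hd.1.continuous
  have hh := B.pos
  have hK := B.nonneg
  obtain ⟨M, hM⟩ := (isCompact_Icc (a := (0 : ℝ)) (b := h)).exists_bound_of_continuousOn
    (f := fun c : ℝ => Complex.exp (-σ * c)) (by fun_prop)
  have hM0 : 0 ≤ M := (norm_nonneg _).trans (hM 0 ⟨le_rfl, hh.le⟩)
  set A : ℝ := n * (M * K) + ‖σ‖ with hA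
  have hA0 : 0 ≤ A := by positivity
  -- `A` bounds the right-hand side of `d' = …` relative to `sup ‖d‖`, and `A * η ≤ 1 / 2` makes one
  -- step a contraction.
  set η : ℝ := 1 / (2 * (A + 1)) with hη
  have hη0 : 0 < η := by positivity
  have hηA : A * η ≤ 1 / 2 := by
    rw [hη, mul_one_div, div_le_div_iff₀ (by positivity) (by positivity)]
    linarith
  have key : ∀ m : ℕ, ∀ t ∈ Icc (-h) (m * η), d t = 0 := by
    intro m
    induction m with
    | zero => simpa using hz
    | succ m ih =>
      push_cast
      set a : ℝ := m * η
      have ha : 0 ≤ a := by positivity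
      rw [show (m + 1 : ℝ) * η = a + η by simp only [a]; ring]
      obtain ⟨x, hx, hmax⟩ := (isCompact_Icc (a := -h) (b := a + η)).exists_isMaxOn
        ⟨0, by constructor <;> linarith⟩ hdc.norm.continuousOn
      have hbd : ∀ t ∈ Icc (-h) (a + η), ‖d t‖ ≤ ‖d x‖ := fun t ht => hmax ht
      suffices hx0 : ‖d x‖ ≤ 0 from fun t ht =>
        norm_le_zero_iff.mp ((hbd t ht).trans hx0)
      rcases le_total x a with hxa | hxa
      · rw [ih x ⟨hx.1, hxa⟩, norm_zero]
      · have hder : ∀ t ∈ Icc a (a + η), ‖deriv d t‖ ≤ A * ‖d x‖ := by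
          intro t ht
          rw [deriv_eq_of_charOp_eq_zero (hd0 t)]
          refine (norm_sub_le _ _).trans ?_
          rw [norm_smul, hA, add_mul]
          refine add_le_add ?_ (mul_le_mul_of_nonneg_left
            (hbd t ⟨by linarith [ht.1], ht.2⟩) (norm_nonneg _))
          refine (B.norm_kerInt_le t (C := M * ‖d x‖) (by fun_prop) fun θ hθ => ?_).trans
            (le_of_eq (by ring))
          rw [norm_smul]
          exact mul_le_mul (hM θ hθ) (hbd _ ⟨by linarith [ht.1, hθ.2], by linarith [ht.2, hθ.1]⟩)
            (norm_nonneg _) hM0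
        have := (convex_Icc a (a + η)).norm_image_sub_le_of_norm_deriv_le
          (fun t _ => (hd.hasDerivAt t).differentiableAt) hder ⟨le_rfl, by linarith⟩ ⟨hxa, hx.2⟩
        rw [ih a ⟨by linarith, le_rfl⟩, sub_zero, Real.norm_of_nonneg (by linarith)] at this
        have h6 : A * ‖d x‖ * (x - a) ≤ ‖d x‖ * (1 / 2) := by
          calc _ ≤ A * ‖d x‖ * η := by gcongr; linarith [hx.2]
            _ = ‖d x‖ * (A * η) := by ring
            _ ≤ _ := by gcongr
        linarith
  have hpos : ∀ t, 0 ≤ t → d t = 0 := by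
    intro t ht
    obtain ⟨m, hm⟩ := exists_nat_ge (t / η)
    exact key m t ⟨by linarith, by rwa [div_le_iff₀ hη0] at hm⟩
  intro t
  obtain ⟨m, hm⟩ := exists_nat_ge (-t / T)
  rw [← hd.2.nat_mul m t]
  refine hpos _ ?_
  rw [div_le_iff₀ hT] at hm
  linarith

end KernelBounds

/-- The restriction of `t ↦ e^{σt} q(t)` to `[-h,0]`. -/
noncomputable def floquetSegment (h : ℝ) (σ : ℂ) {q : ℝ → Fin n → ℂ} (hq : Continuous q) :
    C(Icc (-h) 0, Fin n → ℂ) :=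
  ⟨fun θ => Complex.exp (σ * (θ : ℝ)) • q θ, by fun_prop⟩

/-- The function `e^{σt}q(t)` solves the delay equation, and periodicity of `q` turns a shift by `T`
into multiplication by `e^{σT}`. -/
lemma KernelBounds.inKerPow_floquetSegment (B : KernelBounds h T K ζ)
    {q : ℝ → Fin n → ℂ} (hq : IsCT T 1 q) (hq0 : ∀ τ, charOp h ζ σ q τ = 0) :
    InKerPow (Evolves h ζ 0 T) (Complex.exp (σ * T)) 1
      (floquetSegment h σ hq.1.continuous) := by
  have hqc := hq.1.continuous
  refine ⟨Complex.exp (σ * T) • floquetSegment h σ hqc,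
    ⟨fun t => Complex.exp (σ * t) • q t, by fun_prop, ?_, ?_, ?_⟩, sub_self _⟩
  · intro θ
    simp [floquetSegment]
  · intro r _
    have h1 : HasDerivAt (fun t : ℝ => Complex.exp (σ * t)) (Complex.exp (σ * r) * σ) r := by
      have := ((Complex.ofRealCLM.hasDerivAt (x := r)).const_mul σ).cexp
      simpa using this
    have h2 := h1.smul (hq.hasDerivAt r)
    refine HasDerivAt.hasDerivWithinAt (h2.congr_deriv ?_)
    rw [KernelBounds.deriv_eq_of_charOp_eq_zero (hq0 r), smul_sub, smul_smul, sub_add_cancel,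
      ← B.kerInt_smul r (by fun_prop)]
    refine kerInt_congr r fun θ _ => ?_
    rw [smul_smul, ← Complex.exp_add]
    push_cast
    congr 2
    ring
  · intro θ
    simp only [floquetSegment, ContinuousMap.smul_apply, ContinuousMap.coe_mk]
    rw [smul_smul, ← Complex.exp_add, add_comm T, hq.2]
    push_cast
    congr 2
    ring

lemma exists_smul_eq_of_finrank_span_eq_one {𝕜 E : Type*} [Field 𝕜] [AddCommGroup E] [Module 𝕜 E]
    {S : Set E} (hS : Module.finrank 𝕜 (Submodule.span 𝕜 S) = 1) {x y : E} (hx : x ∈ S)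
    (hy : y ∈ S) : ∃ (v : E) (a b : 𝕜), a • v = x ∧ b • v = y := by
  obtain ⟨v, _, hv⟩ := finrank_eq_one_iff'.mp hS
  obtain ⟨a, ha⟩ := hv ⟨x, Submodule.subset_span hx⟩
  obtain ⟨b, hb⟩ := hv ⟨y, Submodule.subset_span hy⟩
  exact ⟨v, a, b, congrArg Subtype.val ha, congrArg Subtype.val hb⟩

/-- At a simple Floquet exponent the kernel of the characteristic operator is one-dimensional. -/
theorem KernelBounds.exists_eq_smul_of_charOp_eq_zero (B : KernelBounds h T K ζ) (hT : 0 < T)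
    (hσ : IsSimpleFloquetExponent h T ζ σ) {q ξ : ℝ → Fin n → ℂ} (hq : IsCT T 1 q)
    (hq0 : ∀ τ, charOp h ζ σ q τ = 0) (hqne : ∃ t, q t ≠ 0) (hξ : IsCT T 1 ξ)
    (hξ0 : ∀ τ, charOp h ζ σ ξ τ = 0) : ∃ c : ℂ, ∀ t, ξ t = c • q t := by
  obtain ⟨v, a, b, ha, hb⟩ := exists_smul_eq_of_finrank_span_eq_one hσ
    ⟨1, B.inKerPow_floquetSegment hq hq0⟩ ⟨1, B.inKerPow_floquetSegment hξ hξ0⟩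
  have ha' : ∀ θ : Icc (-h) 0, a • v θ = Complex.exp (σ * (θ : ℝ)) • q θ := fun θ =>
    DFunLike.congr_fun ha θ
  have hb' : ∀ θ : Icc (-h) 0, b • v θ = Complex.exp (σ * (θ : ℝ)) • ξ θ := fun θ =>
    DFunLike.congr_fun hb θ
  -- If `a = 0`, then `q` vanishes on `[-h,0]` and hence everywhere by forward uniqueness.
  have ha0 : a ≠ 0 := by
    rintro rfl
    obtain ⟨t, ht⟩ := hqne
    refine ht (B.eq_zero_of_charOp_eq_zero hT hq hq0 (fun t ht => ?_) t)
    have := ha' ⟨t, ht⟩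
    rw [zero_smul, eq_comm, smul_eq_zero] at this
    exact this.resolve_left (Complex.exp_ne_zero _)
  refine ⟨b / a, fun t => sub_eq_zero.mp ?_⟩
  refine B.eq_zero_of_charOp_eq_zero (σ := σ) hT (hξ.sub (hq.const_smul (b / a)))
    (fun τ => ?_) (fun t ht => ?_) t
  · rw [B.charOp_sub hξ (hq.const_smul _), B.charOp_smul hq, hξ0, hq0, smul_zero, sub_zero]
  · have h1 := ha' ⟨t, ht⟩
    have h2 := hb' ⟨t, ht⟩
    have h3 : Complex.exp (σ * t) • (ξ t - (b / a) • q t) = 0 := by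
      rw [smul_sub, smul_comm, ← h1, ← h2, smul_smul, div_mul_cancel₀ _ ha0, sub_self]
    exact (smul_eq_zero.mp h3).resolve_left (Complex.exp_ne_zero _)

end PeriodicDDE

namespace PeriodicDDE

/-! ### Absolutely continuous functions with values in a finite-dimensional space -/

section AC

variable {E : Type*} [NormedAddCommGroup E] [NormedSpace ℝ E]

lemma _root_.AbsolutelyContinuousOnInterval.clm_comp {f : ℝ → E} {a b : ℝ}
    (hf : AbsolutelyContinuousOnInterval f a b) (A : E →L[ℝ] ℝ) :
    AbsolutelyContinuousOnInterval (fun x => A (f x)) a b := by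
  rw [absolutelyContinuousOnInterval_iff] at *
  intro ε hε
  obtain ⟨δ, hδ, H⟩ := hf (ε / (‖A‖ + 1)) (by positivity)
  refine ⟨δ, hδ, fun I hI hlt => ?_⟩
  have h1 := H I hI hlt
  rw [lt_div_iff₀ (by positivity)] at h1
  refine lt_of_le_of_lt ?_ h1
  rw [Finset.sum_mul]
  refine Finset.sum_le_sum fun i _ => ?_
  rw [dist_eq_norm, dist_eq_norm, ← map_sub]
  refine (A.le_opNorm _).trans ?_
  nlinarith [norm_nonneg (f (I.2 i).1 - f (I.2 i).2)]

/-- The fundamental theorem of calculus for real absolutely continuous functions is applied after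
composing with each continuous linear functional; these separate points. -/
lemma sub_eq_integral_of_absolutelyContinuous [FiniteDimensional ℝ E] {ψ F : ℝ → E} {a b : ℝ}
    (hab : a ≤ b) (hψ : AbsolutelyContinuousOnInterval ψ a b)
    (hF : IntervalIntegrable F volume a b)
    (hd : ∀ᵐ x, x ∈ Ioo a b → deriv ψ x = F x) : ψ b - ψ a = ∫ x in a..b, F x := by
  have : CompleteSpace E := FiniteDimensional.complete ℝ E
  rw [SeparatingDual.eq_iff_forall_dual_eq (R := ℝ)]
  intro A
  have h1 := (hψ.clm_comp A).integral_deriv_eq_sub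
  rw [map_sub, ← h1, ← A.intervalIntegral_comp_comm hF]
  refine intervalIntegral.integral_congr_ae ?_
  filter_upwards [hd, hψ.boundedVariationOn.ae_differentiableAt_of_mem_uIcc,
    Measure.ae_ne volume b] with x h2 h3 h4 hx
  have h5 := h3 (uIoc_subset_uIcc hx)
  rw [uIoc_of_le hab] at hx
  rw [← h2 ⟨hx.1, lt_of_le_of_ne hx.2 h4⟩]
  exact (A.hasFDerivAt.comp_hasDerivAt x h5.hasDerivAt).deriv

end AC

lemma norm_le_of_ae_le {E : Type*} [NormedAddCommGroup E] {a b C : ℝ} (hab : a ≠ b) {g : ℝ → E}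
    (hg : ContinuousOn g (Icc a b)) (hC : ∀ᵐ x ∂volume.restrict (Icc a b), ‖g x‖ ≤ C) :
    ∀ x ∈ Icc a b, ‖g x‖ ≤ C := by
  have : EqOn (fun x => max ‖g x‖ C) (fun _ => C) (Icc a b) :=
    Measure.eqOn_Icc_of_ae_eq (μ := volume) hab (hC.mono fun x hx => max_eq_right hx)
      (hg.norm.sup continuousOn_const) continuousOn_const
  exact fun x hx => max_eq_right_iff.mp (this hx)

/-- Integration of a transport equation along a characteristic.  `Ψ t` has derivative `F t` in
the space variable and `D t` in the time variable. -/
theorem transport_along_characteristic {E : Type*} [NormedAddCommGroup E] [NormedSpace ℝ E]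
    [CompleteSpace E] {a b c : ℝ} {Ψ D F : ℝ → ℝ → E} {ω : ℝ → E}
    (hint : ∀ t, IntervalIntegrable (F t) volume a b ∧ IntervalIntegrable (D t) volume a b)
    (hω : IntervalIntegrable ω volume a b)
    (hF : ∀ t, ∀ x ∈ Icc a b, ∀ y ∈ Icc a b, x ≤ y → Ψ t y - Ψ t x = ∫ r in x..y, F t r)
    (hcont : ∀ t, ContinuousOn (Ψ t) (Icc a b))
    (hdiag : ContinuousOn (fun s => Ψ (c - s) s) (Icc a b))
    (hFc : ∀ t, ∀ ε > 0, ∃ δ > 0, ∀ t', |t' - t| < δ →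
      ∀ᵐ x ∂volume.restrict (Icc a b), ‖F t' x - F t x‖ ≤ ε)
    (hD : ∀ t, ∀ ε > 0, ∃ δ > 0, ∀ t', |t' - t| < δ → ∀ᵐ x ∂volume.restrict (Icc a b),
      ‖Ψ t' x - Ψ t x - (t' - t) • D t x‖ ≤ ε * |t' - t|)
    (hωc : ∀ t, ∀ ε > 0, ∃ δ > 0, ∀ᵐ x ∂volume.restrict (Icc a b), |c - x - t| < δ →
      ‖ω x - (D t x - F t x)‖ ≤ ε) :
    ∀ s ∈ Icc a b, Ψ (c - s) s + ∫ r in a..s, ω r = Ψ (c - a) a := by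
  intro s hs
  have hab : a ≤ b := hs.1.trans hs.2
  have hsub : ∀ {f : ℝ → E}, IntervalIntegrable f volume a b → ∀ x ∈ Icc a b, ∀ y ∈ Icc a b,
      IntervalIntegrable f volume x y := fun hf x hx y hy => hf.mono_set (by
    rw [uIcc_of_le hab]
    exact uIcc_subset_Icc hx hy)
  -- A vanishing right derivative is enough. The chain rule would give `F - D + ω` on the
  -- characteristic, but these functions are known almost everywhere in space only, so increments
  -- are averaged over short intervals instead.
  suffices H : ∀ s ∈ Icc a b, (fun s => Ψ (c - s) s + ∫ r in a..s, ω r) s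
      = (fun s => Ψ (c - s) s + ∫ r in a..s, ω r) a by simpa using H s hs
  refine constant_of_has_deriv_right_zero ?_ fun x hx => ?_
  · refine hdiag.add ?_
    have := intervalIntegral.continuousOn_primitive_interval (μ := volume) (f := ω) (a := a) (b := b)
      (by rw [uIcc_of_le hab]; exact (intervalIntegrable_iff_integrableOn_Icc_of_le hab).mp hω)
    rwa [uIcc_of_le hab] at this
  have hxm : x ∈ Icc a b := Ico_subset_Icc_self hx
  rw [hasDerivWithinAt_iff_isLittleO, Asymptotics.isLittleO_iff]
  intro ε hε
  set ε' := ε / 3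
  have hε' : 0 < ε' := by positivity
  obtain ⟨δ₁, hδ₁, h1⟩ := hFc (c - x) ε' hε'
  obtain ⟨δ₂, hδ₂, h2⟩ := hD (c - x) ε' hε'
  obtain ⟨δ₃, hδ₃, h3⟩ := hωc (c - x) ε' hε'
  have hev : ∀ᶠ y in 𝓝[Ici x] x, x ≤ y ∧ y < b ∧ y < x + δ₁ ∧ y < x + δ₂ ∧ y < x + δ₃ := by
    filter_upwards [self_mem_nhdsWithin, mem_nhdsWithin_of_mem_nhds (Iio_mem_nhds hx.2),
      mem_nhdsWithin_of_mem_nhds (Iio_mem_nhds (show x < x + δ₁ by linarith)),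
      mem_nhdsWithin_of_mem_nhds (Iio_mem_nhds (show x < x + δ₂ by linarith)),
      mem_nhdsWithin_of_mem_nhds (Iio_mem_nhds (show x < x + δ₃ by linarith))] with y a1 a2 a3 a4 a5
    exact ⟨a1, a2, a3, a4, a5⟩
  filter_upwards [hev] with y ⟨hxy, hyb, hy1, hy2, hy3⟩
  rcases hxy.eq_or_lt with rfl | hlt
  · simp
  have hym : y ∈ Icc a b := ⟨hx.1.trans hxy, hyb.le⟩
  set d := y - x with hd
  have hd0 : 0 < d := sub_pos.mpr hlt
  set t := c - x with ht
  have htt : c - y - t = -d := by simp only [ht, hd]; ring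
  have h1' := h1 (c - y) (by rw [htt, abs_neg, abs_of_pos hd0]; linarith)
  have h2' := h2 (c - y) (by rw [htt, abs_neg, abs_of_pos hd0]; linarith)
  rw [htt, abs_neg, abs_of_pos hd0] at h2'
  have hae : ∀ {P : ℝ → Prop} {x' y' : ℝ}, x' ∈ Icc a b → y' ∈ Icc a b →
      (∀ᵐ r ∂volume.restrict (Icc a b), P r) → ∀ᵐ r, r ∈ uIoc x' y' → P r :=
    fun hx' hy' hP => ((ae_restrict_iff' measurableSet_Icc).mp hP).mono fun r hr hr' =>
      hr (uIoc_subset_uIcc.trans (uIcc_subset_Icc hx' hy') hr')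
  set A : ℝ → E := fun r => Ψ (c - y) r - Ψ t r with hA
  have hAc : ContinuousOn A (Icc a b) := (hcont _).sub (hcont _)
  have hAi : IntervalIntegrable A volume x y :=
    (hAc.mono (uIcc_subset_Icc hxm hym)).intervalIntegrable
  have hDi := hsub (hint t).2 x hxm y hym
  have hFi := hsub (hint t).1 x hxm y hym
  have hωi := hsub hω x hxm y hym
  -- the increment of `A` is small
  have e1 : ∀ r ∈ Icc x y, ‖A y - A r‖ ≤ ε' * d := by
    intro r hr
    have hrm : r ∈ Icc a b := ⟨hx.1.trans hr.1, hr.2.trans hyb.le⟩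
    have : A y - A r = ∫ u in r..y, (F (c - y) u - F t u) := by
      rw [intervalIntegral.integral_sub (hsub (hint _).1 r hrm y hym) (hsub (hint _).1 r hrm y hym),
        ← hF _ r hrm y hym hr.2, ← hF _ r hrm y hym hr.2]
      simp only [hA]
      abel
    rw [this]
    refine (intervalIntegral.norm_integral_le_of_norm_le_const_ae (hae hrm hym h1')).trans ?_
    rw [abs_of_nonneg (sub_nonneg.mpr hr.2)]
    exact mul_le_mul_of_nonneg_left (by linarith [hr.1]) hε'.le
  have e2 : ‖∫ r in x..y, (A r + d • D t r)‖ ≤ ε' * d * d := by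
    refine (intervalIntegral.norm_integral_le_of_norm_le_const_ae (C := ε' * d)
      ((hae hxm hym h2').mono fun r hr hr' => ?_)).trans_eq (by rw [← hd, abs_of_pos hd0])
    simpa [hA, neg_smul] using hr hr'
  have e3 : ‖∫ r in x..y, (A y - A r)‖ ≤ ε' * d * d := by
    refine (intervalIntegral.norm_integral_le_of_norm_le_const (C := ε' * d)
      fun r hr => ?_).trans_eq (by rw [← hd, abs_of_pos hd0])
    rw [uIoc_of_le hxy] at hr
    exact e1 r (Ioc_subset_Icc_self hr)
  -- The time increment `A` at the point `y` is compared with its mean over `[x,y]`: `A` varies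
  -- little there, and almost everywhere `A r` is close to `-d • D t r`. Both errors have order `ε'
  -- * d * d`, so dividing by `d` leaves `o(d)`.
  have e4 : d • (A y + ∫ r in x..y, D t r)
      = (∫ r in x..y, (A y - A r)) + ∫ r in x..y, (A r + d • D t r) := by
    rw [intervalIntegral.integral_sub intervalIntegrable_const hAi,
      intervalIntegral.integral_add hAi
        (show IntervalIntegrable (fun r => d • D t r) volume x y from hDi.smul d), intervalIntegral.integral_const,
      intervalIntegral.integral_smul, smul_add]
    abel
  have e5 : ‖A y + ∫ r in x..y, D t r‖ ≤ 2 * ε' * d := by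
    have : d * ‖A y + ∫ r in x..y, D t r‖ ≤ ε' * d * d + ε' * d * d := by
      rw [← Real.norm_of_nonneg hd0.le, ← norm_smul, e4, Real.norm_of_nonneg hd0.le]
      exact (norm_add_le _ _).trans (add_le_add e3 e2)
    nlinarith
  have e6 : ‖∫ r in x..y, (ω r - (D t r - F t r))‖ ≤ ε' * d := by
    refine (intervalIntegral.norm_integral_le_of_norm_le_const_ae (C := ε')
      ((hae hxm hym h3).mono fun r hr hr' => hr hr' ?_)).trans_eq (by rw [← hd, abs_of_pos hd0])
    rw [uIoc_of_le hxy] at hr'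
    rw [ht, abs_lt]
    constructor <;> linarith [hr'.1, hr'.2]
  -- The increment splits into a change of time at `y`, which is `A y`, and a change of position at
  -- time `t`, which is the integral of `F t`.
  have e7 : (Ψ (c - y) y + ∫ r in a..y, ω r) - (Ψ (c - x) x + ∫ r in a..x, ω r) - (y - x) • (0 : E)
      = (A y + ∫ r in x..y, D t r) + ∫ r in x..y, (ω r - (D t r - F t r)) := by
    rw [intervalIntegral.integral_sub hωi (hDi.sub hFi), intervalIntegral.integral_sub hDi hFi,
      ← hF t x hxm y hym hxy, ← intervalIntegral.integral_interval_sub_left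
        (hsub hω a ⟨le_rfl, hab⟩ y hym) (hsub hω a ⟨le_rfl, hab⟩ x hxm), smul_zero]
    simp only [hA, ht]
    abel
  rw [e7, Real.norm_of_nonneg hd0.le]
  calc _ ≤ _ := norm_add_le _ _
    _ ≤ 2 * ε' * d + ε' * d := add_le_add e5 e6
    _ = ε * d := by simp only [ε']; ring

end PeriodicDDE

namespace PeriodicDDE

/-! ### Pointwise values of continuous curves in `L^∞` -/

lemma tendsto_int_floor_mul_div (t : ℝ) :
    Tendsto (fun m : ℕ => (⌊(m : ℝ) * t⌋ : ℝ) / m) atTop (𝓝 t) := by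
  rw [tendsto_iff_dist_tendsto_zero]
  refine squeeze_zero' (Eventually.of_forall fun _ => dist_nonneg) ?_
    tendsto_one_div_atTop_nhds_zero_nat
  filter_upwards [eventually_gt_atTop 0] with m hm
  have hm' : (0 : ℝ) < m := by exact_mod_cast hm
  rw [Real.dist_eq, div_sub' hm'.ne', abs_div, abs_of_pos hm']
  gcongr
  rw [abs_le]
  constructor <;> linarith [Int.floor_le ((m : ℝ) * t), Int.lt_floor_add_one ((m : ℝ) * t)]

section Lp

variable {α E : Type*} [MeasurableSpace α] {μ : Measure α} [NormedAddCommGroup E]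

lemma ae_norm_coe_le (f : Lp E ⊤ μ) : ∀ᵐ x ∂μ, ‖f x‖ ≤ ‖f‖ := by
  filter_upwards [ae_le_eLpNormEssSup (f := f) (μ := μ)] with x hx
  rw [← eLpNorm_exponent_top] at hx
  have h1 : eLpNorm f ⊤ μ ≠ ⊤ := (Lp.memLp f).eLpNorm_ne_top
  rw [Lp.norm_def, ← toReal_enorm (f x)]
  exact ENNReal.toReal_mono h1 hx

lemma ae_norm_coe_sub_le (f g : Lp E ⊤ μ) : ∀ᵐ x ∂μ, ‖f x - g x‖ ≤ ‖f - g‖ := by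
  filter_upwards [ae_norm_coe_le (f - g), Lp.coeFn_sub f g] with x hx hx'
  rwa [hx', Pi.sub_apply] at hx

end Lp

section Ev

variable {n : ℕ} {h : ℝ} {w : ℝ → XSunStar n h}

/-- Only countably many sampling times `k / m` occur, so one null set of `s` serves all pairs of
them; off it the samples are Cauchy for every `t` simultaneously, by continuity of `w` in `L^∞`. -/
lemma ae_tendsto_ev (hw : Continuous w) :
    ∀ᵐ s ∂volume.restrict (Icc (-h) 0), ∀ t,
      Tendsto (fun m : ℕ => (w ((⌊(m : ℝ) * t⌋ : ℝ) / m)).2 s) atTop (𝓝 (ev w t s)) := by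
  have h1 : ∀ᵐ s ∂volume.restrict (Icc (-h) 0), ∀ (k k' : ℤ) (m m' : ℕ),
      ‖(w ((k : ℝ) / m)).2 s - (w ((k' : ℝ) / m')).2 s‖
        ≤ ‖(w ((k : ℝ) / m)).2 - (w ((k' : ℝ) / m')).2‖ := by
    simp only [ae_all_iff]
    exact fun k k' m m' => ae_norm_coe_sub_le _ _
  filter_upwards [h1] with s hs t
  refine tendsto_nhds_limUnder (cauchySeq_tendsto_of_complete ?_)
  have h2 : CauchySeq fun m : ℕ => (w ((⌊(m : ℝ) * t⌋ : ℝ) / m)).2 :=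
    (((continuous_snd.comp hw).tendsto t).comp (tendsto_int_floor_mul_div t)).cauchySeq
  rw [Metric.cauchySeq_iff] at h2 ⊢
  intro ε hε
  obtain ⟨N, hN⟩ := h2 ε hε
  refine ⟨N, fun m hm m' hm' => lt_of_le_of_lt ?_ (hN m hm m' hm')⟩
  rw [dist_eq_norm, dist_eq_norm]
  exact hs _ _ _ _

lemma tendsto_snd_floor (hw : Continuous w) (t : ℝ) :
    Tendsto (fun m : ℕ => (w ((⌊(m : ℝ) * t⌋ : ℝ) / m)).2) atTop (𝓝 (w t).2) :=
  ((continuous_snd.comp hw).tendsto t).comp (tendsto_int_floor_mul_div t)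

/-- For fixed `t` the exceptional null set does not depend on `r`, so `r` may later be taken as a
function of `s`, as on a characteristic. -/
lemma ae_norm_ev_sub_coe_le (hw : Continuous w) (t : ℝ) :
    ∀ᵐ s ∂volume.restrict (Icc (-h) 0), ∀ r,
      ‖ev w r s - (w t).2 s‖ ≤ ‖(w r).2 - (w t).2‖ := by
  have h1 : ∀ᵐ s ∂volume.restrict (Icc (-h) 0), ∀ (k : ℤ) (m : ℕ),
      ‖(w ((k : ℝ) / m)).2 s - (w t).2 s‖ ≤ ‖(w ((k : ℝ) / m)).2 - (w t).2‖ := by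
    simp only [ae_all_iff]
    exact fun k m => ae_norm_coe_sub_le _ _
  filter_upwards [h1, ae_tendsto_ev hw] with s hs hs' r
  exact le_of_tendsto_of_tendsto ((hs' r).sub_const _).norm
    ((tendsto_snd_floor hw r).sub_const _).norm (Eventually.of_forall fun m => hs _ _)

/-- Each sample takes its time from a countable set, which makes it a measurable function of a pair
in `ℤ × ℝ` composed with a floor. -/
lemma aestronglyMeasurable_ev_diag (hw : Continuous w) (c : ℝ) :
    AEStronglyMeasurable (fun r => ev w (c - r) r) (volume.restrict (Icc (-h) 0)) := by
  refine aestronglyMeasurable_of_tendsto_ae atTop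
    (f := fun (m : ℕ) r => (w ((⌊(m : ℝ) * (c - r)⌋ : ℝ) / m)).2 r) (fun m => ?_)
    ((ae_tendsto_ev hw).mono fun s hs => hs (c - s))
  have h1 : Measurable fun x : ℤ × ℝ => (w ((x.1 : ℝ) / m)).2 x.2 :=
    measurable_from_prod_countable_right fun k =>
      (Lp.stronglyMeasurable (w ((k : ℝ) / m)).2).measurable
  have h2 : Measurable fun r : ℝ => (⌊(m : ℝ) * (c - r)⌋, r) := by fun_prop
  exact (h1.comp h2).aestronglyMeasurable

lemma intervalIntegrable_ev_diag {T : ℝ} (hh : 0 < h) (hT : 0 < T) (hw : IsCT T 0 w) (c : ℝ) :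
    IntervalIntegrable (fun r => ev w (c - r) r) volume (-h) 0 := by
  rw [intervalIntegrable_iff_integrableOn_Icc_of_le (by linarith)]
  obtain ⟨C, hC0, hC⟩ := exists_bound_of_periodic hT hw.1.continuous hw.2
  refine Integrable.of_bound (aestronglyMeasurable_ev_diag hw.1.continuous c) (3 * C) ?_
  filter_upwards [ae_norm_ev_sub_coe_le hw.1.continuous c, ae_norm_coe_le (w c).2] with s h1 h2
  have h3 := h1 (c - s)
  have h4 := norm_sub_le (w (c - s)).2 (w c).2
  have h5 := (norm_snd_le (w c)).trans (hC c)
  have h6 := (norm_snd_le (w (c - s))).trans (hC (c - s))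
  have h7 := norm_le_norm_add_norm_sub' (ev w (c - s) s) ((w c).2 s)
  linarith

end Ev

end PeriodicDDE

namespace PeriodicDDE

/-! ### The Lipschitz representatives of a curve in the domain -/

variable {n : ℕ} {h T : ℝ} {σ : ℂ}

/-- The projection of `ℝ` onto `[-h,0]`. -/
def clamp (h s : ℝ) : ℝ := max (-h) (min s 0)

lemma continuous_clamp (h : ℝ) : Continuous (clamp h) := by unfold clamp; fun_prop

lemma clamp_mem (hh : 0 < h) (s : ℝ) : clamp h s ∈ Icc (-h) 0 :=
  ⟨le_max_left _ _, max_le (by linarith) (min_le_right _ _)⟩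

lemma clamp_of_mem {s : ℝ} (hs : s ∈ Icc (-h) 0) : clamp h s = s := by
  rw [clamp, min_eq_left hs.2, max_eq_right hs.1]

/-- Lipschitz representatives are continuous, so an essential bound on `[-h,0]` holds at every
point, including the end points. -/
lemma IsLipRep.norm_sub_le (hh : 0 < h) {x y : XSunStar n h} {φ ψ : ℝ → Fin n → ℂ}
    (hx : IsLipRep x φ) (hy : IsLipRep y ψ) :
    ∀ s ∈ Icc (-h) 0, ‖φ s - ψ s‖ ≤ ‖x.2 - y.2‖ := by
  obtain ⟨⟨_, h1⟩, -, h2⟩ := hx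
  obtain ⟨⟨_, h3⟩, -, h4⟩ := hy
  refine norm_le_of_ae_le (by linarith) (h1.continuousOn.sub h3.continuousOn) ?_
  filter_upwards [h2, h4, ae_norm_coe_sub_le x.2 y.2] with s e1 e2 e3
  rwa [← e1, ← e2]

lemma continuous_uncurry_clamp (hh : 0 < h) {u : ℝ → XSunStar n h} (hu : Continuous u)
    {φ : ℝ → ℝ → Fin n → ℂ} (hφ : ∀ t, IsLipRep (u t) (φ t)) :
    Continuous (Function.uncurry fun t s => φ t (clamp h s)) := by
  rw [continuous_iff_continuousAt]
  rintro ⟨t₀, s₀⟩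
  rw [ContinuousAt, tendsto_iff_norm_sub_tendsto_zero]
  have hc : Continuous fun s => φ t₀ (clamp h s) := by
    obtain ⟨⟨_, h1⟩, -⟩ := hφ t₀
    exact h1.continuousOn.comp_continuous (continuous_clamp h) (clamp_mem hh)
  have h0 : Tendsto (fun x : ℝ × ℝ => ‖(u x.1).2 - (u t₀).2‖
      + ‖φ t₀ (clamp h x.2) - φ t₀ (clamp h s₀)‖) (𝓝 (t₀, s₀)) (𝓝 0) := by
    have : Continuous fun x : ℝ × ℝ => ‖(u x.1).2 - (u t₀).2‖
        + ‖φ t₀ (clamp h x.2) - φ t₀ (clamp h s₀)‖ := by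
      have h1 : Continuous fun x : ℝ × ℝ => (u x.1).2 :=
        continuous_snd.comp (hu.comp continuous_fst)
      have h2 : Continuous fun x : ℝ × ℝ => φ t₀ (clamp h x.2) := hc.comp continuous_snd
      exact (h1.sub continuous_const).norm.add (h2.sub continuous_const).norm
    simpa using this.tendsto (t₀, s₀)
  refine squeeze_zero (fun _ => norm_nonneg _) (fun x => ?_) h0
  simp only [Function.uncurry]
  refine (norm_sub_le_norm_sub_add_norm_sub _ (φ t₀ (clamp h x.2)) _).trans ?_
  gcongr
  exact (hφ x.1).norm_sub_le hh (hφ t₀) _ (clamp_mem hh _)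

lemma intervalIntegrable_exp_smul_coe (hh : 0 < h)
    (f : Lp (Fin n → ℂ) ⊤ (volume.restrict (Icc (-h) 0))) :
    IntervalIntegrable (fun r : ℝ => Complex.exp (-σ * r) • f r) volume (-h) 0 := by
  refine IntervalIntegrable.continuousOn_smul ?_ (by fun_prop)
  rw [intervalIntegrable_iff_integrableOn_Icc_of_le (by linarith)]
  exact (Lp.memLp f).integrable le_top

/-- With the integrating factor `e^{-σr}` the equation `φ' = σφ + g` becomes `(e^{-σr}φ)' =
e^{-σr}g`, and the product is absolutely continuous. -/
lemma exp_smul_sub_eq_integral (hh : 0 < h) {g : Lp (Fin n → ℂ) ⊤ (volume.restrict (Icc (-h) 0))}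
    {x : XSunStar n h} {φ : ℝ → Fin n → ℂ} (hφ : IsLipRep x φ)
    (hd : ((σ • x.2 + g : Lp (Fin n → ℂ) ⊤ (volume.restrict (Icc (-h) 0))) : ℝ → Fin n → ℂ)
      =ᵐ[volume.restrict (Icc (-h) 0)] deriv φ) {a b : ℝ}
    (ha : a ∈ Icc (-h) 0) (hb : b ∈ Icc (-h) 0) (hab : a ≤ b) :
    Complex.exp (-σ * b) • φ b - Complex.exp (-σ * a) • φ a
      = ∫ r in a..b, Complex.exp (-σ * r) • g r := by
  obtain ⟨⟨C, h1⟩, -, h2⟩ := hφ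
  have hsub : uIcc a b ⊆ Icc (-h) 0 := uIcc_subset_Icc ha hb
  have hexp : ContDiff ℝ 1 fun r : ℝ => Complex.exp (-σ * r) := by
    have : ContDiff ℝ 1 fun r : ℝ => (r : ℂ) := Complex.ofRealCLM.contDiff
    fun_prop
  refine sub_eq_integral_of_absolutelyContinuous hab
    (ψ := fun r : ℝ => Complex.exp (-σ * r) • φ r)
    (AbsolutelyContinuousOnInterval.fun_smul
      hexp.contDiffOn.absolutelyContinuousOnInterval
      (h1.mono hsub).absolutelyContinuousOnInterval)
    ((intervalIntegrable_exp_smul_coe hh g).mono_set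
      (by rwa [uIcc_of_le (show -h ≤ 0 by linarith)])) ?_
  have h3 : ∀ᵐ r ∂volume.restrict (Icc (-h) 0), deriv φ r = σ • φ r + g r := by
    filter_upwards [hd, h2, Lp.coeFn_add (σ • x.2) g, Lp.coeFn_smul σ x.2] with r e1 e2 e3 e4
    rw [← e1, e3, Pi.add_apply, e4, Pi.smul_apply, e2]
  filter_upwards [(ae_restrict_iff' measurableSet_Icc).mp h3,
    h1.ae_differentiableWithinAt_of_mem_real] with r e1 e2 hr
  have hr' : Ioo a b ⊆ Icc (-h) 0 :=
    (Ioo_subset_Icc_self.trans (by rw [← uIcc_of_le hab])).trans hsub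
  have e3 : HasDerivAt φ (deriv φ r) r :=
    ((e2 (hr' hr)).differentiableAt (mem_of_superset (Ioo_mem_nhds hr.1 hr.2) hr')).hasDerivAt
  have e4 : HasDerivAt (fun r : ℝ => Complex.exp (-σ * r))
      (Complex.exp (-σ * r) * (-σ)) r := by
    have : HasDerivAt (fun r : ℝ => -σ * (r : ℂ)) (-σ) r := by
      simpa using (Complex.ofRealCLM.hasDerivAt (x := r)).const_mul (-σ)
    exact this.cexp
  rw [show deriv (fun r : ℝ => Complex.exp (-σ * r) • φ r) r = _ from (e4.smul e3).deriv, e1 (hr' hr), smul_add, smul_smul, mul_neg, neg_smul]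
  abel

lemma ae_norm_exp_smul_le {M : ℝ} (hM : ∀ r ∈ Icc (-h) 0, ‖Complex.exp (-σ * (r : ℝ))‖ ≤ M)
    {f : ℝ → Fin n → ℂ} {C : ℝ} (hf : ∀ᵐ r ∂volume.restrict (Icc (-h) 0), ‖f r‖ ≤ C) :
    ∀ᵐ r : ℝ ∂volume.restrict (Icc (-h) 0), ‖Complex.exp (-σ * r) • f r‖ ≤ M * C := by
  filter_upwards [hf, ae_restrict_mem measurableSet_Icc] with r h1 h2
  rw [norm_smul]
  exact mul_le_mul (hM r h2) h1 (norm_nonneg _) ((norm_nonneg _).trans (hM r h2))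

lemma exists_dist_lt_mul {B : Type*} [NormedAddCommGroup B] {g : ℝ → B} (hg : Continuous g)
    {M : ℝ} (hM : 0 < M) (t : ℝ) {ε : ℝ} (hε : 0 < ε) :
    ∃ δ > 0, ∀ t', |t' - t| < δ → M * ‖g t' - g t‖ ≤ ε := by
  obtain ⟨δ, hδ, H⟩ := Metric.continuous_iff.mp hg t (ε / M) (by positivity)
  refine ⟨δ, hδ, fun t' ht' => ?_⟩
  have := H t' ht'
  rw [dist_eq_norm, lt_div_iff₀ hM] at this
  linarith

/-- A solution of `(σ - 𝒜)u = w` is given by the variation-of-constants formula. -/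
theorem eq_varConst (hh : 0 < h) (hT : 0 < T) {u w : ℝ → XSunStar n h} (hu : IsCT T 1 u)
    (hw : IsCT T 0 w) {φ : ℝ → ℝ → Fin n → ℂ} (hφ : ∀ t, IsLipRep (u t) (φ t))
    (hd : ∀ t, ((σ • (u t).2 + (deriv u t - w t).2 :
      Lp (Fin n → ℂ) ⊤ (volume.restrict (Icc (-h) 0))) : ℝ → Fin n → ℂ)
      =ᵐ[volume.restrict (Icc (-h) 0)] deriv (φ t)) (τ : ℝ) {θ : ℝ} (hθ : θ ∈ Icc (-h) 0) :
    φ τ θ = varConst σ w (fun t => (u t).1) τ θ := by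
  have huc := hu.1.continuous
  have hwc := hw.1.continuous
  have hdc : Continuous (deriv u) := hu.1.continuous_deriv le_rfl
  have h0 : (0 : ℝ) ∈ Icc (-h) 0 := ⟨by linarith, le_rfl⟩
  obtain ⟨M, hM0, hM⟩ : ∃ M > 0, ∀ r ∈ Icc (-h) 0, ‖Complex.exp (-σ * (r : ℝ))‖ ≤ M := by
    obtain ⟨M, hM⟩ := (isCompact_Icc (a := -h) (b := 0)).exists_bound_of_continuousOn
      (f := fun r : ℝ => Complex.exp (-σ * r)) (by fun_prop)
    exact ⟨max M 1, by positivity, fun r hr => (hM r hr).trans (le_max_left _ _)⟩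
  have hφc := continuous_uncurry_clamp hh huc hφ
  have hω : IntervalIntegrable (fun r : ℝ => Complex.exp (-σ * r) • ev w (τ + θ - r) r)
      volume (-h) 0 :=
    (intervalIntegrable_ev_diag hh hT hw (τ + θ)).continuousOn_smul (by fun_prop)
  -- After removing the factor `e^{σs}`, `D - F` is `e^{-σs}` times `w`. The characteristic `t + s =
  -- τ + θ` joins `(τ, θ)` to `(τ + θ, 0)`, where the solution is known through its first component.
  have key := transport_along_characteristic (a := -h) (b := 0) (c := τ + θ)
    (Ψ := fun t s => Complex.exp (-σ * s) • φ t s)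
    (D := fun t r => Complex.exp (-σ * r) • (deriv u t).2 r)
    (F := fun t r => Complex.exp (-σ * r) • (deriv u t - w t).2 r)
    (ω := fun r => Complex.exp (-σ * r) • ev w (τ + θ - r) r)
    (fun t => ⟨intervalIntegrable_exp_smul_coe hh _, intervalIntegrable_exp_smul_coe hh _⟩)
    hω (fun t x hx y hy hxy => exp_smul_sub_eq_integral hh (hφ t) (hd t) hx hy hxy)
    (fun t => ?_) ?_ (fun t ε hε => ?_) (fun t ε hε => ?_) (fun t ε hε => ?_)
  -- The conserved quantity is anchored at `-h`; comparing it at `θ` and at `0` removes the unknown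
  -- value there.
  · have e1 := key θ hθ
    rw [← key 0 h0] at e1
    simp only [add_sub_cancel_right, sub_zero, Complex.ofReal_zero, mul_zero, Complex.exp_zero,
      one_smul] at e1
    have hsub : ∀ x ∈ Icc (-h) 0, IntervalIntegrable
        (fun r : ℝ => Complex.exp (-σ * r) • ev w (τ + θ - r) r) volume (-h) x := fun x hx =>
      hω.mono_set (by
        rw [uIcc_of_le (show -h ≤ 0 by linarith)]
        exact uIcc_subset_Icc ⟨le_rfl, by linarith⟩ hx)
    rw [← eq_sub_iff_add_eq, add_sub_assoc,
      intervalIntegral.integral_interval_sub_left (hsub 0 h0) (hsub θ hθ),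
      ← (hφ (τ + θ)).2.1] at e1
    have e2 : φ τ θ = Complex.exp (σ * θ) • (Complex.exp (-σ * θ) • φ τ θ) := by
      rw [smul_smul, ← Complex.exp_add, show σ * θ + -σ * θ = 0 by ring, Complex.exp_zero, one_smul]
    rw [e2, e1, smul_add, ← intervalIntegral.integral_smul, varConst]
    congr 1
    refine intervalIntegral.integral_congr fun r _ => ?_
    simp only [smul_smul, ← Complex.exp_add]
    congr 2
    ring
  · obtain ⟨⟨_, h1⟩, -⟩ := hφ t
    exact (show Continuous fun s : ℝ => Complex.exp (-σ * s) by fun_prop).continuousOn.smul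
      h1.continuousOn
  · refine (show Continuous fun s : ℝ => Complex.exp (-σ * s) by fun_prop).continuousOn.smul ?_
    refine ContinuousOn.congr (f := fun s => φ (τ + θ - s) (clamp h s))
      (hφc.comp (by fun_prop : Continuous fun s => (τ + θ - s, s))).continuousOn fun s hs => ?_
    simp only [clamp_of_mem hs]
  · obtain ⟨δ, hδ, H⟩ := exists_dist_lt_mul (hdc.sub hwc) hM0 t hε
    refine ⟨δ, hδ, fun t' ht' => ?_⟩
    filter_upwards [ae_norm_exp_smul_le hM (ae_norm_coe_sub_le (deriv u t' - w t').2
      (deriv u t - w t).2)] with r hr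
    rw [← smul_sub]
    exact hr.trans ((mul_le_mul_of_nonneg_left (norm_snd_le _) hM0.le).trans (H t' ht'))
  · have h1 := hasDerivAt_iff_isLittleO.mp (hu.hasDerivAt t)
    have h2 := Metric.eventually_nhds_iff.mp
      (Asymptotics.isLittleO_iff.mp h1 (show 0 < ε / M by positivity))
    obtain ⟨δ, hδ, H⟩ := h2
    refine ⟨δ, hδ, fun t' ht' => ?_⟩
    have h3 := H ht'
    have h4 := ae_norm_coe_sub_le ((u t').2 - (u t).2) ((t' - t) • (deriv u t).2)
    filter_upwards [ae_norm_exp_smul_le hM h4, Lp.coeFn_sub (u t').2 (u t).2,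
      Lp.coeFn_smul (t' - t) (deriv u t).2, (hφ t').2.2, (hφ t).2.2] with r e1 e2 e3 e4 e5
    rw [e2, e3, Pi.sub_apply, Pi.smul_apply, e4, e5, smul_sub, smul_sub, smul_comm _ (t' - t)] at e1
    refine e1.trans ?_
    have h5 := (norm_snd_le (u t' - u t - (t' - t) • deriv u t)).trans h3
    rw [Real.norm_eq_abs] at h5
    calc _ ≤ M * (ε / M * |t' - t|) := mul_le_mul_of_nonneg_left h5 hM0.le
      _ = _ := by field_simp
  · obtain ⟨δ, hδ, H⟩ := exists_dist_lt_mul hwc hM0 t hε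
    refine ⟨δ, hδ, ?_⟩
    filter_upwards [ae_norm_ev_sub_coe_le hwc t, ae_restrict_mem measurableSet_Icc,
      Lp.coeFn_sub (deriv u t).2 (w t).2] with r e1 hr e2 hrt
    rw [Prod.snd_sub, e2, Pi.sub_apply, ← smul_sub, ← smul_sub, sub_sub_cancel, norm_smul]
    refine le_trans ?_ (H (τ + θ - r) hrt)
    exact mul_le_mul (hM r hr) ((e1 _).trans (norm_snd_le (w (τ + θ - r) - w t)))
      (norm_nonneg _) hM0.le

end PeriodicDDE

namespace PeriodicDDE

/-! ### Continuous curves of continuous functions as curves in `L^∞` -/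

lemma IsCT.continuous {E : Type*} [NormedAddCommGroup E] [NormedSpace ℝ E] {T : ℝ} {l : ℕ}
    {f : ℝ → E} (hf : IsCT T l f) : Continuous f := hf.1.continuous

lemma IsCT.continuous_deriv {E : Type*} [NormedAddCommGroup E] [NormedSpace ℝ E] {T : ℝ}
    {f : ℝ → E} (hf : IsCT T 1 f) : Continuous (deriv f) := hf.1.continuous_deriv le_rfl

section LpCurve

variable {E : Type*} [NormedAddCommGroup E] {a b : ℝ}

lemma norm_le_of_ae_norm_coe_le {f : Lp E ⊤ ((volume : Measure ℝ).restrict (Icc a b))} {C : ℝ}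
    (hC0 : 0 ≤ C) (hC : ∀ᵐ s ∂volume.restrict (Icc a b), ‖f s‖ ≤ C) : ‖f‖ ≤ C := by
  simpa using Lp.norm_le_of_ae_bound hC0 hC

lemma memLp_top_of_continuous {f : ℝ → E} (hf : Continuous f) :
    MemLp f ⊤ ((volume : Measure ℝ).restrict (Icc a b)) := by
  obtain ⟨C, hC⟩ := (isCompact_Icc (a := a) (b := b)).exists_bound_of_continuousOn hf.continuousOn
  exact memLp_top_of_bound hf.aestronglyMeasurable C
    ((ae_restrict_mem measurableSet_Icc).mono hC)

/-- The class in `L^∞([a,b])` of a continuous function. -/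
noncomputable def contLp (a b : ℝ) (f : ℝ → E) (hf : Continuous f) :
    Lp E ⊤ ((volume : Measure ℝ).restrict (Icc a b)) :=
  (memLp_top_of_continuous hf).toLp f

lemma coeFn_contLp {f : ℝ → E} (hf : Continuous f) :
    contLp a b f hf =ᵐ[volume.restrict (Icc a b)] f := MemLp.coeFn_toLp _

lemma exists_forall_norm_sub_le {F : ℝ → ℝ → E} (hF : Continuous (Function.uncurry F)) (t : ℝ)
    {ε : ℝ} (hε : 0 < ε) :
    ∃ δ > 0, ∀ t', |t' - t| < δ → ∀ s ∈ Icc a b, ‖F t' s - F t s‖ ≤ ε := by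
  have h1 : ∀ᶠ t' in 𝓝 t, ∀ s ∈ Icc a b, ‖F t' s - F t s‖ ≤ ε := by
    refine isCompact_Icc.eventually_forall_of_forall_eventually fun s _ => ?_
    have h2 : Continuous fun z : ℝ × ℝ => ‖F z.1 z.2 - F t z.2‖ :=
      (hF.sub (hF.comp (continuous_const.prodMk continuous_snd))).norm
    have h3 := h2.tendsto (t, s)
    simp only [sub_self, norm_zero] at h3
    exact (h3.eventually_lt_const hε).mono fun z hz => hz.le
  exact Metric.eventually_nhds_iff.mp h1

lemma continuous_contLp {F : ℝ → ℝ → E} (hF : Continuous (Function.uncurry F))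
    (hFc : ∀ t, Continuous (F t)) : Continuous fun t => contLp a b (F t) (hFc t) := by
  rw [Metric.continuous_iff]
  intro t ε hε
  obtain ⟨δ, hδ, H⟩ := exists_forall_norm_sub_le (a := a) (b := b) hF t (half_pos hε)
  refine ⟨δ, hδ, fun t' ht' => ?_⟩
  rw [dist_eq_norm]
  refine lt_of_le_of_lt (norm_le_of_ae_norm_coe_le (half_pos hε).le ?_) (half_lt_self hε)
  filter_upwards [Lp.coeFn_sub (contLp a b (F t') (hFc t')) (contLp a b (F t) (hFc t)),
    coeFn_contLp (a := a) (b := b) (hFc t'), coeFn_contLp (a := a) (b := b) (hFc t),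
    ae_restrict_mem measurableSet_Icc] with s e1 e2 e3 hs
  rw [e1, Pi.sub_apply, e2, e3]
  exact H t' ht' s hs

lemma hasDerivAt_contLp [NormedSpace ℝ E] {F F' : ℝ → ℝ → E}
    (hF' : Continuous (Function.uncurry F')) (hFc : ∀ t, Continuous (F t))
    (hFc' : ∀ t, Continuous (F' t)) (hd : ∀ t s, HasDerivAt (fun t => F t s) (F' t s) t) (t : ℝ) :
    HasDerivAt (fun t => contLp a b (F t) (hFc t)) (contLp a b (F' t) (hFc' t)) t := by
  rw [hasDerivAt_iff_isLittleO, Asymptotics.isLittleO_iff]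
  intro ε hε
  obtain ⟨δ, hδ, H⟩ := exists_forall_norm_sub_le (a := a) (b := b) hF' t hε
  filter_upwards [Metric.ball_mem_nhds t hδ] with t' ht'
  refine norm_le_of_ae_norm_coe_le (by positivity) ?_
  filter_upwards [Lp.coeFn_sub (contLp a b (F t') (hFc t') - contLp a b (F t) (hFc t))
      ((t' - t) • contLp a b (F' t) (hFc' t)),
    Lp.coeFn_sub (contLp a b (F t') (hFc t')) (contLp a b (F t) (hFc t)),
    Lp.coeFn_smul (t' - t) (contLp a b (F' t) (hFc' t)),
    coeFn_contLp (a := a) (b := b) (hFc t'), coeFn_contLp (a := a) (b := b) (hFc t),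
    coeFn_contLp (a := a) (b := b) (hFc' t),
    ae_restrict_mem measurableSet_Icc] with s e1 e2 e3 e4 e5 e6 hs
  rw [e1, Pi.sub_apply, e2, Pi.sub_apply, e3, Pi.smul_apply, e4, e5, e6]
  have key := Convex.norm_image_sub_le_of_norm_hasDerivWithin_le
    (f := fun r => F r s - r • F' t s) (f' := fun r => F' r s - (1 : ℝ) • F' t s)
    (s := Metric.ball t δ) (x := t) (y := t') (C := ε)
    (fun r _ => ((hd r s).sub ((hasDerivAt_id r).smul_const (F' t s))).hasDerivWithinAt)
    (fun r hr => by rw [one_smul]; exact H r hr s hs) (convex_ball t δ)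
    (Metric.mem_ball_self hδ) ht'
  refine le_trans (le_of_eq (congrArg norm ?_)) key
  rw [sub_smul]
  abel

end LpCurve

/-! ### Linear structure of the solution set -/

variable {n : ℕ} {h T K : ℝ} {ζ : ℝ → ℝ → Matrix (Fin n) (Fin n) ℝ} {σ : ℂ}

lemma IsLipRep.continuousOn_comp_neg {x : XSunStar n h} {φ : ℝ → Fin n → ℂ} (hφ : IsLipRep x φ) :
    ContinuousOn (fun θ => φ (-θ)) (Icc 0 h) := by
  obtain ⟨⟨_, h1⟩, -⟩ := hφ
  exact h1.continuousOn.comp continuousOn_neg fun θ hθ => ⟨by linarith [hθ.2], by linarith [hθ.1]⟩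

lemma IsLipRep.congr (hh : 0 < h) {x : XSunStar n h} {φ ψ : ℝ → Fin n → ℂ} (hφ : IsLipRep x φ)
    (he : EqOn φ ψ (Icc (-h) 0)) : IsLipRep x ψ := by
  obtain ⟨⟨C, h1⟩, h2, h3⟩ := hφ
  refine ⟨⟨C, fun a ha b hb => ?_⟩, by rw [h2, he ⟨by linarith, le_rfl⟩], ?_⟩
  · rw [← he ha, ← he hb]
    exact h1 ha hb
  · filter_upwards [h3, ae_restrict_mem measurableSet_Icc] with s e1 hs
    rw [e1, he hs]

lemma IsLipRep.sub_smul {x y : XSunStar n h} {φ ψ : ℝ → Fin n → ℂ} (hφ : IsLipRep x φ)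
    (hψ : IsLipRep y ψ) (c : ℂ) : IsLipRep (x - c • y) (fun s => φ s - c • ψ s) := by
  obtain ⟨⟨C, h1⟩, h2, h3⟩ := hφ
  obtain ⟨⟨D, h4⟩, h5, h6⟩ := hψ
  refine ⟨⟨_, h1.sub ((lipschitzWith_smul c).comp_lipschitzOnWith h4)⟩, ?_, ?_⟩
  · rw [Prod.fst_sub, Prod.smul_fst, h2, h5]
  · filter_upwards [Lp.coeFn_sub x.2 (c • y.2), Lp.coeFn_smul c y.2, h3, h6] with s e1 e2 e3 e4
    rw [Prod.snd_sub, Prod.smul_snd, e1, Pi.sub_apply, e2, Pi.smul_apply, e3, e4]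

lemma ae_differentiableAt_of_lipschitzOnWith {φ : ℝ → Fin n → ℂ} {C : NNReal}
    (hφ : LipschitzOnWith C φ (Icc (-h) 0)) :
    ∀ᵐ s ∂(volume : Measure ℝ).restrict (Icc (-h) 0), DifferentiableAt ℝ φ s := by
  filter_upwards [hφ.ae_differentiableWithinAt_real measurableSet_Icc,
    ae_restrict_mem measurableSet_Icc, ae_restrict_of_ae (Measure.ae_ne volume (-h)),
    ae_restrict_of_ae (Measure.ae_ne volume 0)] with s e1 e2 e3 e4
  exact e1.differentiableAt (Icc_mem_nhds (lt_of_le_of_ne e2.1 e3.symm) (lt_of_le_of_ne e2.2 e4))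

lemma KernelBounds.sunStarGen_sub_smul (B : KernelBounds h T K ζ) {τ : ℝ} {x y x' y' : XSunStar n h}
    (hx : SunStarGen ζ τ x y) (hx' : SunStarGen ζ τ x' y') (c : ℂ) :
    SunStarGen ζ τ (x - c • x') (y - c • y') := by
  obtain ⟨φ, hφ, h1, h2⟩ := hx
  obtain ⟨ψ, hψ, h3, h4⟩ := hx'
  refine ⟨_, hφ.sub_smul hψ c, ?_, ?_⟩
  · rw [B.kerInt_sub τ hφ.continuousOn_comp_neg (g := fun θ => c • ψ (-θ))
        (hψ.continuousOn_comp_neg.const_smul c),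
      B.kerInt_smul τ hψ.continuousOn_comp_neg, ← h1, ← h3]
    rfl
  · obtain ⟨⟨_, h5⟩, -⟩ := hφ
    obtain ⟨⟨_, h6⟩, -⟩ := hψ
    filter_upwards [Lp.coeFn_sub y.2 (c • y'.2), Lp.coeFn_smul c y'.2, h2, h4,
      ae_differentiableAt_of_lipschitzOnWith h5, ae_differentiableAt_of_lipschitzOnWith h6]
      with s e1 e2 e3 e4 e5 e6
    rw [Prod.snd_sub, Prod.smul_snd, e1, Pi.sub_apply, e2, Pi.smul_apply, e3, e4]
    exact ((e5.hasDerivAt.sub (e6.hasDerivAt.const_smul c)).deriv).symm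

lemma KernelBounds.solves_sub_smul (B : KernelBounds h T K ζ) {w u E : ℝ → XSunStar n h}
    (hu : Solves T ζ σ w u) (hE : Solves T ζ σ (fun _ => 0) E) (c : ℂ) :
    Solves T ζ σ w (fun t => u t - c • E t) := by
  obtain ⟨h1, h2, h3⟩ := hu
  obtain ⟨h4, h5, h6⟩ := hE
  refine ⟨h1.sub (h4.const_smul c), ?_, fun τ => ?_⟩
  · convert! h2.sub (h5.const_smul c) using 2 with t
    rw [sub_zero, smul_sub, smul_comm c σ]
    abel
  · convert! B.sunStarGen_sub_smul (h3 τ) (h6 τ) c using 1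
    rw [show deriv (fun t => u t - c • E t) τ = deriv u τ - c • deriv E τ from
      ((h1.hasDerivAt τ).sub ((h4.hasDerivAt τ).const_smul c)).deriv]
    simp only [sub_zero, smul_sub, smul_add, smul_comm c σ]
    abel

/-! ### The eigenfunction -/

lemma continuous_uncurry_eig {q : ℝ → Fin n → ℂ} (hq : Continuous q) :
    Continuous (Function.uncurry (eig σ q)) := by
  have : Continuous fun x : ℝ × ℝ => Complex.exp (σ * x.2) • q (x.1 + x.2) := by fun_prop
  exact this

lemma continuous_eig {q : ℝ → Fin n → ℂ} (hq : Continuous q) (t : ℝ) : Continuous (eig σ q t) :=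
  (continuous_uncurry_eig hq).comp (continuous_const.prodMk continuous_id)

/-- The curve `τ ↦ φ(τ)` of eigenfunctions in `X^{⊙*}`. -/
noncomputable def eigCurve (h : ℝ) (σ : ℂ) (q : ℝ → Fin n → ℂ) (hq : Continuous q) (t : ℝ) :
    XSunStar n h :=
  (q t, contLp (-h) 0 (eig σ q t) (continuous_eig hq t))

lemma hasDerivAt_eigCurve {q : ℝ → Fin n → ℂ} (hq : IsCT T 1 q) (t : ℝ) :
    HasDerivAt (eigCurve h σ q hq.continuous)
      (eigCurve h σ (deriv q) (hq.continuous_deriv) t) t :=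
  (hq.hasDerivAt t).prodMk (hasDerivAt_contLp
    (continuous_uncurry_eig (hq.continuous_deriv)) _ _
    (fun t s => ((hq.hasDerivAt (t + s)).comp_add_const t s).const_smul _) t)

lemma isCT_eigCurve {q : ℝ → Fin n → ℂ} (hq : IsCT T 1 q) :
    IsCT T 1 (eigCurve h σ q hq.continuous) := by
  refine ⟨contDiff_one_iff_deriv.mpr ⟨fun t => (hasDerivAt_eigCurve hq t).differentiableAt, ?_⟩,
    fun t => ?_⟩
  · rw [show deriv (eigCurve h σ q hq.continuous) = eigCurve h σ (deriv q) hq.continuous_deriv from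
      funext fun t => (hasDerivAt_eigCurve hq t).deriv]
    have hdc := hq.continuous_deriv
    exact hdc.prodMk (continuous_contLp (continuous_uncurry_eig hdc) _)
  · have : eig σ q (t + T) = eig σ q t := funext fun s => by
      rw [eig, eig, add_right_comm, hq.2]
    simp only [eigCurve, hq.2 t, this]

lemma hasDerivAt_eig {q : ℝ → Fin n → ℂ} (hq : IsCT T 1 q) (τ s : ℝ) :
    HasDerivAt (eig σ q τ) (σ • eig σ q τ s + eig σ (deriv q) τ s) s := by
  have h1 : HasDerivAt (fun r : ℝ => Complex.exp (σ * r)) (Complex.exp (σ * s) * σ) s := by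
    have : HasDerivAt (fun r : ℝ => σ * (r : ℂ)) σ s := by
      simpa using (Complex.ofRealCLM.hasDerivAt (x := s)).const_mul σ
    exact this.cexp
  have h2 := h1.smul ((hq.hasDerivAt (τ + s)).comp_const_add τ s)
  convert! h2 using 1
  rw [eig, eig, add_comm, smul_smul, mul_comm σ (Complex.exp _)]

lemma isLipRep_eigCurve {q : ℝ → Fin n → ℂ} (hq : IsCT T 1 q) (τ : ℝ) :
    IsLipRep (eigCurve h σ q hq.continuous τ) (eig σ q τ) := by
  refine ⟨?_, by simp [eigCurve, eig], coeFn_contLp (continuous_eig hq.continuous τ)⟩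
  have h1 : ContDiff ℝ 1 (eig σ q τ) := by
    refine contDiff_one_iff_deriv.mpr ⟨fun s => (hasDerivAt_eig hq τ s).differentiableAt, ?_⟩
    rw [show deriv (eig σ q τ) = _ from funext fun s => (hasDerivAt_eig hq τ s).deriv]
    exact ((continuous_eig hq.continuous τ).const_smul σ).add
      (continuous_eig (hq.continuous_deriv) τ)
  exact h1.contDiffOn.exists_lipschitzOnWith (by decide) (convex_Icc _ _) isCompact_Icc

/-- The second component holds because `∂_s` of `e^{σs}q(τ+s)` equals `σ + ∂_τ` applied to it; the
first component is the equation `Δ(σ)q = 0`. -/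
lemma solves_eigCurve {q : ℝ → Fin n → ℂ} (hq : IsCT T 1 q) (hq0 : ∀ τ, charOp h ζ σ q τ = 0) :
    Solves T ζ σ (fun _ => 0) (eigCurve h σ q hq.continuous) := by
  have hE := isCT_eigCurve (h := h) (σ := σ) hq
  refine ⟨hE, ?_, fun τ => ⟨_, isLipRep_eigCurve hq τ, ?_, ?_⟩⟩
  · simp only [sub_zero]
    exact ⟨contDiff_zero.mpr (hE.const_smul σ).1.continuous, (hE.const_smul σ).2⟩
  · simp only [sub_zero]
    rw [(hasDerivAt_eigCurve hq τ).deriv]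
    change σ • q τ + deriv q τ = _
    have := hq0 τ
    rw [charOp, sub_eq_zero] at this
    rw [add_comm, this]
    refine kerInt_congr τ fun θ _ => ?_
    rw [eig, sub_eq_add_neg, Complex.ofReal_neg, mul_neg, neg_mul]
  · simp only [sub_zero]
    rw [(hasDerivAt_eigCurve hq τ).deriv]
    have hdc := hq.continuous_deriv
    have h1 := coeFn_contLp (a := -h) (b := 0) (continuous_eig (σ := σ) hq.continuous τ)
    have h2 := coeFn_contLp (a := -h) (b := 0) (continuous_eig (σ := σ) hdc τ)
    filter_upwards [h1, h2, Lp.coeFn_add (σ • contLp (-h) 0 (eig σ q τ)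
        (continuous_eig hq.continuous τ)) (contLp (-h) 0 (eig σ (deriv q) τ)
        (continuous_eig hdc τ)), Lp.coeFn_smul σ (contLp (-h) 0 (eig σ q τ)
        (continuous_eig hq.continuous τ))] with s e1 e2 e3 e4
    rw [(hasDerivAt_eig hq τ s).deriv, ← e1, ← e2]
    exact e3.trans (by rw [Pi.add_apply, e4, Pi.smul_apply])

end PeriodicDDE

namespace PeriodicDDE

variable {n : ℕ} {h T K : ℝ} {ζ : ℝ → ℝ → Matrix (Fin n) (Fin n) ℝ} {σ : ℂ}

/-! ### Solutions of the resolvent equation -/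

/-- A solution is represented by the variation-of-constants formula. -/
theorem Solves.exists_rep (hh : 0 < h) (hT : 0 < T) {w u : ℝ → XSunStar n h}
    (hw : IsCT T 0 w) (hu : Solves T ζ σ w u) :
    ∃ φ : ℝ → ℝ → Fin n → ℂ, (∀ τ, IsLipRep (u τ) (φ τ)) ∧
      (∀ τ, (σ • u τ - w τ + deriv u τ).1 = kerInt h ζ τ fun θ => φ τ (-θ)) ∧
      ∀ τ, EqOn (φ τ) (varConst σ w (fun t => (u t).1) τ) (Icc (-h) 0) := by
  obtain ⟨h1, -, h2⟩ := hu
  choose φ hφ h3 h4 using h2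
  refine ⟨φ, hφ, h3, fun τ θ hθ => eq_varConst hh hT h1 hw hφ (fun t => ?_) τ hθ⟩
  have : σ • (u t).2 + (deriv u t - w t).2 = (σ • u t - w t + deriv u t).2 := by
    simp only [Prod.snd_add, Prod.snd_sub, Prod.smul_snd]
    abel
  rw [this]
  exact h4 t

lemma Solves.isLipRep (hh : 0 < h) (hT : 0 < T) {w u : ℝ → XSunStar n h} (hw : IsCT T 0 w)
    (hu : Solves T ζ σ w u) (τ : ℝ) :
    IsLipRep (u τ) (varConst σ w (fun t => (u t).1) τ) := by
  obtain ⟨φ, hφ, -, he⟩ := hu.exists_rep hh hT hw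
  exact (hφ τ).congr hh (he τ)

lemma Solves.isCT_fst {w u : ℝ → XSunStar n h} (hu : Solves T ζ σ w u) :
    IsCT T 1 fun t => (u t).1 :=
  hu.1.clm (ContinuousLinearMap.fst ℝ _ _)

lemma Solves.ext_of_fst (hh : 0 < h) (hT : 0 < T) {w u u' : ℝ → XSunStar n h} (hw : IsCT T 0 w)
    (hu : Solves T ζ σ w u) (hu' : Solves T ζ σ w u') (he : ∀ t, (u t).1 = (u' t).1) : u = u' := by
  funext τ
  refine Prod.ext (he τ) (Lp.ext ?_)
  have h1 := (hu.isLipRep hh hT hw τ).2.2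
  have h2 := (hu'.isLipRep hh hT hw τ).2.2
  rw [← funext he] at h2
  exact h1.trans h2.symm

lemma varConst_neg (w : ℝ → XSunStar n h) (v : ℝ → Fin n → ℂ) (τ θ : ℝ) :
    varConst σ w v τ (-θ) = Complex.exp (-σ * θ) • (v (τ - θ) +
      ∫ r in (-θ)..(0 : ℝ), Complex.exp (-σ * r) • ev w (τ - θ - r) r) := by
  rw [varConst, smul_add, ← intervalIntegral.integral_smul]
  congr 1
  · rw [Complex.ofReal_neg, mul_neg, neg_mul, sub_eq_add_neg]
  · refine intervalIntegral.integral_congr fun r _ => ?_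
    simp only [smul_smul, ← Complex.exp_add, Complex.ofReal_neg, ← sub_eq_add_neg]
    congr 2
    ring

lemma smul_integral_ev (w : ℝ → XSunStar n h) (τ θ : ℝ) :
    Complex.exp (-σ * θ) • ∫ r in (-θ)..(0 : ℝ), Complex.exp (-σ * r) • ev w (τ - θ - r) r
      = ∫ s in (0 : ℝ)..θ, Complex.exp (-σ * s) • ev w (τ - s) (s - θ) := by
  have h1 := intervalIntegral.integral_comp_sub_right (a := (0 : ℝ)) (b := θ)
    (fun r : ℝ => Complex.exp (-σ * θ) • (Complex.exp (-σ * r) • ev w (τ - θ - r) r)) θ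
  rw [zero_sub, sub_self] at h1
  rw [← intervalIntegral.integral_smul, ← h1]
  refine intervalIntegral.integral_congr fun s _ => ?_
  simp only [smul_smul, ← Complex.exp_add, Complex.ofReal_sub]
  rw [show -σ * (θ : ℂ) + -σ * (s - θ) = -σ * s by ring, show τ - θ - (s - θ) = τ - s by ring]

/-- The first component of a solution solves the characteristic equation. -/
theorem KernelBounds.charOp_fst_eq (B : KernelBounds h T K ζ) (hT : 0 < T)
    {w u : ℝ → XSunStar n h} (hw : IsCT T 0 w) (hu : Solves T ζ σ w u) (τ : ℝ) :
    charOp h ζ σ (fun t => (u t).1) τ = xiRhs ζ σ w τ := by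
  obtain ⟨φ, hφ, h1, he⟩ := hu.exists_rep B.pos hT hw
  have hc := hu.isCT_fst.continuous
  have h2 : (σ • u τ - w τ + deriv u τ).1
      = σ • (u τ).1 - (w τ).1 + deriv (fun t => (u t).1) τ := by
    rw [show deriv (fun t => (u t).1) τ = (deriv u τ).1 from
      ((hasFDerivAt_fst (𝕜 := ℝ) (p := u τ)).comp_hasDerivAt τ (hu.1.hasDerivAt τ)).deriv]
    rfl
  have h3 : kerInt h ζ τ (fun θ => φ τ (-θ))
      - kerInt h ζ τ (fun θ => Complex.exp (-σ * θ) • (u (τ - θ)).1)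
      = kerInt h ζ τ
        (fun θ => ∫ s in (0 : ℝ)..θ, Complex.exp (-σ * s) • ev w (τ - s) (s - θ)) := by
    have h4 : Continuous fun θ : ℝ => Complex.exp (-σ * θ) • (u (τ - θ)).1 :=
      (show Continuous fun θ : ℝ => Complex.exp (-σ * θ) by fun_prop).smul
        (hc.comp (continuous_const.sub continuous_id))
    rw [← B.kerInt_sub τ (hφ τ).continuousOn_comp_neg h4.continuousOn]
    refine kerInt_congr τ fun θ hθ => ?_
    rw [he τ ⟨by linarith [hθ.2], by linarith [hθ.1]⟩, varConst_neg, smul_add, smul_integral_ev,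
      add_sub_cancel_left]
  rw [charOp, xiRhs, ← h3, ← h1, h2]
  abel

/-! ### The pairing of solutions with the adjoint eigenfunction -/

lemma smul_dotProduct_smul_cancel (θ : ℝ) (a b : Fin n → ℂ) :
    (Complex.exp (σ * θ) • a) ⬝ᵥ (Complex.exp (-σ * θ) • b) = a ⬝ᵥ b := by
  rw [smul_dotProduct, dotProduct_smul, smul_smul, ← Complex.exp_add,
    show σ * θ + -σ * θ = 0 by ring, Complex.exp_zero, one_smul]

/-- The exponentials of `adjEig` and `eig` cancel, leaving the double integral of
`pairT_charOpDeriv`. The normalization thus becomes `⟨p, Δ'(σ)q⟩_T = 1`. -/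
theorem KernelBounds.pairEig_eq (B : KernelBounds h T K ζ) (hT : 0 < T) {p q : ℝ → Fin n → ℂ}
    (hp : IsCT T 1 p) (hq : IsCT T 1 q) :
    pairEig h T ζ σ p q = pairT T p (charOpDeriv h ζ σ q) := by
  have hpc := hp.continuous
  have hqc := hq.continuous
  have hΦ : Continuous (Function.uncurry fun τ θ : ℝ => q (τ - θ)) :=
    hqc.comp (continuous_fst.sub continuous_snd)
  rw [B.pairT_charOpDeriv hT hp hq, pairEig, pairT, ← intervalIntegral.integral_add
    ((continuous_dotProduct hpc hqc).intervalIntegrable _ _)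
    (B.tendsto_integral_integral_adjSum hT hpc hp.2 hΦ).1]
  refine intervalIntegral.integral_congr fun τ _ => ?_
  simp only [pairSun]
  congr 1
  · simp [eig]
  · refine intervalIntegral.integral_congr fun θ hθ => ?_
    rw [uIcc_of_le B.pos.le] at hθ
    simp only [B.adjEig_eq hpc τ hθ, eig]
    rw [Complex.ofReal_neg, mul_neg, ← neg_mul, smul_dotProduct_smul_cancel, sub_eq_add_neg]

/-- By the variation-of-constants formula, `e^{σθ}v(τ)(-θ)` is `v₀(τ-θ)` plus an integral of `w`.
Paired with the adjoint integral, the former yields together with `⟨p, v₀⟩_T` the term `⟨p,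
Δ'(σ)v₀⟩_T`, the latter the second term of `muCoeff`. -/
theorem KernelBounds.pairSunStar_eq (B : KernelBounds h T K ζ) (hT : 0 < T) {p : ℝ → Fin n → ℂ}
    (hp : IsCT T 1 p) {w u : ℝ → XSunStar n h} (hw : IsCT T 0 w) (hu : Solves T ζ σ w u) :
    pairSunStar T ζ σ p u = -muCoeff T ζ σ w p fun t => (u t).1 := by
  have hpc := hp.continuous
  have hh := B.pos
  have hu0 := hu.isCT_fst
  have huc := hu0.continuous
  obtain ⟨φ, hφ, -, he⟩ := hu.exists_rep hh hT hw
  set Φ : ℝ → ℝ → Fin n → ℂ := fun τ θ => (u (τ - θ)).1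
  -- On `[0,h]` this is the integral of `w` in `muCoeff`, but written through the Lipschitz
  -- representatives its joint continuity in `(τ, θ)` is visible.
  set W : ℝ → ℝ → Fin n → ℂ := fun τ θ =>
    Complex.exp (σ * θ) • φ τ (clamp h (-θ)) - (u (τ - θ)).1
  have hΦ : Continuous (Function.uncurry Φ) := huc.comp (continuous_fst.sub continuous_snd)
  have hW : Continuous (Function.uncurry W) := by
    have h1 : Continuous fun x : ℝ × ℝ => φ x.1 (clamp h (-x.2)) :=
      (continuous_uncurry_clamp hh hu.1.continuous hφ).comp
        (continuous_fst.prodMk continuous_snd.neg)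
    have h2 : Continuous fun x : ℝ × ℝ => Complex.exp (σ * x.2) := by fun_prop
    exact (h2.smul h1).sub hΦ
  have hWeq : ∀ τ, ∀ θ ∈ Icc 0 h,
      W τ θ = ∫ r in (-θ)..(0 : ℝ), Complex.exp (-σ * r) • ev w (τ - θ - r) r := by
    intro τ θ hθ
    have hm : -θ ∈ Icc (-h) 0 := ⟨by linarith [hθ.2], by linarith [hθ.1]⟩
    simp only [W]
    rw [clamp_of_mem hm, he τ hm, varConst_neg, smul_smul, ← Complex.exp_add,
      show σ * θ + -σ * θ = 0 by ring, Complex.exp_zero, one_smul, add_sub_cancel_left]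
  have iΦ := B.tendsto_integral_adjSum (σ := σ) hT hpc hp.2 hΦ
  have iW := B.tendsto_integral_adjSum (σ := σ) hT hpc hp.2 hW
  have iΦ' := (B.tendsto_integral_integral_adjSum (σ := σ) hT hpc hp.2 hΦ).1
  have iW' := (B.tendsto_integral_integral_adjSum (σ := σ) hT hpc hp.2 hW).1
  have e1 : muCoeff T ζ σ w p (fun t => (u t).1) = -pairT T p (charOpDeriv h ζ σ fun t => (u t).1)
      - ∫ τ in (0 : ℝ)..T, ∫ θ in (0 : ℝ)..h, adjInt h ζ σ p (τ - θ) θ ⬝ᵥ W τ θ := by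
    rw [muCoeff, sub_right_inj]
    refine intervalIntegral.integral_congr fun τ _ => intervalIntegral.integral_congr fun θ hθ => ?_
    rw [uIcc_of_le hh.le] at hθ
    simp only [hWeq τ θ hθ, muCoeff_integrand_eq]
  have iP : IntervalIntegrable (fun τ => p τ ⬝ᵥ (u τ).1) volume 0 T :=
    (continuous_dotProduct hpc huc).intervalIntegrable _ _
  have e2 : -muCoeff T ζ σ w p (fun t => (u t).1)
      = ∫ τ in (0 : ℝ)..T, (p τ ⬝ᵥ (u τ).1 + (∫ θ in (0 : ℝ)..h, adjInt h ζ σ p (τ - θ) θ ⬝ᵥ Φ τ θ)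
        + ∫ θ in (0 : ℝ)..h, adjInt h ζ σ p (τ - θ) θ ⬝ᵥ W τ θ) := by
    rw [intervalIntegral.integral_add (iP.add iΦ') iW', intervalIntegral.integral_add iP iΦ', e1,
      B.pairT_charOpDeriv hT hp hu0, pairT]
    simp only [Φ]
    ring
  rw [e2, pairSunStar]
  refine intervalIntegral.integral_congr fun τ _ => ?_
  simp only [pairSun]
  rw [add_assoc, ← intervalIntegral.integral_add (iΦ τ).1 (iW τ).1]
  congr 1
  refine intervalIntegral.integral_congr_ae ?_
  have h3 : ∀ᵐ θ : ℝ, θ ∈ Icc (-h) 0 → (u τ).2 θ = φ τ θ :=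
    (ae_restrict_iff' measurableSet_Icc).mp (hφ τ).2.2
  filter_upwards [(Measure.measurePreserving_neg volume).quasiMeasurePreserving.ae h3] with θ h4 hθ
  rw [uIoc_of_le hh.le] at hθ
  have hm : -θ ∈ Icc (-h) 0 := ⟨by linarith [hθ.2], by linarith [hθ.1]⟩
  rw [h4 hm, B.adjEig_eq hpc τ (Ioc_subset_Icc_self hθ), ← dotProduct_add]
  simp only [Φ, W]
  rw [add_sub_cancel, clamp_of_mem hm, smul_dotProduct, dotProduct_smul]

lemma pairT_sub_smul {p q ξ : ℝ → Fin n → ℂ} (hp : Continuous p) (hξ : Continuous ξ)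
    (hq : Continuous q) (c : ℂ) :
    pairT T p (fun t => ξ t - c • q t) = pairT T p ξ - c * pairT T p q := by
  simp only [pairT, dotProduct_sub, dotProduct_smul, smul_eq_mul]
  rw [intervalIntegral.integral_sub ((continuous_dotProduct hp hξ).intervalIntegrable _ _)
    (((continuous_dotProduct hp hq).intervalIntegrable _ _).const_mul c),
    intervalIntegral.integral_const_mul]

lemma KernelBounds.pairT_charOpDeriv_sub_smul (B : KernelBounds h T K ζ) (hT : 0 < T)
    {p q ξ : ℝ → Fin n → ℂ} (hp : IsCT T 1 p) (hq : IsCT T 1 q) (hξ : IsCT T 1 ξ) (c : ℂ) :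
    pairT T p (charOpDeriv h ζ σ fun t => ξ t - c • q t)
      = pairT T p (charOpDeriv h ζ σ ξ) - c * pairT T p (charOpDeriv h ζ σ q) := by
  have hpc := hp.continuous
  have hshift : ∀ {r : ℝ → Fin n → ℂ}, IsCT T 1 r →
      Continuous (Function.uncurry fun τ θ : ℝ => r (τ - θ)) := fun hr =>
    hr.continuous.comp (continuous_fst.sub continuous_snd)
  have i1 := fun {r} (hr : IsCT T 1 r) => B.tendsto_integral_adjSum (σ := σ) hT hpc hp.2 (hshift hr)
  have i2 := fun {r} (hr : IsCT T 1 r) =>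
    (B.tendsto_integral_integral_adjSum (σ := σ) hT hpc hp.2 (hshift hr)).1
  rw [B.pairT_charOpDeriv hT hp (hξ.sub (hq.const_smul c)), B.pairT_charOpDeriv hT hp hξ,
    B.pairT_charOpDeriv hT hp hq]
  have e2 : ∫ τ in (0 : ℝ)..T, ∫ θ in (0 : ℝ)..h,
      adjInt h ζ σ p (τ - θ) θ ⬝ᵥ (ξ (τ - θ) - c • q (τ - θ))
      = (∫ τ in (0 : ℝ)..T, ∫ θ in (0 : ℝ)..h, adjInt h ζ σ p (τ - θ) θ ⬝ᵥ ξ (τ - θ))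
        - c * ∫ τ in (0 : ℝ)..T, ∫ θ in (0 : ℝ)..h, adjInt h ζ σ p (τ - θ) θ ⬝ᵥ q (τ - θ) := by
    rw [← intervalIntegral.integral_const_mul,
      ← intervalIntegral.integral_sub (i2 hξ) ((i2 hq).const_mul c)]
    refine intervalIntegral.integral_congr fun τ _ => ?_
    simp only [dotProduct_sub, dotProduct_smul, smul_eq_mul]
    rw [intervalIntegral.integral_sub (i1 hξ τ).1 ((i1 hq τ).1.const_mul c),
      intervalIntegral.integral_const_mul]
  rw [pairT_sub_smul hpc hξ.continuous hq.continuous, e2]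
  ring

/-- The `w`-term of `μ` does not involve `ξ`, and the other is linear in `ξ` with value `-1` at `q`
by the normalization. -/
lemma KernelBounds.muCoeff_sub_smul (B : KernelBounds h T K ζ) (hT : 0 < T) {p q ξ : ℝ → Fin n → ℂ}
    (hp : IsCT T 1 p) (hq : IsCT T 1 q) (hξ : IsCT T 1 ξ) (hnorm : pairEig h T ζ σ p q = 1)
    (w : ℝ → XSunStar n h) (c : ℂ) :
    muCoeff T ζ σ w p (fun t => ξ t - c • q t) = muCoeff T ζ σ w p ξ + c := by
  rw [muCoeff, muCoeff, B.pairT_charOpDeriv_sub_smul hT hp hq hξ, ← B.pairEig_eq hT hp hq, hnorm]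
  ring

end PeriodicDDE

/-! ### Proof of the theorem -/

open PeriodicDDE

theorem proposition3p13 (n : ℕ) (h T : ℝ) (hh : 0 < h) (hT : 0 < T)
    (L : ℝ → C(Set.Icc (-h) 0, Fin n → ℝ) →L[ℝ] (Fin n → ℝ))
    (hL : PeriodicDDE.IsCT T 1 L)
    (ζ : ℝ → ℝ → Matrix (Fin n) (Fin n) ℝ)
    (hζ : PeriodicDDE.IsKernel h T hh L ζ)
    (σ : ℂ) (hσ : PeriodicDDE.IsSimpleFloquetExponent h T ζ σ)
    (q : ℝ → Fin n → ℂ) (hq : PeriodicDDE.IsCT T 1 q)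
    (hq0 : ∀ τ, PeriodicDDE.charOp h ζ σ q τ = 0)
    (p : ℝ → Fin n → ℂ) (hp : PeriodicDDE.IsCT T 1 p)
    (hp0 : ∀ τ, PeriodicDDE.charOpAdj h ζ σ p τ = 0)
    (hnorm : PeriodicDDE.pairEig h T ζ σ p q = 1)
    (w : ℝ → PeriodicDDE.XSunStar n h) (hw : PeriodicDDE.IsCT T 0 w)
    (hcons : ∃ u, PeriodicDDE.Solves T ζ σ w u) :
    ∃ v : ℝ → PeriodicDDE.XSunStar n h,
      -- `v = (v₀, v)` is the unique solution with vanishing pairing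
      (PeriodicDDE.Solves T ζ σ w v ∧ PeriodicDDE.pairSunStar T ζ σ p v = 0 ∧
        ∀ u, PeriodicDDE.Solves T ζ σ w u → PeriodicDDE.pairSunStar T ζ σ p u = 0 → u = v) ∧
      -- the explicit representation, for every solution `ξ` of the characteristic equation
      (∀ ξ : ℝ → Fin n → ℂ, PeriodicDDE.IsCT T 1 ξ →
        (∀ τ, PeriodicDDE.charOp h ζ σ ξ τ = PeriodicDDE.xiRhs ζ σ w τ) →
        ∀ τ, (v τ).1 = ξ τ + PeriodicDDE.muCoeff T ζ σ w p ξ • q τ ∧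
          PeriodicDDE.IsLipRep (v τ) (PeriodicDDE.varConst σ w (fun t => (v t).1) τ)) ∧
      -- such `ξ` exist
      (∃ ξ : ℝ → Fin n → ℂ, PeriodicDDE.IsCT T 1 ξ ∧
        ∀ τ, PeriodicDDE.charOp h ζ σ ξ τ = PeriodicDDE.xiRhs ζ σ w τ) ∧
      -- the bordered inverse selects exactly one of them when `⟨p,q⟩_T ≠ 0`
      (PeriodicDDE.pairT T p q ≠ 0 →
        ∃! ξ : ℝ → Fin n → ℂ,
          PeriodicDDE.IsBorderedSol h T ζ σ p (PeriodicDDE.xiRhs ζ σ w) ξ) := by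
  obtain ⟨K, B⟩ := hζ.exists_kernelBounds hT hL
  obtain ⟨u, hu⟩ := hcons
  -- For `q = 0` the normalized pairing would be `0` instead of `1`.
  have hqne : ∃ t, q t ≠ 0 := by
    by_contra! H
    obtain rfl : q = fun _ => 0 := funext H
    rw [B.pairEig_eq hT hp hq, B.pairT_charOpDeriv hT hp hq] at hnorm
    simp [pairT] at hnorm
  have hker : ∀ ξ ξ' : ℝ → Fin n → ℂ, IsCT T 1 ξ → IsCT T 1 ξ' →
      (∀ τ, charOp h ζ σ ξ τ = xiRhs ζ σ w τ) → (∀ τ, charOp h ζ σ ξ' τ = xiRhs ζ σ w τ) →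
      ∃ c : ℂ, ξ = fun t => ξ' t - c • q t := by
    intro ξ ξ' hξ hξ' h1 h2
    obtain ⟨c, hc⟩ := B.exists_eq_smul_of_charOp_eq_zero hT hσ hq hq0 hqne (hξ'.sub hξ)
      fun τ => by rw [B.charOp_sub hξ' hξ, h1, h2, sub_self]
    exact ⟨c, funext fun t => by rw [← hc t, sub_sub_cancel]⟩
  have hu0 := hu.isCT_fst
  have huw := B.charOp_fst_eq hT hw hu
  -- The eigencurve has pairing `1` with the adjoint eigenfunction, so subtracting `c` times it
  -- projects `u` onto the solutions with zero pairing.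
  set c := pairSunStar T ζ σ p u with hc
  set v : ℝ → XSunStar n h := fun t => u t - c • eigCurve h σ q hq.continuous t with hv
  have hvs : Solves T ζ σ w v := B.solves_sub_smul hu (solves_eigCurve hq hq0) c
  have hv1 : (fun t => (v t).1) = fun t => (u t).1 - c • q t := rfl
  have hmu : muCoeff T ζ σ w p (fun t => (v t).1) = 0 := by
    rw [hv1, B.muCoeff_sub_smul hT hp hq hu0 hnorm, hc, B.pairSunStar_eq hT hp hw hu, add_neg_cancel]
  have hfst : ∀ ξ : ℝ → Fin n → ℂ, IsCT T 1 ξ → (∀ τ, charOp h ζ σ ξ τ = xiRhs ζ σ w τ) →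
      ∀ τ, (v τ).1 = ξ τ + muCoeff T ζ σ w p ξ • q τ := by
    intro ξ hξ hξw τ
    -- Here `ξ = v₀ - d q`, and `μ(v₀) = 0` forces `μ(ξ) = d`: the coefficient `μ` measures exactly
    -- the missing multiple of `q`.
    obtain ⟨d, hd⟩ := hker _ _ hξ hvs.isCT_fst hξw (B.charOp_fst_eq hT hw hvs)
    have h1 : muCoeff T ζ σ w p ξ = d := by
      rw [hd, B.muCoeff_sub_smul hT hp hq hvs.isCT_fst hnorm, hmu, zero_add]
    rw [h1, congrFun hd τ, sub_add_cancel]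
  refine ⟨v, ⟨hvs, by rw [B.pairSunStar_eq hT hp hw hvs, hmu, neg_zero], fun u' hu' h0 => ?_⟩,
    fun ξ hξ hξw τ => ⟨hfst ξ hξ hξw τ, hvs.isLipRep hh hT hw τ⟩, ⟨_, hu0, huw⟩, fun hpq => ?_⟩
  · refine hu'.ext_of_fst hh hT hw hvs fun t => ?_
    rw [B.pairSunStar_eq hT hp hw hu', neg_eq_zero] at h0
    rw [hfst _ hu'.isCT_fst (B.charOp_fst_eq hT hw hu') t, h0, zero_smul, add_zero]
  · have hpair : ∀ (ξ : ℝ → Fin n → ℂ), IsCT T 1 ξ → ∀ d : ℂ,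
        pairT T p (fun t => ξ t - d • q t) = pairT T p ξ - d * pairT T p q := fun ξ hξ d =>
      pairT_sub_smul hp.continuous hξ.continuous hq.continuous d
    -- The multiple of `q` whose removal makes the pairing with `p` vanish; it is unique since
    -- `⟨p,q⟩_T ≠ 0`.
    set d := pairT T p (fun t => (u t).1) / pairT T p q
    refine ⟨fun t => (u t).1 - d • q t, ⟨hu0.sub (hq.const_smul d), fun τ => ?_, ?_⟩, ?_⟩
    · rw [B.charOp_sub hu0 (hq.const_smul d), B.charOp_smul hq, hq0, smul_zero, sub_zero, huw]
    · rw [hpair _ hu0, div_mul_cancel₀ _ hpq, sub_self]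
    · rintro ξ ⟨hξ, hξw, h0⟩
      obtain ⟨e, he⟩ := hker _ _ hξ hu0 hξw huw
      have hed : e = d := by
        rw [he, hpair _ hu0, sub_eq_zero] at h0
        exact (eq_div_of_mul_eq hpq h0.symm)
      rw [he, hed]
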